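/- Let $\alpha\in(0,1)$ and $f\in C^\infty(\mathbb{R})$. For $g\in C^1_b(\mathbb{R})$ let $$\mathcal{D}^\alpha[g](x)=\frac{1}{\Gamma(1-\alpha)}\int_{-\infty}^x\frac{g'(z)}{(x-z)^\alpha}\,dz,$$ where the integral is understood as the limit of $\int_a^x$ as $a\to-\infty$, and consider the equation $$\partial_t u+\partial_x f(u)=\partial_x\mathcal{D}^\alpha[u]. \qquad (1)$$ For $t>0$, $x\in\mathbb{R}$ let $$K(t,x)=\frac1{2\pi}\int_{\mathbb{R}}e^{t(i\xi)^{\alpha+1}}e^{i\xi x}\,d\xi$$ (with the principal branch of the power). For $u_0\in L^\infty(\mathbb{R})$ and $T\in(0,\infty]$, a mild solution of (1) on $(0,T)\times\mathbb{R}$ with initial datum $u_0$ is a function $u\in L^\infty((0,T)\times\mathbb{R})$ such that $$u(t,x)=K(t,\cdot)*u_0(x)-\int_0^t\partial_xK(t-s,\cdot)*f(u(s,\cdot))(x)\,ds\quad\text{for a.e. }(t,x)\in(0,T)\times\mathbb{R}.$$ For $k\in\mathbb{N}\cup\{\infty\}$ write $u\in\mathcal{C}^k_T$ if, for every $\delta>0$,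 $u$ is of class $C^k$ on $(\delta,T)\times\mathbb{R}$ and all its derivatives of order at most $k$ are bounded there; every function in $C^k_b((0,T)\times\mathbb{R})$ belongs to $\mathcal{C}^k_T$. Let $\|\cdot\|_\infty$ be the norm of $L^\infty(\mathbb{R})$. (a) Let $T\in(0,\infty]$. If $u\in\mathcal{C}^2_T$ satisfies (1) at every point of $(0,T)\times\mathbb{R}$, then $$\|u(t,\cdot)\|_\infty\le\|u(t',\cdot)\|_\infty\quad\text{for all }0<t'<t<T.$$ (b) Let $u_0\in L^\infty(\mathbb{R})$ and $T\in(0,\infty]$. If $u\in\mathcal{C}^\infty_T$ is a mild solution of (1) on $(0,T)\times\mathbb{R}$ with initial datum $u_0$, then $$\|u(t,\cdot)\|_\infty\le\|u_0\|_\infty\quad\text{for all }t\in(0,T),$$ and $u$ extends globally in time: there is a mild solution $v\in\mathcal{C}^\infty_\infty$ of (1) on $(0,\infty)\times\mathbb{R}$ with initial datum $u_0$ such that $v=u$ on $(0,T)\times\mathbb{R}$ and $\|v(t,\cdot)\|_\infty\le\|u_0\|_\infty$ for all $t>0$. (c) For every $u_0\in L^\infty(\mathbb{R})$ there is a mild solution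 $v\in\mathcal{C}^\infty_\infty$ of (1) on $(0,\infty)\times\mathbb{R}$ with initial datum $u_0$, and $\|v(t,\cdot)\|_\infty\le\|u_0\|_\infty$ for all $t>0$. -/

import Mathlib

open scoped ContDiff

noncomputable section

namespace FracConsLaw

open MeasureTheory Filter

/-- The time interval `(0, T)`, for `T ∈ (0, ∞]`; more generally `(δ, T)`. -/
def timeIoo (δ : ℝ) (T : EReal) : Set ℝ := {t : ℝ | δ < t ∧ (t : EReal) < T}

/-- The strip `(δ, T) × ℝ` of points `(t, x)`. -/
def strip (δ : ℝ) (T : EReal) : Set (ℝ × ℝ) := timeIoo δ T ×ˢ Set.univ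

/-- `w ∈ C_b^k(U)` for an open set `U`: `w` is `k` times continuously differentiable on `U`, and
each of its derivatives of order at most `k` is bounded on `U`. -/
def CbOn (k : ℕ∞) (U : Set (ℝ × ℝ)) (w : ℝ × ℝ → ℝ) : Prop :=
  ContDiffOn ℝ k w U ∧
    ∀ m : ℕ, (m : ℕ∞) ≤ k → ∃ C : ℝ, ∀ p ∈ U, ‖iteratedFDeriv ℝ m w p‖ ≤ C

/-- `C_b^k` regularity on `(0, T) × ℝ` with bounds that may degenerate as `t → 0⁺`: the function
belongs to `C_b^k((δ, T) × ℝ)` for every `δ > 0`. This is weaker than membership in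
`C_b^k((0, T) × ℝ)` with bounds up to `t = 0`; derivatives of solutions with merely bounded
initial data do blow up as `t → 0⁺`. -/
def CbAwayFromZero (k : ℕ∞) (T : EReal) (u : ℝ → ℝ → ℝ) : Prop :=
  ∀ δ : ℝ, 0 < δ → CbOn k (strip δ T) (Function.uncurry u)

/-- The operator `D^α[g](x) = (1 / Γ(1 - α)) ∫_{-∞}^x g'(z) / (x - z)^α dz`. For `g ∈ C_b^1(ℝ)`
the integral converges at `-∞` in general only conditionally (take `g = sin`), so it is the
improper integral `lim_{a → -∞} ∫_a^x`. -/
def fracDer (α : ℝ) (g : ℝ → ℝ) (x : ℝ) : ℝ :=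
  (Real.Gamma (1 - α))⁻¹ *
    limUnder atBot (fun a : ℝ => ∫ z in a..x, deriv g z / (x - z) ^ α)

/-- `u` satisfies `∂_t u + ∂_x f(u) = ∂_x D^α[u]` at every point of `(0, T) × ℝ`. -/
def SolvesEquation (α : ℝ) (f : ℝ → ℝ) (T : EReal) (u : ℝ → ℝ → ℝ) : Prop :=
  ∀ t ∈ timeIoo 0 T, ∀ x : ℝ,
    deriv (fun s => u s x) t + deriv (fun y => f (u t y)) x = deriv (fracDer α (u t)) x

/-- The kernel `K(t, x) = (1 / 2π) ∫ exp(t (iξ)^{α+1}) exp(iξx) dξ`, with the principal branch of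
the power. The integral is real, since the values of the integrand at `ξ` and `-ξ` are conjugate.
The factor `1 / 2π` is the one for which `K(t, ·)` has mass one. -/
def kernel (α t x : ℝ) : ℝ :=
  (2 * Real.pi)⁻¹ *
    (∫ ξ : ℝ, Complex.exp ((t : ℂ) * (Complex.I * (ξ : ℂ)) ^ ((α : ℂ) + 1)) *
      Complex.exp (Complex.I * (ξ : ℂ) * (x : ℂ))).re

/-- The right-hand side of the Duhamel formula,
`K(t, ·) * u₀ (x) - ∫_0^t (∂_x K(t - s, ·)) * f(u(s, ·)) (x) ds`. -/
def duhamel (α : ℝ) (f u₀ : ℝ → ℝ) (u : ℝ → ℝ → ℝ) (t x : ℝ) : ℝ :=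
  (∫ y : ℝ, kernel α t (x - y) * u₀ y) -
    ∫ s in (0 : ℝ)..t, ∫ y : ℝ, deriv (kernel α (t - s)) (x - y) * f (u s y)

/-- `u` is a mild solution on `(0, T) × ℝ` with initial datum `u₀`: it is in `L^∞((0, T) × ℝ)` and
satisfies the Duhamel formula almost everywhere in `(0, T) × ℝ`. -/
def IsMildSolution (α : ℝ) (f u₀ : ℝ → ℝ) (T : EReal) (u : ℝ → ℝ → ℝ) : Prop :=
  MemLp (Function.uncurry u) ⊤ (volume.restrict (strip 0 T)) ∧
    ∀ᵐ p : ℝ × ℝ ∂(volume.restrict (strip 0 T)), u p.1 p.2 = duhamel α f u₀ u p.1 p.2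

/-- The class of solutions furnished by the local existence theory: mild solutions in `C_b^∞`,
the bounds on the derivatives holding away from `t = 0`. -/
def IsSmoothMildSolution (α : ℝ) (f u₀ : ℝ → ℝ) (T : EReal) (u : ℝ → ℝ → ℝ) : Prop :=
  IsMildSolution α f u₀ T u ∧ CbAwayFromZero ⊤ T u

/-- The norm of `L^∞(ℝ)`, with value `∞` for essentially unbounded functions. -/
def supNorm (g : ℝ → ℝ) : ENNReal := eLpNorm g ⊤ volume

end FracConsLaw

end

noncomputable section

namespace FracConsLaw

open MeasureTheory Filter Set
open scoped Topology Real

/-! For `ξ > 0` the symbol `(iξ)^{α+1}` has real part `-decay α * ξ^{α+1}`, with `decay α > 0`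
because `0 < α < 1`. The linear part is therefore parabolic of order `α + 1 > 1`. All kernels needed
belong to one family `G α q t`, with symbol `(iξ)^q exp(t(iξ)^{α+1})`: a space derivative raises `q`
by one, a time derivative raises it by `α + 1`. Integration by parts in `ξ` gives a recurrence and
hence decay like `x⁻²` (`G_decay`). By self-similarity `∂ₓK(t)` has `L¹` norm of order
`t^{-1/(α+1)}`, which is integrable at `t = 0`. This drives the whole fixed point theory.

Existence is first proved for a flux with compact support, which is globally Lipschitz: the Duhamel
map contracts in a sup norm weighted by `e^{-γt}`, for `γ` large (`exists_globalMild`).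

Smoothness comes from moving frames. The function `u(λt, x + μt)` satisfies a fixed point equation
in which, after self-similar scaling, `(λ, μ)` enters only through bounded multipliers that depend
smoothly on them. The implicit function theorem in a space of bounded continuous functions makes the
solution smooth in `(λ, μ)` near `(1, 0)`, and those derivatives are the space-time derivatives of
`u` weighted by powers of `t` (`regularity`). Working with a sequence of solutions at once gives
constants common to all restarting times, hence bounds on `(δ, ∞)`.

The maximum principle rests on writing `∂ₓD^α g` as a positive multiple of `∫₀^∞ (g(x-z) - g(x) + z
g'(x)) z^{-α-2} dz`. The weight is positive, so at a spatial maximum this is nonpositive. Since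
maxima on the line need not be attained, the solution is penalized by `ε(t - t')` and by a small
multiple of `√(1 + x²)` (`le_const_of_linear`).

To apply it to mild solutions they must solve the equation pointwise. The Marchaud derivative is
shown to have symbol `(iξ)^α` (`laplaceExp_I`, `marchaud_G`), and the Duhamel formula restarted at
time `t` is differentiated from the right at `t` (`solves_at_of_restart`).

Reaching the initial datum requires the `L¹` norm of `K(t)` to be exactly one. Mass one is the value
of the symbol at zero. Positivity of `K` is deduced from the maximum principle itself, applied to
the linear flow of Lipschitz data (`G_zero_nonneg`). Then `|u(t')| ≤ ‖u₀‖ + o(1)` as `t' → 0`, and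
the maximum principle propagates this bound to all later times. Consequently the solution never
leaves the region where the truncated flux equals `f`, which gives the global solution. Uniqueness
identifies any given smooth mild solution with it, and so transfers both the bound and the
extension. -/

/-! ### Oscillatory-integral kernels: derivatives, recurrence, decay, scaling -/

/-- The unit complex number `i ^ (α + 1)`. -/
def omega (α : ℝ) : ℂ := Complex.exp (Complex.I * (π * (α + 1) / 2 : ℝ))

/-- Decay rate of the symbol: minus the real part of `i ^ (α + 1)`. -/
def decay (α : ℝ) : ℝ := -Real.cos (π * (α + 1) / 2)

lemma decay_pos {α : ℝ} (h0 : 0 < α) (h1 : α < 1) : 0 < decay α := by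
  unfold decay
  have := Real.cos_neg_of_pi_div_two_lt_of_lt (x := π * (α + 1) / 2)
    (by nlinarith [Real.pi_pos]) (by nlinarith [Real.pi_pos])
  linarith

lemma omega_re (α : ℝ) : (omega α).re = -decay α := by
  unfold omega decay
  rw [mul_comm, Complex.exp_ofReal_mul_I_re]
  ring

/-- The integrand `(iξ)^q exp(t (iξ)^{α+1} + iξx)` for `ξ > 0`. -/
def symb (α q t x ξ : ℝ) : ℂ :=
  ((ξ ^ q : ℝ) : ℂ) * Complex.exp (Complex.I * (π * q / 2 : ℝ) +
    (t : ℂ) * omega α * ((ξ ^ (α + 1) : ℝ) : ℂ) + Complex.I * ξ * x)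

/-- The kernel with symbol `(iξ)^q exp(t (iξ)^{α+1})`. -/
def G (α q t x : ℝ) : ℝ := π⁻¹ * (∫ ξ in Ioi (0 : ℝ), symb α q t x ξ).re

lemma norm_symb {α q t x ξ : ℝ} (hξ : 0 < ξ) :
    ‖symb α q t x ξ‖ = ξ ^ q * Real.exp (-(decay α * t) * ξ ^ (α + 1)) := by
  unfold symb
  rw [norm_mul, Complex.norm_exp, Complex.norm_real, Real.norm_of_nonneg (by positivity)]
  congr 2
  have : (t * omega α * ((ξ ^ (α + 1) : ℝ) : ℂ)).re = -(decay α * t) * ξ ^ (α + 1) := by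
    rw [Complex.re_mul_ofReal, Complex.re_ofReal_mul, omega_re]
    ring
  rw [Complex.add_re, Complex.add_re, this]
  simp

lemma continuousOn_symb (α q t x : ℝ) : ContinuousOn (symb α q t x) (Ioi 0) := by
  unfold symb
  have h : ∀ r : ℝ, ContinuousOn (fun ξ : ℝ => ((ξ ^ r : ℝ) : ℂ)) (Ioi 0) := fun r =>
    Complex.continuous_ofReal.comp_continuousOn
      (continuousOn_id.rpow_const fun ξ hξ => Or.inl (ne_of_gt hξ))
  refine (h q).mul (Complex.continuous_exp.comp_continuousOn ?_)
  refine ((continuousOn_const).add (continuousOn_const.mul (h (α + 1)))).add ?_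
  fun_prop

lemma integrableOn_rpow_exp {α q t : ℝ} (h0 : 0 < α) (h1 : α < 1) (hq : -1 < q) (ht : 0 < t) :
    IntegrableOn (fun ξ : ℝ => ξ ^ q * Real.exp (-(decay α * t) * ξ ^ (α + 1))) (Ioi 0) :=
  integrableOn_rpow_mul_exp_neg_mul_rpow hq (by linarith) (mul_pos (decay_pos h0 h1) ht)

lemma integrableOn_symb {α q t : ℝ} (h0 : 0 < α) (h1 : α < 1) (hq : -1 < q) (ht : 0 < t) (x : ℝ) :
    IntegrableOn (symb α q t x) (Ioi 0) := by
  refine Integrable.mono' (integrableOn_rpow_exp h0 h1 hq ht)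
    ((continuousOn_symb α q t x).aestronglyMeasurable measurableSet_Ioi) ?_
  filter_upwards [ae_restrict_mem measurableSet_Ioi] with ξ hξ
  rw [norm_symb hξ]

/-- `L¹` norm of the symbol on the half line. -/
def symbNorm (α q t : ℝ) : ℝ :=
  ∫ ξ in Ioi (0 : ℝ), ξ ^ q * Real.exp (-(decay α * t) * ξ ^ (α + 1))

lemma symbNorm_nonneg (α q t : ℝ) : 0 ≤ symbNorm α q t :=
  setIntegral_nonneg measurableSet_Ioi fun ξ hξ => by
    have : (0 : ℝ) < ξ := hξ
    positivity

lemma abs_G_le (α q t x : ℝ) : |G α q t x| ≤ π⁻¹ * symbNorm α q t := by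
  unfold G symbNorm
  rw [abs_mul, abs_of_pos (inv_pos.2 Real.pi_pos)]
  refine mul_le_mul_of_nonneg_left ?_ (inv_pos.2 Real.pi_pos).le
  refine (Complex.abs_re_le_norm _).trans ((norm_integral_le_integral_norm _).trans_eq ?_)
  exact setIntegral_congr_fun measurableSet_Ioi fun ξ hξ => norm_symb hξ

lemma symbNorm_antitone {α q a t : ℝ} (h0 : 0 < α) (h1 : α < 1) (hq : -1 < q) (ha : 0 < a)
    (hat : a ≤ t) : symbNorm α q t ≤ symbNorm α q a := by
  refine setIntegral_mono_on (integrableOn_rpow_exp h0 h1 hq (ha.trans_le hat))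
    (integrableOn_rpow_exp h0 h1 hq ha) measurableSet_Ioi fun ξ hξ => ?_
  have hξ' : (0 : ℝ) < ξ := hξ
  have := decay_pos h0 h1
  gcongr

lemma symb_add_rpow {α q t x ξ : ℝ} (hξ : 0 < ξ) :
    omega α * ((ξ ^ (α + 1) : ℝ) : ℂ) * symb α q t x ξ = symb α (q + (α + 1)) t x ξ := by
  unfold symb
  rw [Real.rpow_add hξ q, Complex.ofReal_mul]
  have : Complex.exp (Complex.I * (π * (q + (α + 1)) / 2 : ℝ) +
    (t : ℂ) * omega α * ((ξ ^ (α + 1) : ℝ) : ℂ) + Complex.I * ξ * x) = omega α *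
    Complex.exp (Complex.I * (π * q / 2 : ℝ) +
    (t : ℂ) * omega α * ((ξ ^ (α + 1) : ℝ) : ℂ) + Complex.I * ξ * x) := by
    conv_rhs => enter [1]; rw [omega]
    rw [← Complex.exp_add]
    congr 1
    push_cast
    ring
  rw [this]
  ring

lemma exp_I_pi_half : Complex.exp (Complex.I * (π / 2 : ℝ)) = Complex.I := by
  rw [mul_comm]; simp [Complex.exp_pi_div_two_mul_I]

lemma symb_add_one {α q t x ξ : ℝ} (hξ : 0 < ξ) :
    Complex.I * (ξ : ℂ) * symb α q t x ξ = symb α (q + 1) t x ξ := by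
  unfold symb
  rw [Real.rpow_add hξ q, Complex.ofReal_mul, Real.rpow_one]
  have : Complex.exp (Complex.I * (π * (q + 1) / 2 : ℝ) +
    (t : ℂ) * omega α * ((ξ ^ (α + 1) : ℝ) : ℂ) + Complex.I * ξ * x) = Complex.I *
    Complex.exp (Complex.I * (π * q / 2 : ℝ) +
    (t : ℂ) * omega α * ((ξ ^ (α + 1) : ℝ) : ℂ) + Complex.I * ξ * x) := by
    conv_rhs => enter [1]; rw [← exp_I_pi_half]
    rw [← Complex.exp_add]
    congr 1
    push_cast
    ring
  rw [this]
  ring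

/-- Working along an arbitrary line gives both partial derivatives as special cases, and later the
second derivatives along segments needed for Taylor estimates in the frame parameters. -/
lemma hasDerivAt_symb_line {α q a b d e ξ s : ℝ} (hξ : 0 < ξ) :
    HasDerivAt (fun s : ℝ => symb α q (a + s * b) (d + s * e) ξ)
      (b * symb α (q + (α + 1)) (a + s * b) (d + s * e) ξ +
        e * symb α (q + 1) (a + s * b) (d + s * e) ξ) s := by
  rw [← symb_add_rpow hξ, ← symb_add_one hξ]
  unfold symb
  have h1 : HasDerivAt (fun s : ℝ => ((a + s * b : ℝ) : ℂ)) (b : ℂ) s := by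
    have : HasDerivAt (fun s : ℝ => a + s * b) b s := by
      simpa using ((hasDerivAt_id s).mul_const b).const_add a
    exact this.ofReal_comp
  have h2 : HasDerivAt (fun s : ℝ => ((d + s * e : ℝ) : ℂ)) (e : ℂ) s := by
    have : HasDerivAt (fun s : ℝ => d + s * e) e s := by
      simpa using ((hasDerivAt_id s).mul_const e).const_add d
    exact this.ofReal_comp
  have h3 := ((((h1.mul_const (omega α)).mul_const ((ξ ^ (α + 1) : ℝ) : ℂ)).const_add
    (Complex.I * (π * q / 2 : ℝ))).add (h2.const_mul (Complex.I * ξ))).cexp.const_mul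
      ((ξ ^ q : ℝ) : ℂ)
  convert! h3 using 1
  simp only [Pi.add_apply]
  ring

/-- Chain rule for `G` along lines in the `(t, x)` half plane. -/
lemma hasDerivAt_G_line {α q a b d e s : ℝ} (h0 : 0 < α) (h1 : α < 1) (hq : -1 < q)
    (hs : 0 < a + s * b) :
    HasDerivAt (fun s : ℝ => G α q (a + s * b) (d + s * e))
      (b * G α (q + (α + 1)) (a + s * b) (d + s * e) +
        e * G α (q + 1) (a + s * b) (d + s * e)) s := by
  -- Half the current time bounds all nearby times from below, so the exponential at time `m`
  -- dominates uniformly.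
  set m := (a + s * b) / 2 with hm
  have hm0 : 0 < m := by positivity
  have hnhds : {r : ℝ | m < a + r * b} ∈ 𝓝 s := by
    refine (isOpen_lt (by fun_prop) (by fun_prop)).mem_nhds ?_
    simp only [mem_ofPred_eq]; linarith
  have key := hasDerivAt_integral_of_dominated_loc_of_deriv_le (𝕜 := ℝ)
    (μ := volume.restrict (Ioi (0 : ℝ)))
    (F := fun r ξ => symb α q (a + r * b) (d + r * e) ξ)
    (F' := fun r ξ => (b * symb α (q + (α + 1)) (a + r * b) (d + r * e) ξ +
        e * symb α (q + 1) (a + r * b) (d + r * e) ξ))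
    (bound := fun ξ => |b| * (ξ ^ (q + (α + 1)) * Real.exp (-(decay α * m) * ξ ^ (α + 1))) +
      |e| * (ξ ^ (q + 1) * Real.exp (-(decay α * m) * ξ ^ (α + 1)))) (x₀ := s) hnhds
    (Eventually.of_forall fun r =>
      (continuousOn_symb _ _ _ _).aestronglyMeasurable measurableSet_Ioi)
    (integrableOn_symb h0 h1 hq hs _)
    ((((continuousOn_symb _ _ _ _).aestronglyMeasurable measurableSet_Ioi).const_mul _).add
      (((continuousOn_symb _ _ _ _).aestronglyMeasurable measurableSet_Ioi).const_mul _))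
    ?_ ?_ ?_
  · have h2 := key.2
    rw [integral_add ((integrableOn_symb h0 h1 (by linarith) hs _).const_mul _)
      ((integrableOn_symb h0 h1 (by linarith) hs _).const_mul _), integral_const_mul,
      integral_const_mul] at h2
    have h3 := (Complex.reCLM.hasFDerivAt.comp_hasDerivAt s h2).const_mul π⁻¹
    convert! h3 using 1
    simp [G]
    ring
  · filter_upwards [ae_restrict_mem measurableSet_Ioi] with ξ hξ r hr
    have hξ' : (0 : ℝ) < ξ := hξ
    have hd := decay_pos h0 h1
    have hr' : m < a + r * b := hr
    refine (norm_add_le _ _).trans ?_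
    rw [norm_mul, norm_mul, norm_symb hξ, norm_symb hξ, Complex.norm_real, Complex.norm_real,
      Real.norm_eq_abs, Real.norm_eq_abs]
    gcongr
  · exact ((integrableOn_rpow_exp h0 h1 (by linarith) hm0).const_mul _).add
      ((integrableOn_rpow_exp h0 h1 (by linarith) hm0).const_mul _)
  · filter_upwards [ae_restrict_mem measurableSet_Ioi] with ξ hξ r hr
    exact hasDerivAt_symb_line hξ

lemma hasDerivAt_G_space {α q t x : ℝ} (h0 : 0 < α) (h1 : α < 1) (hq : -1 < q) (ht : 0 < t) :
    HasDerivAt (G α q t) (G α (q + 1) t x) x := by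
  have := hasDerivAt_G_line (α := α) (q := q) (a := t) (b := 0) (d := 0) (e := 1) (s := x) h0 h1 hq
    (by simpa using ht)
  simpa using this

lemma hasDerivAt_G_time {α q t x : ℝ} (h0 : 0 < α) (h1 : α < 1) (hq : -1 < q) (ht : 0 < t) :
    HasDerivAt (fun s => G α q s x) (G α (q + (α + 1)) t x) t := by
  have := hasDerivAt_G_line (α := α) (q := q) (a := 0) (b := 1) (d := x) (e := 0) (s := t) h0 h1 hq
    (by simpa using ht)
  simpa using this

/-- The three terms differentiate the power, the parabolic exponent and the oscillation. Expressing
each as a symbol of shifted order is what turns the integrated identity into a recurrence between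
kernels. -/
lemma hasDerivAt_symb {α q t x ξ : ℝ} (hξ : 0 < ξ) :
    HasDerivAt (symb α q t x) (Complex.I * (q * symb α (q - 1) t x ξ +
      t * (α + 1) * symb α (q + α) t x ξ + x * symb α q t x ξ)) ξ := by
  have e1 : symb α q t x ξ = Complex.I * ξ * symb α (q - 1) t x ξ := by
    rw [symb_add_one hξ]; simp
  have e2 : symb α (q + α) t x ξ = omega α * ((ξ ^ (α + 1) : ℝ) : ℂ) * symb α (q - 1) t x ξ := by
    rw [symb_add_rpow hξ]; ring_nf
  rw [e2, e1]
  have hp : ∀ r : ℝ, HasDerivAt (fun ξ : ℝ => ((ξ ^ r : ℝ) : ℂ)) ((r * ξ ^ (r - 1) : ℝ) : ℂ) ξ :=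
    fun r => (Real.hasDerivAt_rpow_const (Or.inl hξ.ne')).ofReal_comp
  have h3 := (hp q).mul ((((hp (α + 1)).const_mul ((t : ℂ) * omega α)).const_add
    (Complex.I * (π * q / 2 : ℝ))).add
      (((hasDerivAt_id ξ).ofReal_comp.const_mul Complex.I).mul_const (x : ℂ))).cexp
  have h4 : HasDerivAt (symb α q t x) _ ξ := h3
  refine h4.congr_deriv ?_
  have e3 : Complex.exp (Complex.I * (π * q / 2 : ℝ) +
    (t : ℂ) * omega α * ((ξ ^ (α + 1) : ℝ) : ℂ) + Complex.I * ξ * x) = Complex.I *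
    Complex.exp (Complex.I * (π * (q - 1) / 2 : ℝ) +
    (t : ℂ) * omega α * ((ξ ^ (α + 1) : ℝ) : ℂ) + Complex.I * ξ * x) := by
    conv_rhs => enter [1]; rw [← exp_I_pi_half]
    rw [← Complex.exp_add]
    congr 1
    push_cast
    ring
  have e4 : ξ ^ q = ξ * ξ ^ (q - 1) := by
    rw [mul_comm, ← Real.rpow_add_one hξ.ne']; ring_nf
  have e5 : ξ ^ (α + 1) = ξ * ξ ^ α := by
    rw [mul_comm, ← Real.rpow_add_one hξ.ne']
  simp only [id_eq, add_sub_cancel_right, Pi.add_apply]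
  rw [e3]
  unfold symb
  rw [e4, e5]
  push_cast
  ring_nf

lemma tendsto_symb_atTop {α q t : ℝ} (h0 : 0 < α) (h1 : α < 1) (ht : 0 < t) (x : ℝ) :
    Tendsto (symb α q t x) atTop (𝓝 0) := by
  rw [tendsto_zero_iff_norm_tendsto_zero]
  have hd := mul_pos (decay_pos h0 h1) ht
  have h2 := (tendsto_rpow_mul_exp_neg_mul_atTop_nhds_zero (q / (α + 1)) _ hd).comp
    (tendsto_rpow_atTop (y := α + 1) (by linarith))
  refine h2.congr' ?_
  filter_upwards [eventually_gt_atTop 0] with ξ hξ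
  rw [norm_symb hξ, Function.comp, ← Real.rpow_mul hξ.le]
  congr 2
  field_simp

lemma integral_symb_recurrence {α q t : ℝ} (h0 : 0 < α) (h1 : α < 1) (hq : 0 ≤ q) (ht : 0 < t)
    (x : ℝ) :
    Complex.I * (q * (∫ ξ in Ioi (0 : ℝ), symb α (q - 1) t x ξ) +
      t * (α + 1) * (∫ ξ in Ioi (0 : ℝ), symb α (q + α) t x ξ) +
      x * ∫ ξ in Ioi (0 : ℝ), symb α q t x ξ) = - symb α q t x 0 := by
  -- For `q = 0` the order `q - 1 = -1` is not integrable at zero, but its coefficient vanishes.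
  have i1 : IntegrableOn (fun ξ => (q : ℂ) * symb α (q - 1) t x ξ) (Ioi 0) := by
    rcases hq.eq_or_lt with rfl | hq
    · simp
    · exact (integrableOn_symb h0 h1 (by linarith) ht x).const_mul _
  have i2 : IntegrableOn (fun ξ => (t : ℂ) * (α + 1) * symb α (q + α) t x ξ) (Ioi 0) :=
    (integrableOn_symb h0 h1 (by linarith) ht x).const_mul _
  have i3 : IntegrableOn (fun ξ => (x : ℂ) * symb α q t x ξ) (Ioi 0) :=
    (integrableOn_symb h0 h1 (by linarith) ht x).const_mul _
  have hc : ContinuousWithinAt (symb α q t x) (Ici 0) 0 := by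
    refine Continuous.continuousWithinAt ?_
    unfold symb
    have c1 : Continuous fun ξ : ℝ => ξ ^ q := Real.continuous_rpow_const hq
    have c2 : Continuous fun ξ : ℝ => ξ ^ (α + 1) := Real.continuous_rpow_const (by linarith)
    fun_prop
  have := integral_Ioi_of_hasDerivAt_of_tendsto hc
    (fun ξ (hξ : ξ ∈ Ioi (0 : ℝ)) => hasDerivAt_symb hξ)
    (((i1.add i2).add i3).const_mul Complex.I) (tendsto_symb_atTop h0 h1 ht x)
  rw [zero_sub, integral_const_mul] at this
  rw [← this]
  congr 1
  have s1 := integral_add (i1.add i2) i3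
  have s2 := integral_add i1 i2
  simp only [Pi.add_apply] at s1
  rw [s1, s2, integral_const_mul, integral_const_mul, integral_const_mul]

/-- This is the Fourier form of multiplication by `x`: one power of `x` is traded for kernels of
orders `q - 1` and `q + α`, both controlled by absolute integrals. -/
lemma G_recurrence {α q t : ℝ} (h0 : 0 < α) (h1 : α < 1) (hq : 0 ≤ q) (ht : 0 < t) (x : ℝ) :
    x * G α q t x = -(q * G α (q - 1) t x + t * (α + 1) * G α (q + α) t x) := by
  have h := integral_symb_recurrence h0 h1 hq ht x
  -- The boundary term at `ξ = 0` vanishes for `q > 0`. For `q = 0` it equals `i`, which disappears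
  -- on taking real parts.
  have hz : (Complex.I * symb α q t x 0).re = 0 := by
    rcases hq.eq_or_lt with rfl | hq
    · simp [symb, Real.zero_rpow (show α + 1 ≠ 0 by linarith)]
    · simp [symb, Real.zero_rpow hq.ne']
  have h2 := congrArg (fun w => (-(Complex.I * w)).re) h
  simp only [← mul_assoc, Complex.I_mul_I, mul_neg, neg_neg, hz] at h2
  simp at h2
  unfold G
  linear_combination π⁻¹ * h2

/-- The kernels decay like `x⁻²` if `q = 0` or `q ≥ 1`. -/
lemma G_decay {α q a b : ℝ} (h0 : 0 < α) (h1 : α < 1) (hq : q = 0 ∨ 1 ≤ q) (ha : 0 < a) :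
    ∃ C : ℝ, 0 ≤ C ∧ ∀ t x : ℝ, a ≤ t → t ≤ b → |G α q t x| ≤ C * (1 + x ^ 2)⁻¹ := by
  have B0 : ∀ r : ℝ, -1 < r → ∃ C : ℝ, 0 ≤ C ∧ ∀ t x : ℝ, a ≤ t → t ≤ b → |G α r t x| ≤ C := by
    intro r hr
    refine ⟨π⁻¹ * symbNorm α r a, mul_nonneg (by positivity) (symbNorm_nonneg _ _ _),
      fun t x hat _ => (abs_G_le α r t x).trans ?_⟩
    exact mul_le_mul_of_nonneg_left (symbNorm_antitone h0 h1 hr ha hat) (by positivity)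
  -- One use of the recurrence gives first-order decay for every nonnegative order.
  have B1 : ∀ r : ℝ, 0 ≤ r → ∃ C : ℝ, 0 ≤ C ∧ ∀ t x : ℝ, a ≤ t → t ≤ b →
      |x * G α r t x| ≤ C := by
    intro r hr
    obtain ⟨C2, hC2, H2⟩ := B0 (r + α) (by linarith)
    obtain ⟨C1, hC1, H1⟩ : ∃ C : ℝ, 0 ≤ C ∧ ∀ t x : ℝ, a ≤ t → t ≤ b →
        |r * G α (r - 1) t x| ≤ C := by
      rcases hr.eq_or_lt with rfl | hr
      · exact ⟨0, le_rfl, by simp⟩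
      · obtain ⟨C, hC, H⟩ := B0 (r - 1) (by linarith)
        refine ⟨r * C, by positivity, fun t x h h' => ?_⟩
        rw [abs_mul, abs_of_pos hr]
        gcongr
        exact H t x h h'
    refine ⟨C1 + |b| * (α + 1) * C2, by positivity, fun t x h h' => ?_⟩
    rw [G_recurrence h0 h1 hr (ha.trans_le h), abs_neg]
    refine (abs_add_le _ _).trans (add_le_add (H1 t x h h') ?_)
    rw [abs_mul, abs_of_pos (by positivity [ha.trans_le h] : 0 < t * (α + 1))]
    gcongr
    · exact h'.trans (le_abs_self b)
    · exact H2 t x h h'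
  obtain ⟨C0, hC0, H0⟩ := B0 q (by rcases hq with rfl | hq <;> linarith)
  have hq0 : 0 ≤ q := by rcases hq with rfl | hq <;> linarith
  obtain ⟨C2, hC2, H2⟩ := B1 (q + α) (by linarith)
  obtain ⟨C1, hC1, H1⟩ : ∃ C : ℝ, 0 ≤ C ∧ ∀ t x : ℝ, a ≤ t → t ≤ b →
      |q * (x * G α (q - 1) t x)| ≤ C := by
    rcases hq with rfl | hq
    · exact ⟨0, le_rfl, by simp⟩
    · obtain ⟨C, hC, H⟩ := B1 (q - 1) (by linarith)
      refine ⟨q * C, by positivity, fun t x h h' => ?_⟩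
      rw [abs_mul, abs_of_nonneg hq0]
      gcongr
      exact H t x h h'
  refine ⟨C0 + (C1 + |b| * (α + 1) * C2), by positivity, fun t x h htb => ?_⟩
  rw [← div_eq_mul_inv, le_div_iff₀ (by positivity), mul_add, mul_one]
  refine add_le_add (H0 t x h htb) ?_
  -- A second use of the recurrence needs first-order decay at order `q - 1`. This is available when
  -- `q ≥ 1`, and unnecessary when `q = 0`.
  have : |G α q t x| * x ^ 2 = |x * (x * G α q t x)| := by
    rw [← mul_assoc, abs_mul, abs_of_nonneg (mul_self_nonneg x)]; ring
  rw [this, G_recurrence h0 h1 hq0 (ha.trans_le h)]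
  have e : x * -(q * G α (q - 1) t x + t * (α + 1) * G α (q + α) t x) =
    -(q * (x * G α (q - 1) t x) + t * (α + 1) * (x * G α (q + α) t x)) := by ring
  rw [e, abs_neg]
  refine (abs_add_le _ _).trans (add_le_add (H1 t x h htb) ?_)
  rw [abs_mul, abs_of_pos (by have := ha.trans_le h; positivity : 0 < t * (α + 1))]
  gcongr
  · exact htb.trans (le_abs_self b)
  · exact H2 t x h htb

/-- Self-similarity of the kernels. -/
lemma G_scaling {α q s τ : ℝ} (h0 : 0 < α) (hτ : 0 < τ) (z : ℝ) :
    G α q (τ * s) (τ ^ (1 / (α + 1)) * z) = τ ^ (-((q + 1) / (α + 1))) * G α q s z := by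
  have hr : 0 < τ ^ (1 / (α + 1)) := by positivity
  set r := τ ^ (1 / (α + 1)) with hrdef
  have e1 : ∀ ξ ∈ Ioi (0 : ℝ), symb α q (τ * s) (r * z) ξ =
      ((r ^ (-q) : ℝ) : ℂ) * symb α q s z (r * ξ) := by
    intro ξ hξ
    have hξ' : (0 : ℝ) < ξ := hξ
    unfold symb
    have a1 : (r * ξ) ^ (α + 1) = τ * ξ ^ (α + 1) := by
      rw [Real.mul_rpow hr.le hξ'.le, hrdef, ← Real.rpow_mul hτ.le,
        one_div_mul_cancel (by linarith), Real.rpow_one]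
    have a2 : ξ ^ q = r ^ (-q) * (r * ξ) ^ q := by
      rw [Real.mul_rpow hr.le hξ'.le, ← mul_assoc, ← Real.rpow_add hr]; simp
    rw [a1, a2]
    push_cast
    ring_nf
  unfold G
  rw [setIntegral_congr_fun measurableSet_Ioi e1, integral_const_mul,
    integral_comp_mul_left_Ioi (fun ξ => symb α q s z ξ) 0 hr, mul_zero]
  have e2 : τ ^ (-((q + 1) / (α + 1))) = r ^ (-q) * r⁻¹ := by
    rw [← Real.rpow_neg_one r, ← Real.rpow_add hr, hrdef, ← Real.rpow_mul hτ.le]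
    congr 1; field_simp; ring
  rw [e2, ← mul_assoc, Complex.real_smul]
  rw [← mul_assoc, ← Complex.ofReal_mul, Complex.re_ofReal_mul]
  ring

/-! ### Identification with the given kernel, Fourier inversion, semigroup law -/

section Fourier

open scoped ComplexConjugate FourierTransform

/-- The symbol `exp(t (iξ)^{α+1})` of the semigroup. -/
def phi (α t ξ : ℝ) : ℂ := Complex.exp ((t : ℂ) * (Complex.I * (ξ : ℂ)) ^ ((α : ℂ) + 1))

lemma phi_of_pos {α t ξ : ℝ} (hξ : 0 < ξ) :
    phi α t ξ = Complex.exp (t * omega α * ((ξ ^ (α + 1) : ℝ) : ℂ)) := by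
  unfold phi omega
  have hne : Complex.I * (ξ : ℂ) ≠ 0 := by simp [hξ.ne']
  rw [Complex.cpow_def_of_ne_zero hne, mul_comm Complex.I (ξ : ℂ),
    Complex.log_ofReal_mul hξ Complex.I_ne_zero, Complex.log_I, Real.rpow_def_of_pos hξ,
    Complex.ofReal_exp, mul_assoc (t : ℂ), ← Complex.exp_add]
  congr 3
  push_cast
  ring

lemma phi_mul_exp_of_pos {α t ξ : ℝ} (hξ : 0 < ξ) (x : ℝ) :
    phi α t ξ * Complex.exp (Complex.I * ξ * x) = symb α 0 t x ξ := by
  rw [phi_of_pos hξ, ← Complex.exp_add]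
  simp [symb]

lemma phi_neg (α t ξ : ℝ) : phi α t (-ξ) = conj (phi α t ξ) := by
  unfold phi
  rw [← Complex.exp_conj]
  have h1 : Complex.I * ((-ξ : ℝ) : ℂ) = conj (Complex.I * (ξ : ℂ)) := by simp
  have harg : (Complex.I * (ξ : ℂ)).arg ≠ π := by
    rw [Ne, Complex.arg_eq_pi_iff]; simp
  rw [h1, Complex.conj_cpow _ _ harg]
  simp

lemma continuous_phi {α : ℝ} (h0 : 0 < α) (t : ℝ) : Continuous (phi α t) := by
  unfold phi
  refine Complex.continuous_exp.comp (continuous_const.mul ?_)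
  rw [continuous_iff_continuousAt]
  intro ξ
  refine ContinuousAt.comp (f := fun ξ : ℝ => Complex.I * (ξ : ℂ))
    (g := fun z : ℂ => z ^ ((α : ℂ) + 1)) ?_ (by fun_prop)
  refine Complex.continuousAt_cpow_const_of_re_pos (Or.inl (by simp)) ?_
  simp; linarith

lemma integrable_phi_mul_exp {α t : ℝ} (h0 : 0 < α) (h1 : α < 1) (ht : 0 < t) (x : ℝ) :
    Integrable (fun ξ : ℝ => phi α t ξ * Complex.exp (Complex.I * ξ * x)) := by
  have hN := (show IntegrableOn (fun ξ => ‖symb α 0 t x ξ‖) (Ioi 0) volume from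
    (integrableOn_symb h0 h1 (by norm_num : (-1 : ℝ) < 0) ht x).norm).integrable_indicator measurableSet_Ioi
  have hc := continuous_phi (α := α) h0 t
  refine (hN.add hN.comp_neg).mono' (by fun_prop) ?_
  filter_upwards [Measure.ae_ne volume (0 : ℝ)] with ξ hξ
  have hpos : ∀ η : ℝ, 0 < η → ‖phi α t η * Complex.exp (Complex.I * η * x)‖ =
      ‖symb α 0 t x η‖ := fun η hη => by rw [phi_mul_exp_of_pos hη]
  rcases lt_or_gt_of_ne hξ with h | h
  · have e : ‖phi α t ξ * Complex.exp (Complex.I * ξ * x)‖ = ‖symb α 0 t x (-ξ)‖ := by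
      rw [← hpos (-ξ) (by linarith), norm_mul, norm_mul, phi_neg, RCLike.norm_conj]
      congr 1
      simp [Complex.norm_exp]
    rw [e]
    simp [indicator, h, not_lt.2 h.le]
  · rw [hpos ξ h]
    simp [indicator, h, not_lt.2 h.le]

/-- The integrand takes conjugate values at `ξ` and `-ξ`, so the full integral is twice the real
part of the half-line integral. -/
lemma integral_phi_mul_exp {α t : ℝ} (h0 : 0 < α) (h1 : α < 1) (ht : 0 < t) (x : ℝ) :
    ∫ ξ : ℝ, phi α t ξ * Complex.exp (Complex.I * ξ * x) = ((2 * π * G α 0 t x : ℝ) : ℂ) := by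
  have hi := integrable_phi_mul_exp h0 h1 ht x
  rw [← intervalIntegral.integral_Iic_add_Ioi hi.integrableOn hi.integrableOn (b := 0)]
  have e1 : ∫ ξ in Iic (0:ℝ), phi α t ξ * Complex.exp (Complex.I * ξ * x) =
      conj (∫ ξ in Ioi (0:ℝ), phi α t ξ * Complex.exp (Complex.I * ξ * x)) := by
    rw [← integral_conj, ← neg_zero, ← integral_comp_neg_Ioi, neg_zero]
    refine setIntegral_congr_fun measurableSet_Ioi fun ξ _ => ?_
    simp only [phi_neg, map_mul, ← Complex.exp_conj]
    simp
  rw [e1, add_comm, Complex.add_conj, setIntegral_congr_fun measurableSet_Ioi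
    (fun ξ hξ => phi_mul_exp_of_pos hξ x)]
  unfold G
  push_cast
  field_simp

lemma kernel_eq_G {α t : ℝ} (h0 : 0 < α) (h1 : α < 1) (ht : 0 < t) (x : ℝ) :
    kernel α t x = G α 0 t x := by
  have := integral_phi_mul_exp h0 h1 ht x
  unfold phi at this
  unfold kernel
  rw [this, Complex.ofReal_re]
  field_simp

lemma continuous_G {α q t : ℝ} (h0 : 0 < α) (h1 : α < 1) (hq : -1 < q) (ht : 0 < t) :
    Continuous (G α q t) :=
  continuous_iff_continuousAt.2 fun _ => (hasDerivAt_G_space h0 h1 hq ht).continuousAt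

lemma integrable_G {α q t : ℝ} (h0 : 0 < α) (h1 : α < 1) (hq : q = 0 ∨ 1 ≤ q) (ht : 0 < t) :
    Integrable (G α q t) := by
  obtain ⟨C, _, H⟩ := G_decay (b := t) h0 h1 hq ht
  exact (integrable_inv_one_add_sq.const_mul C).mono'
    (continuous_G h0 h1 (by rcases hq with rfl | hq <;> linarith) ht).aestronglyMeasurable
    (Eventually.of_forall fun x => H t x le_rfl le_rfl)

/-- Fourier transform of the kernel. -/
lemma integral_G_mul_exp {α t : ℝ} (h0 : 0 < α) (h1 : α < 1) (ht : 0 < t) (ξ : ℝ) :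
    ∫ y : ℝ, (G α 0 t y : ℂ) * Complex.exp (-(Complex.I * ξ * y)) = phi α t ξ := by
  -- Up to rescaling, the kernel is the Fourier transform of its symbol. Its `x⁻²` decay makes that
  -- transform integrable, so Fourier inversion recovers the symbol.
  have hF : 𝓕 (phi α t) = fun w => ((2 * π * G α 0 t (-2 * π * w) : ℝ) : ℂ) := by
    ext w
    rw [Real.fourier_real_eq_integral_exp_smul, ← integral_phi_mul_exp h0 h1 ht]
    refine integral_congr_ae (Eventually.of_forall fun v => ?_)
    simp only [smul_eq_mul]
    rw [mul_comm]
    congr 2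
    push_cast
    ring
  have hpi : (-2 * π) ≠ 0 := by simp [Real.pi_ne_zero]
  have hInt : Integrable (𝓕 (phi α t)) := by
    rw [hF]
    exact (((integrable_G h0 h1 (Or.inl rfl) ht).comp_mul_left' hpi).const_mul _).ofReal
  have hphi : Integrable (phi α t) := by simpa using integrable_phi_mul_exp h0 h1 ht 0
  have key := congrFun ((continuous_phi h0 t).fourierInv_fourier_eq hphi hInt) ξ
  rw [Real.fourierInv_eq_fourier_neg, Real.fourier_real_eq_integral_exp_smul, hF] at key
  rw [← key]
  have h2 := Measure.integral_comp_mul_left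
    (fun y : ℝ => (G α 0 t y : ℂ) * Complex.exp (-(Complex.I * ξ * y))) (-2 * π)
  have h3 : ∫ v : ℝ, Complex.exp (((-2 * π * v * (-ξ) : ℝ) : ℂ) * Complex.I) •
      ((2 * π * G α 0 t (-2 * π * v) : ℝ) : ℂ) = (2 * π : ℂ) *
      ∫ v : ℝ, (G α 0 t (-2 * π * v) : ℂ) *
        Complex.exp (-(Complex.I * ξ * ((-2 * π * v : ℝ) : ℂ))) := by
    rw [← integral_const_mul]
    refine integral_congr_ae (Eventually.of_forall fun v => ?_)
    simp only [smul_eq_mul]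
    rw [show ((-2 * π * v * (-ξ) : ℝ) : ℂ) * Complex.I =
      -(Complex.I * ξ * ((-2 * π * v : ℝ) : ℂ)) by push_cast; ring]
    push_cast
    ring
  rw [h3, h2, abs_inv, abs_mul, abs_of_pos Real.pi_pos]
  simp only [Complex.real_smul]
  push_cast
  norm_num
  have : (π : ℂ) ≠ 0 := by exact_mod_cast Real.pi_ne_zero
  field_simp

lemma integral_G_zero {α t : ℝ} (h0 : 0 < α) (h1 : α < 1) (ht : 0 < t) :
    ∫ y : ℝ, G α 0 t y = 1 := by
  have := integral_G_mul_exp h0 h1 ht 0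
  simp only [Complex.ofReal_zero, mul_zero, zero_mul, neg_zero, Complex.exp_zero, mul_one] at this
  rw [integral_complex_ofReal] at this
  have h2 : phi α t 0 = 1 := by
    have : (α : ℂ) + 1 ≠ 0 := by
      have : (α + 1 : ℝ) ≠ 0 := by linarith
      exact_mod_cast this
    simp [phi, Complex.zero_cpow this]
  rw [h2] at this
  exact_mod_cast this

lemma symb_mul_phi {α q s t x ξ : ℝ} (hξ : 0 < ξ) :
    symb α q t x ξ * phi α s ξ = symb α q (s + t) x ξ := by
  rw [phi_of_pos hξ]
  unfold symb
  rw [mul_assoc, ← Complex.exp_add]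
  congr 2
  push_cast
  ring

/-- Semigroup property: `K(s) * G_q(t) = G_q(s + t)`. -/
lemma integral_G_mul_G {α q s t : ℝ} (h0 : 0 < α) (h1 : α < 1) (hq : -1 < q) (hs : 0 < s)
    (ht : 0 < t) (x : ℝ) :
    ∫ y : ℝ, G α 0 s y * G α q t (x - y) = G α q (s + t) x := by
  have hsx : ∀ y ξ, symb α q t (x - y) ξ = symb α q t x ξ * Complex.exp (-(Complex.I * ξ * y)) := by
    intro y ξ
    unfold symb
    rw [mul_assoc _ (Complex.exp _) (Complex.exp _), ← Complex.exp_add]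
    congr 2
    push_cast
    ring
  have hG0 := integrable_G (q := 0) h0 h1 (Or.inl rfl) hs
  -- Translation in `x` only multiplies the symbol by a unimodular factor, so the double integrand
  -- is dominated by a product and Fubini applies.
  have hInt : Integrable (fun p : ℝ × ℝ => (G α 0 s p.1 : ℂ) * symb α q t (x - p.1) p.2)
      (volume.prod (volume.restrict (Ioi 0))) := by
    have h3 : Integrable (fun y => (G α 0 s y : ℂ)) := hG0.ofReal
    have h2 := h3.mul_prod (integrableOn_symb h0 h1 hq ht x)
    refine (h2.norm.congr' ?_ (Eventually.of_forall fun p => ?_))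
    · simp only [hsx]
      have : AEStronglyMeasurable (fun p : ℝ × ℝ => Complex.exp (-(Complex.I * p.2 * p.1)))
        (volume.prod (volume.restrict (Ioi 0))) := Continuous.aestronglyMeasurable (by fun_prop)
      refine (h2.aestronglyMeasurable.mul this).congr (Eventually.of_forall fun p => ?_)
      simp only [Pi.mul_apply]
      ring
    · simp only [hsx, norm_norm, norm_mul]
      simp [Complex.norm_exp]
  have hswap := integral_integral_swap
    (f := fun y ξ => (G α 0 s y : ℂ) * symb α q t (x - y) ξ) hInt
  have hL : ∀ y, (∫ ξ in Ioi (0:ℝ), (G α 0 s y : ℂ) * symb α q t (x - y) ξ).re * π⁻¹ =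
      G α 0 s y * G α q t (x - y) := by
    intro y
    rw [integral_const_mul, Complex.re_ofReal_mul]
    unfold G
    ring
  simp_rw [← hL]
  rw [integral_mul_const]
  have hre : ∫ y : ℝ, (∫ ξ in Ioi (0:ℝ), (G α 0 s y : ℂ) * symb α q t (x - y) ξ).re =
      (∫ y : ℝ, ∫ ξ in Ioi (0:ℝ), (G α 0 s y : ℂ) * symb α q t (x - y) ξ).re :=
    integral_re hInt.integral_prod_left
  rw [hre, hswap, mul_comm]
  conv_rhs => unfold G
  congr 2
  refine setIntegral_congr_fun measurableSet_Ioi fun ξ hξ => ?_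
  rw [← symb_mul_phi hξ, ← integral_G_mul_exp h0 h1 hs, ← integral_const_mul]
  refine integral_congr_ae (Eventually.of_forall fun y => ?_)
  simp only [hsx]
  ring

end Fourier

/-! ### Convolution operators and self-similar variables -/

/-- Convolution of the kernel `G_q(t, ·)` with `g`. -/
def conv (α q t : ℝ) (g : ℝ → ℝ) (x : ℝ) : ℝ := ∫ y : ℝ, G α q t (x - y) * g y

/-- The source term of the Duhamel formula. -/
def src (α : ℝ) (F : ℝ → ℝ → ℝ) (t x : ℝ) : ℝ := ∫ s in (0 : ℝ)..t, conv α 1 (t - s) (F s) x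

lemma duhamel_eq {α t : ℝ} (h0 : 0 < α) (h1 : α < 1) (ht : 0 < t) (f u₀ : ℝ → ℝ) (u : ℝ → ℝ → ℝ)
    (x : ℝ) :
    duhamel α f u₀ u t x = conv α 0 t u₀ x - src α (fun s y => f (u s y)) t x := by
  unfold duhamel conv src
  congr 1
  · simp_rw [kernel_eq_G h0 h1 ht]
  -- The open interval excludes `s = t`, where the elapsed time is zero and the identification of
  -- the kernels is not available.
  · rw [intervalIntegral.integral_of_le ht.le, intervalIntegral.integral_of_le ht.le,
      integral_Ioc_eq_integral_Ioo, integral_Ioc_eq_integral_Ioo]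
    refine setIntegral_congr_fun measurableSet_Ioo fun s hs => ?_
    have hts : 0 < t - s := sub_pos.2 hs.2
    have : kernel α (t - s) = G α 0 (t - s) := funext (kernel_eq_G h0 h1 hts)
    simp only [this, conv]
    refine integral_congr_ae (Eventually.of_forall fun y => ?_)
    simp only
    rw [(hasDerivAt_G_space h0 h1 (by norm_num) hts).deriv, zero_add]

lemma integral_comp_sub_mul {E : Type*} [NormedAddCommGroup E] [NormedSpace ℝ E] (F : ℝ → E)
    (x : ℝ) {r : ℝ} (hr : 0 < r) : ∫ y, F y = r • ∫ z, F (x - r * z) := by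
  have := Measure.integral_comp_mul_left (fun z => F (x - z)) r
  rw [this, smul_smul, abs_of_pos (inv_pos.2 hr), mul_inv_cancel₀ hr.ne', one_smul,
    integral_sub_left_eq_self]

/-- Convolution in self-similar variables, in a moving frame. -/
lemma conv_frame {α q t l m : ℝ} (h0 : 0 < α) (ht : 0 < t) (g : ℝ → ℝ) (x : ℝ) :
    conv α q (t * l) g (x + m * t) = t ^ (-(q / (α + 1))) *
      ∫ z, G α q l (z + m * t ^ (1 - 1 / (α + 1))) * g (x - t ^ (1 / (α + 1)) * z) := by
  have hr : 0 < t ^ (1 / (α + 1)) := by positivity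
  unfold conv
  rw [integral_comp_sub_mul _ x hr, smul_eq_mul, ← integral_const_mul, ← integral_const_mul]
  refine integral_congr_ae (Eventually.of_forall fun z => ?_)
  have e1 : x + m * t - (x - t ^ (1 / (α + 1)) * z) =
      t ^ (1 / (α + 1)) * (z + m * t ^ (1 - 1 / (α + 1))) := by
    have : t = t ^ (1 / (α + 1)) * t ^ (1 - 1 / (α + 1)) := by
      rw [← Real.rpow_add ht]; simp
    linear_combination m * this
  simp only
  rw [e1, G_scaling h0 ht, ← mul_assoc, ← mul_assoc, ← Real.rpow_add ht, ← mul_assoc]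
  congr 3
  field_simp
  ring

lemma conv_scaled {α q t : ℝ} (h0 : 0 < α) (ht : 0 < t) (g : ℝ → ℝ) (x : ℝ) :
    conv α q t g x = t ^ (-(q / (α + 1))) *
      ∫ z, G α q 1 z * g (x - t ^ (1 / (α + 1)) * z) := by
  simpa using conv_frame (q := q) (l := 1) (m := 0) h0 ht g x

/-- `L¹` norm of `G_q(1, ·)`. -/
def kerNorm (α q : ℝ) : ℝ := ∫ z, |G α q 1 z|

lemma kerNorm_nonneg (α q : ℝ) : 0 ≤ kerNorm α q := integral_nonneg fun _ => abs_nonneg _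

/-- This is Young's inequality after scaling to time one. All dependence on `t` is the explicit
power, which for `q = 1` is integrable at zero. -/
lemma abs_conv_le {α q t C : ℝ} (h0 : 0 < α) (h1 : α < 1) (hq : q = 0 ∨ 1 ≤ q) (ht : 0 < t)
    {g : ℝ → ℝ} (hg : ∀ y, |g y| ≤ C) (x : ℝ) :
    |conv α q t g x| ≤ t ^ (-(q / (α + 1))) * (kerNorm α q * C) := by
  rw [conv_scaled h0 ht, abs_mul, abs_of_pos (by positivity)]
  refine mul_le_mul_of_nonneg_left ?_ (by positivity)
  unfold kerNorm
  rw [← integral_mul_const]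
  rw [← Real.norm_eq_abs]
  refine norm_integral_le_of_norm_le ((integrable_G h0 h1 hq one_pos).abs.mul_const C)
    (Eventually.of_forall fun z => ?_)
  rw [Real.norm_eq_abs, abs_mul]
  exact mul_le_mul_of_nonneg_left (hg _) (abs_nonneg _)

lemma integrable_G_mul {α q t C : ℝ} (h0 : 0 < α) (h1 : α < 1) (hq : q = 0 ∨ 1 ≤ q) (ht : 0 < t)
    {g : ℝ → ℝ} (hm : AEStronglyMeasurable g) (hg : ∀ y, |g y| ≤ C) (x : ℝ) :
    Integrable fun y => G α q t (x - y) * g y :=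
  ((integrable_G h0 h1 hq ht).comp_sub_left x).mul_bdd (c := C) hm (Eventually.of_forall hg)

lemma conv_sub {α q t C C' : ℝ} (h0 : 0 < α) (h1 : α < 1) (hq : q = 0 ∨ 1 ≤ q) (ht : 0 < t)
    {g g' : ℝ → ℝ} (hm : AEStronglyMeasurable g) (hg : ∀ y, |g y| ≤ C)
    (hm' : AEStronglyMeasurable g') (hg' : ∀ y, |g' y| ≤ C') (x : ℝ) :
    conv α q t (fun y => g y - g' y) x = conv α q t g x - conv α q t g' x := by
  unfold conv
  rw [← integral_sub (integrable_G_mul h0 h1 hq ht hm hg x)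
    (integrable_G_mul h0 h1 hq ht hm' hg' x)]
  simp_rw [mul_sub]

lemma aestronglyMeasurable_conv {α q t : ℝ} (h0 : 0 < α) (h1 : α < 1) (hq : -1 < q) (ht : 0 < t)
    {g : ℝ → ℝ} (hm : AEStronglyMeasurable g) : AEStronglyMeasurable (conv α q t g) := by
  have c := continuous_G h0 h1 hq ht
  have h2 : AEStronglyMeasurable (fun p : ℝ × ℝ => G α q t (p.1 - p.2) * g p.2)
      (volume.prod volume) :=
    (Continuous.aestronglyMeasurable (by fun_prop)).mul hm.comp_snd
  exact h2.integral_prod_right'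

/-- Semigroup property of the convolutions. -/
lemma conv_conv {α q s t C : ℝ} (h0 : 0 < α) (h1 : α < 1) (hq : q = 0 ∨ 1 ≤ q) (hs : 0 < s)
    (ht : 0 < t) {g : ℝ → ℝ} (hm : AEStronglyMeasurable g) (hg : ∀ y, |g y| ≤ C) (x : ℝ) :
    conv α 0 s (conv α q t g) x = conv α q (s + t) g x := by
  have hq' : -1 < q := by rcases hq with rfl | hq <;> linarith
  have i1 := integrable_G (q := 0) h0 h1 (Or.inl rfl) hs
  have i2 := integrable_G h0 h1 hq ht
  have c1 := continuous_G (q := 0) h0 h1 (by norm_num) hs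
  have c2 := continuous_G h0 h1 hq' ht
  have hInt : Integrable (fun p : ℝ × ℝ => G α 0 s (x - p.1) * (G α q t (p.1 - p.2) * g p.2))
      (volume.prod volume) := by
    have h2 : Integrable (fun p : ℝ × ℝ => G α 0 s (x - p.1) * G α q t (p.1 - p.2))
        (volume.prod volume) := by
      refine (integrable_prod_iff (Continuous.aestronglyMeasurable (by fun_prop))).2 ⟨?_, ?_⟩
      · exact Eventually.of_forall fun y => (i2.comp_sub_left y).const_mul (G α 0 s (x - y))
      · have : ∀ y, ∫ w, ‖G α 0 s (x - y) * G α q t (y - w)‖ =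
            ‖G α 0 s (x - y)‖ * ∫ w, ‖G α q t w‖ := by
          intro y
          simp_rw [norm_mul]
          rw [integral_const_mul, integral_sub_left_eq_self (fun w => ‖G α q t w‖) volume y]
        simp_rw [this]
        exact (i1.comp_sub_left x).norm.mul_const _
    have h3 := h2.mul_bdd (c := C) (g := fun p : ℝ × ℝ => g p.2) (hm.comp_snd)
      (Eventually.of_forall fun p => hg p.2)
    simpa only [mul_assoc] using h3
  have hswap := integral_integral_swap
    (f := fun y w => G α 0 s (x - y) * (G α q t (y - w) * g w)) hInt
  unfold conv
  simp_rw [← integral_const_mul]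
  rw [hswap]
  refine integral_congr_ae (Eventually.of_forall fun w => ?_)
  simp only
  rw [← integral_G_mul_G h0 h1 hq' hs ht, ← integral_mul_const]
  rw [← integral_sub_left_eq_self _ volume x]
  refine integral_congr_ae (Eventually.of_forall fun y => ?_)
  simp only
  rw [show x - (x - y) = y by ring, show x - y - w = x - w - y by ring]
  ring

/-- The exponent satisfies `1/(α+1) < 1` exactly because `α > 0`: the diffusion has order above that
of the transport term. -/
lemma integrableOn_time {α : ℝ} (h0 : 0 < α) (t : ℝ) :
    IntegrableOn (fun τ : ℝ => τ ^ (-(1 / (α + 1)))) (Ioo 0 t) := by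
  rcases le_or_gt t 0 with h | h
  · simp [Ioo_eq_empty (not_lt.2 h)]
  have := intervalIntegral.intervalIntegrable_rpow' (a := 0) (b := t) (r := -(1 / (α + 1)))
    (by rw [neg_lt_neg_iff, div_lt_one (by linarith)]; linarith)
  rw [intervalIntegrable_iff_integrableOn_Ioo_of_le h.le] at this
  exact this

/-! ### The Duhamel source term and restarting -/

section source

variable {α : ℝ} {F : ℝ → ℝ → ℝ} {C : ℝ}

/-- In self-similar variables the singularity in `τ` separates from the kernel at time one. The
integrand is then a product of three integrable functions of one variable times a bounded one, which
justifies the Fubini arguments below. -/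
lemma integrable_src_triple (h0 : 0 < α) (h1 : α < 1) (hF : Measurable (Function.uncurry F))
    (hC : ∀ s y, |F s y| ≤ C) {w : ℝ → ℝ} (hw : Integrable w) (t : ℝ) :
    Integrable (fun p : (ℝ × ℝ) × ℝ => w p.1.1 * p.1.2 ^ (-(1 / (α + 1))) *
      (G α 1 1 p.2 * F (t - p.1.2) (p.1.1 - p.1.2 ^ (1 / (α + 1)) * p.2)))
      ((volume.prod (volume.restrict (Ioo 0 t))).prod volume) := by
  have h2 := (hw.mul_prod (integrableOn_time h0 t)).mul_prod
    (integrable_G (q := 1) h0 h1 (Or.inr le_rfl) one_pos)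
  have h3 : Measurable fun p : (ℝ × ℝ) × ℝ =>
      F (t - p.1.2) (p.1.1 - p.1.2 ^ (1 / (α + 1)) * p.2) :=
    hF.comp (f := fun p : (ℝ × ℝ) × ℝ => (t - p.1.2, p.1.1 - p.1.2 ^ (1 / (α + 1)) * p.2))
      (by fun_prop)
  have h4 := h2.mul_bdd (c := C) h3.aestronglyMeasurable (Eventually.of_forall fun p => hC _ _)
  simpa only [mul_assoc] using h4

/-- Joint integrability of the convolved source against an integrable weight. -/
lemma integrable_src_pair (h0 : 0 < α) (h1 : α < 1) (hF : Measurable (Function.uncurry F))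
    (hC : ∀ s y, |F s y| ≤ C) {w : ℝ → ℝ} (hw : Integrable w) (t : ℝ) :
    Integrable (fun p : ℝ × ℝ => w p.1 * conv α 1 p.2 (F (t - p.2)) p.1)
      (volume.prod (volume.restrict (Ioo 0 t))) := by
  refine (integrable_src_triple h0 h1 hF hC hw t).integral_prod_left.congr ?_
  have : ∀ᵐ p : ℝ × ℝ ∂(volume.prod (volume.restrict (Ioo 0 t))), p.2 ∈ Ioo 0 t :=
    Measure.quasiMeasurePreserving_snd.ae (ae_restrict_mem measurableSet_Ioo)
  filter_upwards [this] with p hp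
  rw [integral_const_mul, conv_scaled h0 hp.1]
  ring

lemma integrableOn_conv (h0 : 0 < α) (h1 : α < 1) (hF : Measurable (Function.uncurry F))
    (hC : ∀ s y, |F s y| ≤ C) (t x : ℝ) :
    IntegrableOn (fun τ => conv α 1 τ (F (t - τ)) x) (Ioo 0 t) := by
  have h2 := (integrableOn_time h0 t).mul_prod
    (integrable_G (q := 1) h0 h1 (Or.inr le_rfl) one_pos)
  have h3 : Measurable fun p : ℝ × ℝ =>
      F (t - p.1) (x - p.1 ^ (1 / (α + 1)) * p.2) :=
    hF.comp (f := fun p : ℝ × ℝ => (t - p.1, x - p.1 ^ (1 / (α + 1)) * p.2)) (by fun_prop)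
  have h4 := h2.mul_bdd (c := C) h3.aestronglyMeasurable (Eventually.of_forall fun p => hC _ _)
  simp only [mul_assoc] at h4
  refine Integrable.congr h4.integral_prod_left ?_
  filter_upwards [ae_restrict_mem measurableSet_Ioo] with τ hτ
  rw [integral_const_mul, conv_scaled h0 hτ.1]

lemma src_eq {t : ℝ} (ht : 0 ≤ t) (x : ℝ) :
    src α F t x = ∫ τ in Ioo 0 t, conv α 1 τ (F (t - τ)) x := by
  unfold src
  have := intervalIntegral.integral_comp_sub_left (a := 0) (b := t)
    (fun τ => conv α 1 τ (F (t - τ)) x) t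
  simp only [sub_sub_cancel, sub_self, sub_zero] at this
  rw [this, intervalIntegral.integral_of_le ht, integral_Ioc_eq_integral_Ioo]

lemma intervalIntegrable_src (h0 : 0 < α) (h1 : α < 1) (hF : Measurable (Function.uncurry F))
    (hC : ∀ s y, |F s y| ≤ C) {t : ℝ} (ht : 0 ≤ t) (x : ℝ) :
    IntervalIntegrable (fun s => conv α 1 (t - s) (F s) x) volume 0 t := by
  have := (intervalIntegrable_iff_integrableOn_Ioo_of_le ht).2 (integrableOn_conv h0 h1 hF hC t x)
  have h2 := this.comp_sub_left t
  simpa using h2.symm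

lemma abs_src_le (h0 : 0 < α) (h1 : α < 1) {t : ℝ} (ht : 0 ≤ t)
    (hC : ∀ s ∈ Ioo 0 t, ∀ y, |F s y| ≤ C) (x : ℝ) :
    |src α F t x| ≤ (∫ τ in Ioo 0 t, τ ^ (-(1 / (α + 1)))) * (kerNorm α 1 * C) := by
  rw [src_eq ht, ← integral_mul_const, ← Real.norm_eq_abs]
  refine norm_integral_le_of_norm_le ((integrableOn_time h0 t).mul_const _) ?_
  filter_upwards [ae_restrict_mem measurableSet_Ioo] with τ hτ
  exact abs_conv_le h0 h1 (Or.inr le_rfl) hτ.1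
    (hC _ ⟨by linarith [hτ.2], by linarith [hτ.1]⟩) x

/-- The Duhamel formula restarts at any positive time. -/
lemma restart (h0 : 0 < α) (h1 : α < 1) (hF : Measurable (Function.uncurry F))
    (hC : ∀ s y, |F s y| ≤ C) {u₀ : ℝ → ℝ} {M : ℝ} (hm : AEStronglyMeasurable u₀)
    (hM : ∀ y, |u₀ y| ≤ M) {t h : ℝ} (ht : 0 < t) (hh : 0 < h) (x : ℝ) :
    conv α 0 h (fun y => conv α 0 t u₀ y - src α F t y) x - src α (fun s => F (t + s)) h x =
      conv α 0 (t + h) u₀ x - src α F (t + h) x := by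
  have hInt := integrable_src_pair h0 h1 hF hC
    ((integrable_G (q := 0) h0 h1 (Or.inl rfl) hh).comp_sub_left x) t
  -- Fubini moves `K(h)` under the time integral, where the semigroup law absorbs it into the kernel
  -- of order one.
  have e1 : ∫ y, G α 0 h (x - y) * src α F t y =
      ∫ s in (0:ℝ)..t, conv α 1 (t + h - s) (F s) x := by
    simp_rw [src_eq ht.le, ← integral_const_mul]
    rw [integral_integral_swap
      (f := fun y τ => G α 0 h (x - y) * conv α 1 τ (F (t - τ)) y) hInt]
    have := intervalIntegral.integral_comp_sub_left (a := 0) (b := t)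
      (fun τ => conv α 1 (h + τ) (F (t - τ)) x) t
    simp only [sub_sub_cancel, sub_self, sub_zero] at this
    have e : ∀ s, t + h - s = h + (t - s) := fun s => by ring
    simp_rw [e]
    rw [this, intervalIntegral.integral_of_le ht.le, integral_Ioc_eq_integral_Ioo]
    refine setIntegral_congr_fun measurableSet_Ioo fun τ hτ => ?_
    exact conv_conv h0 h1 (Or.inr le_rfl) hh hτ.1
      (hF.of_uncurry_left).aestronglyMeasurable (hC _) x
  have i1 : Integrable fun y => G α 0 h (x - y) * src α F t y := by
    refine hInt.integral_prod_left.congr (Eventually.of_forall fun y => ?_)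
    simp only
    rw [integral_const_mul, src_eq ht.le]
  have i2 := integrable_G_mul (q := 0) h0 h1 (Or.inl rfl) hh
    (aestronglyMeasurable_conv (q := 0) h0 h1 (by norm_num) ht hm)
    (abs_conv_le (q := 0) h0 h1 (Or.inl rfl) ht hM) x
  have e2 : conv α 0 h (fun y => conv α 0 t u₀ y - src α F t y) x =
      conv α 0 (t + h) u₀ x - ∫ s in (0:ℝ)..t, conv α 1 (t + h - s) (F s) x := by
    rw [← e1, add_comm t h, ← conv_conv h0 h1 (Or.inl rfl) hh ht hm hM]
    conv_lhs => unfold conv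
    simp_rw [mul_sub]
    exact integral_sub i2 i1
  have i3 := intervalIntegrable_src h0 h1 hF hC (by linarith : 0 ≤ t + h) x
  -- The source splits at time `t`: its past is the propagated source from `e1`, its future is the
  -- source of the restarted problem.
  have e3 : src α F (t + h) x = (∫ s in (0:ℝ)..t, conv α 1 (t + h - s) (F s) x) +
      src α (fun s => F (t + s)) h x := by
    unfold src
    rw [← intervalIntegral.integral_add_adjacent_intervals (b := t)
      (i3.mono_set (uIcc_subset_uIcc left_mem_uIcc (by rw [mem_uIcc]; left; constructor <;> linarith)))
      (i3.mono_set (uIcc_subset_uIcc (by rw [mem_uIcc]; left; constructor <;> linarith) right_mem_uIcc))]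
    congr 1
    have := intervalIntegral.integral_comp_add_left (a := 0) (b := h)
      (fun s => conv α 1 (t + h - s) (F s) x) t
    rw [add_zero] at this
    rw [← this]
    refine intervalIntegral.integral_congr fun s _ => ?_
    simp only
    congr 1
    ring
  rw [e2, e3]
  ring

end source

/-! ### Smooth dependence of superposition and kernel multipliers -/

section Multipliers

open scoped BoundedContinuousFunction

/-- The mean value inequality is used twice. The sharp factor one half is not needed, since only a
quadratic remainder bound enters. -/
lemma abs_taylor_le {φ φ' φ'' : ℝ → ℝ} {K : ℝ}
    (h1 : ∀ s ∈ Icc (0 : ℝ) 1, HasDerivAt φ (φ' s) s)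
    (h2 : ∀ s ∈ Icc (0 : ℝ) 1, HasDerivAt φ' (φ'' s) s)
    (hK : ∀ s ∈ Icc (0 : ℝ) 1, |φ'' s| ≤ K) : |φ 1 - φ 0 - φ' 0| ≤ K := by
  have hK0 : 0 ≤ K := (abs_nonneg _).trans (hK 0 (by simp))
  have a1 : ∀ s ∈ Icc (0 : ℝ) 1, |φ' s - φ' 0| ≤ K := by
    intro s hs
    have := norm_image_sub_le_of_norm_deriv_le_segment' (f := φ') (f' := φ'') (C := K)
      (a := 0) (b := 1) (fun x hx => (h2 x hx).hasDerivWithinAt)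
      (fun x hx => hK x (Ico_subset_Icc_self hx)) s hs
    refine this.trans ?_
    rw [sub_zero]
    exact mul_le_of_le_one_right hK0 hs.2
  have := norm_image_sub_le_of_norm_deriv_le_segment' (f := fun s => φ s - s * φ' 0)
    (f' := fun s => φ' s - φ' 0) (C := K) (a := 0) (b := 1)
    (fun x hx => ((h1 x hx).sub (by simpa using (hasDerivAt_id x).mul_const (φ' 0))).hasDerivWithinAt)
    (fun x hx => a1 x (Ico_subset_Icc_self hx)) 1 (by simp)
  simpa [sub_right_comm] using this

/-- Together with the scalar Taylor estimate, this reduces Fréchet differentiability of maps into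
sup-normed spaces to pointwise remainders bounded uniformly in the point. -/
lemma hasFDerivAt_of_quadratic {E F : Type*} [NormedAddCommGroup E] [NormedSpace ℝ E]
    [NormedAddCommGroup F] [NormedSpace ℝ F] {f : E → F} {L : E →L[ℝ] F} {x : E} {C : ℝ}
    (h : ∀ᶠ d in 𝓝 (0 : E), ‖f (x + d) - f x - L d‖ ≤ C * ‖d‖ ^ 2) : HasFDerivAt f L x := by
  rw [hasFDerivAt_iff_isLittleO_nhds_zero]
  refine (Asymptotics.IsBigO.of_bound C ?_).trans_isLittleO
    (Asymptotics.isLittleO_norm_pow_id (E' := E) one_lt_two)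
  filter_upwards [h] with d hd
  simpa using hd

section Nemytskii

variable {Z : Type*} [TopologicalSpace Z]

/-- The superposition operator `v ↦ f ∘ v` on bounded continuous functions. -/
def nem (f : ℝ →ᵇ ℝ) (v : Z →ᵇ ℝ) : Z →ᵇ ℝ := f.compContinuous v.toContinuousMap

@[simp] lemma nem_apply (f : ℝ →ᵇ ℝ) (v : Z →ᵇ ℝ) (z : Z) : nem f v z = f (v z) := rfl

/-- Multiplication of bounded continuous functions, as a bilinear map. -/
def bddMul : (Z →ᵇ ℝ) →L[ℝ] (Z →ᵇ ℝ) →L[ℝ] (Z →ᵇ ℝ) :=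
  ContinuousLinearMap.mul ℝ (Z →ᵇ ℝ)

@[simp] lemma bddMul_apply (v w : Z →ᵇ ℝ) : bddMul v w = v * w := rfl

lemma hasFDerivAt_nem {f f' f'' : ℝ →ᵇ ℝ} (h1 : ∀ x, HasDerivAt f (f' x) x)
    (h2 : ∀ x, HasDerivAt f' (f'' x) x) (v : Z →ᵇ ℝ) :
    HasFDerivAt (nem f) (bddMul (nem f' v)) v := by
  refine hasFDerivAt_of_quadratic (C := ‖f''‖) (Eventually.of_forall fun d => ?_)
  rw [BoundedContinuousFunction.norm_le (by positivity)]
  intro z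
  have line : ∀ s : ℝ, HasDerivAt (fun s : ℝ => v z + s * d z) (d z) s := fun s => by
    simpa using ((hasDerivAt_id s).mul_const (d z)).const_add (v z)
  have := abs_taylor_le (φ := fun s => f (v z + s * d z)) (φ' := fun s => f' (v z + s * d z) * d z)
    (φ'' := fun s => f'' (v z + s * d z) * d z * d z) (K := ‖f''‖ * ‖d‖ ^ 2)
    (fun s _ => (h1 _).comp s (line s)) (fun s _ => ((h2 _).comp s (line s)).mul_const _) ?_
  · simpa using this
  · intro s _
    rw [mul_assoc, abs_mul, abs_mul, sq]
    have a1 : |f'' (v z + s * d z)| ≤ ‖f''‖ := f''.norm_coe_le_norm _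
    have a2 : |d z| ≤ ‖d‖ := d.norm_coe_le_norm _
    gcongr

/-- The derivative is multiplication by the superposition operator of the next function in the
sequence. The induction therefore treats all indices simultaneously. -/
lemma contDiff_nem {F : ℕ → (ℝ →ᵇ ℝ)} (hF : ∀ k x, HasDerivAt (F k) (F (k + 1) x) x) :
    ContDiff ℝ ∞ (nem (Z := Z) (F 0)) := by
  have : ∀ n : ℕ, ∀ k, ContDiff ℝ n (nem (Z := Z) (F k)) := by
    intro n
    induction n with
    | zero =>
      intro k
      have : Differentiable ℝ (nem (Z := Z) (F k)) := fun v =>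
        (hasFDerivAt_nem (hF k) (hF (k + 1)) v).differentiableAt
      exact_mod_cast contDiff_zero.2 this.continuous
    | succ n ih =>
      intro k
      push_cast
      rw [contDiff_succ_iff_fderiv]
      refine ⟨fun v => (hasFDerivAt_nem (hF k) (hF (k + 1)) v).differentiableAt, by simp, ?_⟩
      have : fderiv ℝ (nem (Z := Z) (F k)) =
          fun v => bddMul (nem (F (k + 1)) v) :=
        funext fun v => (hasFDerivAt_nem (hF k) (hF (k + 1)) v).fderiv
      rw [this]
      have hL : ContDiff ℝ n fun v : Z →ᵇ ℝ => bddMul v :=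
        by fun_prop
      exact hL.comp (ih (k + 1))
  rw [contDiff_infty]
  exact fun n => this n 0

lemma nem_lipschitz {f f' : ℝ →ᵇ ℝ} (h1 : ∀ x, HasDerivAt f (f' x) x) (x y : ℝ) :
    |f x - f y| ≤ ‖f'‖ * |x - y| := by
  have := Convex.norm_image_sub_le_of_norm_hasDerivWithin_le (f := f) (f' := f') (s := univ)
    (C := ‖f'‖) (x := y) (y := x) (fun x _ => (h1 x).hasDerivWithinAt)
    (fun x _ => f'.norm_coe_le_norm x) convex_univ (mem_univ _) (mem_univ _)
  simpa using this

lemma norm_nem_sub_le {f f' : ℝ →ᵇ ℝ} (h1 : ∀ x, HasDerivAt f (f' x) x) (v w : Z →ᵇ ℝ) :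
    ‖nem f v - nem f w‖ ≤ ‖f'‖ * ‖v - w‖ := by
  rw [BoundedContinuousFunction.norm_le (by positivity)]
  intro z
  refine (nem_lipschitz h1 _ _).trans ?_
  gcongr
  exact (v - w).norm_coe_le_norm z

lemma hasCompactSupport_iteratedDeriv {f : ℝ → ℝ} (hs : HasCompactSupport f) (k : ℕ) :
    HasCompactSupport (iteratedDeriv k f) := by
  induction k with
  | zero => simpa using hs
  | succ k ih => rw [iteratedDeriv_succ]; exact ih.deriv

/-- The iterated derivatives of a compactly supported smooth function, as bounded functions. -/
def iterBdd {f : ℝ → ℝ} (hf : ContDiff ℝ ∞ f) (hs : HasCompactSupport f) (k : ℕ) : ℝ →ᵇ ℝ :=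
  BoundedContinuousFunction.ofNormedAddCommGroup (iteratedDeriv k f)
    (hf.continuous_iteratedDeriv k (by exact_mod_cast le_top))
    (Classical.choose ((hf.continuous_iteratedDeriv k
      (by exact_mod_cast le_top)).bounded_above_of_compact_support
      (hasCompactSupport_iteratedDeriv hs k)))
    (Classical.choose_spec ((hf.continuous_iteratedDeriv k
      (by exact_mod_cast le_top)).bounded_above_of_compact_support
      (hasCompactSupport_iteratedDeriv hs k)))

lemma hasDerivAt_iterBdd {f : ℝ → ℝ} (hf : ContDiff ℝ ∞ f) (hs : HasCompactSupport f) (k : ℕ)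
    (x : ℝ) : HasDerivAt (iterBdd hf hs k) (iterBdd hf hs (k + 1) x) x := by
  have hd : Differentiable ℝ (iteratedDeriv k f) :=
    hf.differentiable_iteratedDeriv k (by exact_mod_cast ENat.natCast_lt_top k)
  have := (hd x).hasDerivAt
  rw [← iteratedDeriv_succ] at this
  exact this

@[simp] lemma iterBdd_zero {f : ℝ → ℝ} (hf : ContDiff ℝ ∞ f) (hs : HasCompactSupport f) (x : ℝ) :
    iterBdd hf hs 0 x = f x := by
  change iteratedDeriv 0 f x = f x
  simp

end Nemytskii

section Multiplier

/-- The self-similar displacement `τ^{1 - 1/(α+1)}`, truncated to `[0, 1]`. -/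
def nu (α τ : ℝ) : ℝ := (min (max τ 0) 1) ^ (1 - 1 / (α + 1))

lemma one_sub_pos {α : ℝ} (h0 : 0 < α) : 0 < 1 - 1 / (α + 1) := by
  rw [sub_pos, div_lt_one (by linarith)]; linarith

lemma nu_nonneg (α τ : ℝ) : 0 ≤ nu α τ := Real.rpow_nonneg (le_min (le_max_right _ _) zero_le_one) _

lemma nu_le_one {α : ℝ} (h0 : 0 < α) (τ : ℝ) : nu α τ ≤ 1 :=
  Real.rpow_le_one (le_min (le_max_right _ _) zero_le_one) (min_le_right _ _) (one_sub_pos h0).le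

lemma continuous_nu {α : ℝ} (h0 : 0 < α) : Continuous (nu α) :=
  Continuous.rpow_const (by fun_prop) fun _ => Or.inr (one_sub_pos h0).le

lemma nu_of_mem {α τ : ℝ} (h0 : 0 ≤ τ) (h1 : τ ≤ 1) : nu α τ = τ ^ (1 - 1 / (α + 1)) := by
  simp [nu, h0, h1]

/-- The parameter region around `(λ, μ) = (1, 0)`. -/
def params : Set (ℝ × ℝ) := Metric.ball ((1 : ℝ), (0 : ℝ)) (1 / 2)

lemma mem_params {p : ℝ × ℝ} : p ∈ params ↔ |p.1 - 1| < 1 / 2 ∧ |p.2| < 1 / 2 := by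
  simp [params, Prod.dist_eq, Real.dist_eq]

/-- Admissible orders of the kernels. -/
def admissible (q : ℝ) : Prop := q = 0 ∨ 1 ≤ q

lemma admissible_zero : admissible 0 := Or.inl rfl

lemma admissible_one : admissible 1 := Or.inr le_rfl

lemma admissible.add {q r : ℝ} (hq : admissible q) (hr : 1 ≤ r) : admissible (q + r) := by
  rcases hq with rfl | hq
  · right; linarith
  · right; linarith

lemma admissible.neg_one_lt {q : ℝ} (hq : admissible q) : -1 < q := by
  rcases hq with rfl | hq <;> linarith

/-- In this parameter region time stays in `[1/2, 3/2]` and the displacement is at most `1/2`, so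
recentring the weight costs only a factor two. -/
lemma weighted_bound {α q : ℝ} (h0 : 0 < α) (h1 : α < 1) (hq : admissible q) :
    ∃ C : ℝ, 0 ≤ C ∧ ∀ p ∈ params, ∀ τ z : ℝ,
      |(1 + z ^ 2) * G α q p.1 (z + p.2 * nu α τ)| ≤ C := by
  obtain ⟨C, hC, H⟩ := G_decay (a := 1 / 2) (b := 3 / 2) h0 h1 hq (by norm_num)
  refine ⟨2 * C, by positivity, fun p hp τ z => ?_⟩
  rw [mem_params, abs_lt, abs_lt] at hp
  have hG := H p.1 (z + p.2 * nu α τ) (by linarith) (by linarith)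
  have n0 := nu_nonneg α τ
  have n1 := nu_le_one h0 τ
  set x := z + p.2 * nu α τ with hx
  have hw : 1 + z ^ 2 ≤ 2 * (1 + x ^ 2) := by
    have e1 : |p.2 * nu α τ| ≤ 1 / 2 := by
      rw [abs_mul, abs_of_nonneg n0]
      calc |p.2| * nu α τ ≤ 1 / 2 * 1 := by
            gcongr
            exact abs_le.2 ⟨by linarith, by linarith⟩
        _ = 1 / 2 := by norm_num
    have e2 : (p.2 * nu α τ) ^ 2 ≤ 1 / 4 := by
      rw [← sq_abs]; nlinarith [abs_nonneg (p.2 * nu α τ)]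
    have e3 : z = x - p.2 * nu α τ := by rw [hx]; ring
    rw [e3]
    nlinarith [sq_nonneg (x + p.2 * nu α τ)]
  rw [abs_mul, abs_of_pos (by positivity)]
  calc (1 + z ^ 2) * |G α q p.1 x| ≤ (2 * (1 + x ^ 2)) * (C * (1 + x ^ 2)⁻¹) := by gcongr
    _ = 2 * C := by field_simp

/-- The multiplier `(1 + z²) ν(τ)^b G_q(λ, z + μ ν(τ))` as a bounded continuous function. -/
def mult {α : ℝ} (h0 : 0 < α) (h1 : α < 1) {q : ℝ} (hq : admissible q) (b : ℕ) (p : ℝ × ℝ)  :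
    (ℝ × ℝ) →ᵇ ℝ :=
  open Classical in
  if hp : p ∈ params then
    BoundedContinuousFunction.ofNormedAddCommGroup
      (fun w : ℝ × ℝ => nu α w.1 ^ b * ((1 + w.2 ^ 2) * G α q p.1 (w.2 + p.2 * nu α w.1)))
      (by
        have c1 := continuous_nu h0
        have c2 : Continuous (G α q p.1) := continuous_G h0 h1 hq.neg_one_lt (by
          rw [mem_params, abs_lt] at hp; linarith)
        fun_prop)
      (Classical.choose (weighted_bound h0 h1 hq))
      (fun w => by
        obtain ⟨hC, H⟩ := Classical.choose_spec (weighted_bound h0 h1 hq)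
        rw [norm_mul, Real.norm_of_nonneg (pow_nonneg (nu_nonneg _ _) _)]
        refine (mul_le_of_le_one_left (norm_nonneg _)
          (pow_le_one₀ (nu_nonneg _ _) (nu_le_one h0 _))).trans (H p hp _ _))
  else 0

variable {α : ℝ} (h0 : 0 < α) (h1 : α < 1)

lemma mult_apply {q : ℝ} (hq : admissible q) (b : ℕ) {p : ℝ × ℝ} (hp : p ∈ params) (w : ℝ × ℝ) :
    mult h0 h1 hq b p w =
      nu α w.1 ^ b * ((1 + w.2 ^ 2) * G α q p.1 (w.2 + p.2 * nu α w.1)) := by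
  rw [mult, dif_pos hp]; rfl

lemma norm_mult_le {q : ℝ} (hq : admissible q) :
    ∃ C : ℝ, 0 ≤ C ∧ ∀ b p, ‖mult h0 h1 hq b p‖ ≤ C := by
  obtain ⟨C, hC, H⟩ := weighted_bound h0 h1 hq
  refine ⟨C, hC, fun b p => ?_⟩
  by_cases hp : p ∈ params
  · rw [BoundedContinuousFunction.norm_le hC]
    intro w
    rw [mult_apply h0 h1 hq b hp, norm_mul, Real.norm_of_nonneg (pow_nonneg (nu_nonneg _ _) _)]
    refine (mul_le_of_le_one_left (norm_nonneg _)
      (pow_le_one₀ (nu_nonneg _ _) (nu_le_one h0 _))).trans (H p hp _ _)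
  · simp [mult, hp, hC]

/-- Derivative of the multiplier in the parameters. -/
def multDeriv {q : ℝ} (hq : admissible q) (b : ℕ) (p : ℝ × ℝ) : (ℝ × ℝ) →L[ℝ] ((ℝ × ℝ) →ᵇ ℝ) :=
  (ContinuousLinearMap.fst ℝ ℝ ℝ).smulRight
      (mult h0 h1 (hq.add (by linarith : 1 ≤ α + 1)) b p) +
    (ContinuousLinearMap.snd ℝ ℝ ℝ).smulRight (mult h0 h1 (hq.add le_rfl) (b + 1) p)

/-- The parameter `λ` acts as time and raises the order by `α + 1`. The parameter `μ` acts as a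
displacement with speed `ν`, so it raises the order by one and brings out a factor `ν`. The four
kernels of second order are bounded uniformly, which controls the remainder. -/
lemma hasFDerivAt_mult {q : ℝ} (hq : admissible q) (b : ℕ) {p : ℝ × ℝ} (hp : p ∈ params) :
    HasFDerivAt (mult h0 h1 hq b) (multDeriv h0 h1 hq b p) p := by
  have ha : 1 ≤ α + 1 := by linarith
  obtain ⟨C1, hC1, H1⟩ := weighted_bound h0 h1 ((hq.add ha).add ha)
  obtain ⟨C2, hC2, H2⟩ := weighted_bound h0 h1 ((hq.add ha).add le_rfl)
  obtain ⟨C2', hC2', H2'⟩ := weighted_bound h0 h1 ((hq.add le_rfl).add ha)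
  obtain ⟨C3, hC3, H3⟩ := weighted_bound h0 h1 ((hq.add (le_refl (1:ℝ))).add le_rfl)
  have hopen : IsOpen params := Metric.isOpen_ball
  have hnear : ∀ᶠ d in 𝓝 (0 : ℝ × ℝ), p + d ∈ params := by
    have : Tendsto (fun d => p + d) (𝓝 (0 : ℝ × ℝ)) (𝓝 p) := by
      have := (by fun_prop : Continuous fun d : ℝ × ℝ => p + d).tendsto 0
      rwa [add_zero] at this
    exact this (hopen.mem_nhds hp)
  refine hasFDerivAt_of_quadratic (C := C1 + C2 + C2' + C3) ?_
  filter_upwards [hnear] with d hd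
  rw [BoundedContinuousFunction.norm_le (by positivity)]
  intro w
  have hseg : ∀ s ∈ Icc (0:ℝ) 1, p + s • d ∈ params := fun s hs =>
    (convex_ball _ _).add_smul_mem hp hd hs
  have hpos : ∀ s ∈ Icc (0:ℝ) 1, 0 < p.1 + s * d.1 := fun s hs => by
    have := hseg s hs
    rw [mem_params, abs_lt] at this
    simp at this
    linarith
  set ν := nu α w.1 with hν
  set W := ν ^ b * (1 + w.2 ^ 2) with hW
  have n0 : 0 ≤ ν := nu_nonneg _ _
  have n1 : ν ≤ 1 := nu_le_one h0 _
  have hline : ∀ r s, 0 < p.1 + s * d.1 → -1 < r → HasDerivAt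
      (fun s => G α r (p.1 + s * d.1) (w.2 + p.2 * ν + s * (d.2 * ν)))
      (d.1 * G α (r + (α + 1)) (p.1 + s * d.1) (w.2 + p.2 * ν + s * (d.2 * ν)) +
        (d.2 * ν) * G α (r + 1) (p.1 + s * d.1) (w.2 + p.2 * ν + s * (d.2 * ν))) s :=
    fun r s hs hr => hasDerivAt_G_line h0 h1 hr hs
  have hbd : ∀ {r C : ℝ}, (∀ p ∈ params, ∀ τ z : ℝ,
      |(1 + z ^ 2) * G α r p.1 (z + p.2 * nu α τ)| ≤ C) → ∀ s ∈ Icc (0:ℝ) 1,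
      |W * G α r (p.1 + s * d.1) (w.2 + p.2 * ν + s * (d.2 * ν))| ≤ C := by
    intro r C H s hs
    have := H (p + s • d) (hseg s hs) w.1 w.2
    simp only [Prod.fst_add, Prod.smul_fst, Prod.snd_add, Prod.smul_snd, smul_eq_mul] at this
    rw [hW, mul_assoc, abs_mul, abs_of_nonneg (pow_nonneg n0 b)]
    refine (mul_le_of_le_one_left (abs_nonneg _) (pow_le_one₀ n0 n1)).trans ?_
    rwa [show w.2 + p.2 * ν + s * (d.2 * ν) = w.2 + (p.2 + s * d.2) * ν by ring]
  have key := abs_taylor_le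
    (φ := fun s => W * G α q (p.1 + s * d.1) (w.2 + p.2 * ν + s * (d.2 * ν)))
    (φ' := fun s => W * (d.1 * G α (q + (α + 1)) (p.1 + s * d.1) (w.2 + p.2 * ν + s * (d.2 * ν)) +
        (d.2 * ν) * G α (q + 1) (p.1 + s * d.1) (w.2 + p.2 * ν + s * (d.2 * ν))))
    (φ'' := fun s => W * (d.1 *
      (d.1 * G α (q + (α + 1) + (α + 1)) (p.1 + s * d.1) (w.2 + p.2 * ν + s * (d.2 * ν)) +
        (d.2 * ν) * G α (q + (α + 1) + 1) (p.1 + s * d.1) (w.2 + p.2 * ν + s * (d.2 * ν))) +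
      (d.2 * ν) *
      (d.1 * G α (q + 1 + (α + 1)) (p.1 + s * d.1) (w.2 + p.2 * ν + s * (d.2 * ν)) +
        (d.2 * ν) * G α (q + 1 + 1) (p.1 + s * d.1) (w.2 + p.2 * ν + s * (d.2 * ν)))))
    (K := (C1 + C2 + C2' + C3) * ‖d‖ ^ 2)
    (fun s hs => (hline q s (hpos s hs) hq.neg_one_lt).const_mul W)
    (fun s hs => (((hline _ s (hpos s hs) (hq.add ha).neg_one_lt).const_mul d.1).add
      ((hline _ s (hpos s hs) (hq.add le_rfl).neg_one_lt).const_mul (d.2 * ν))).const_mul W)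
    ?_
  · simp only [one_mul, zero_mul, add_zero] at key
    simp only [BoundedContinuousFunction.coe_sub, Pi.sub_apply, multDeriv,
      _root_.add_apply, ContinuousLinearMap.smulRight_apply,
      ContinuousLinearMap.coe_fst', ContinuousLinearMap.coe_snd', BoundedContinuousFunction.coe_add,
      Pi.add_apply, BoundedContinuousFunction.coe_smul, smul_eq_mul]
    rw [mult_apply h0 h1 hq b hd, mult_apply h0 h1 hq b hp, mult_apply h0 h1 _ b hp,
      mult_apply h0 h1 _ (b + 1) hp, Real.norm_eq_abs]
    convert key using 2
    simp only [Prod.fst_add, Prod.snd_add, ← hν, hW]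
    ring_nf
  · intro s hs
    have b1 := hbd H1 s hs
    have b2 := hbd H2 s hs
    have b2' := hbd H2' s hs
    have b3 := hbd H3 s hs
    have d1 : |d.1| ≤ ‖d‖ := norm_fst_le d
    have d2 : |d.2 * ν| ≤ ‖d‖ := by
      rw [abs_mul, abs_of_nonneg n0]
      exact (mul_le_of_le_one_right (abs_nonneg _) n1).trans (norm_snd_le d)
    generalize d.2 * ν = e2 at *
    generalize G α (q + (α + 1) + (α + 1)) _ _ = g1 at *
    generalize G α (q + (α + 1) + 1) _ _ = g2 at *
    generalize G α (q + 1 + (α + 1)) _ _ = g2' at *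
    generalize G α (q + 1 + 1) _ _ = g3 at *
    have prod : ∀ {x y c g : ℝ}, |x| ≤ ‖d‖ → |y| ≤ ‖d‖ → |g| ≤ c → |x * y * g| ≤ c * ‖d‖ ^ 2 := by
      intro x y c g hx hy hg
      rw [abs_mul, abs_mul, mul_comm, sq]
      gcongr
      exact (abs_nonneg _).trans hg
    have e : W * (d.1 * (d.1 * g1 + e2 * g2) + e2 * (d.1 * g2' + e2 * g3)) =
        d.1 * d.1 * (W * g1) + d.1 * e2 * (W * g2) + e2 * d.1 * (W * g2') +
          e2 * e2 * (W * g3) := by ring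
    rw [e]
    refine (abs_add_le _ _).trans ?_
    rw [add_mul]
    refine add_le_add ((abs_add_le _ _).trans ?_) (prod d2 d2 b3)
    rw [add_mul]
    refine add_le_add ((abs_add_le _ _).trans ?_) (prod d2 d1 b2')
    rw [add_mul]
    exact add_le_add (prod d1 d1 b1) (prod d1 d2 b2)

/-- Admissible orders and powers of `ν` form a family closed under parameter differentiation. The
induction is over this whole family. -/
lemma contDiffOn_mult {q : ℝ} (hq : admissible q) (b : ℕ) :
    ContDiffOn ℝ ∞ (mult h0 h1 hq b) params := by
  have hopen : IsOpen params := Metric.isOpen_ball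
  have : ∀ n : ℕ, ∀ {q : ℝ} (hq : admissible q) (b : ℕ),
      ContDiffOn ℝ n (mult h0 h1 hq b) params := by
    intro n
    induction n with
    | zero =>
      intro q hq b
      have : DifferentiableOn ℝ (mult h0 h1 hq b) params := fun p hp =>
        (hasFDerivAt_mult h0 h1 hq b hp).differentiableAt.differentiableWithinAt
      exact_mod_cast contDiffOn_zero.2 this.continuousOn
    | succ n ih =>
      intro q hq b
      push_cast
      rw [contDiffOn_succ_iff_fderiv_of_isOpen hopen]
      refine ⟨fun p hp =>
        (hasFDerivAt_mult h0 h1 hq b hp).differentiableAt.differentiableWithinAt, by simp, ?_⟩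
      have : ContDiffOn ℝ n (multDeriv h0 h1 hq b) params := by
        unfold multDeriv
        exact (contDiffOn_const.smulRight (ih _ b)).add (contDiffOn_const.smulRight (ih _ (b + 1)))
      exact this.congr fun p hp => (hasFDerivAt_mult h0 h1 hq b hp).fderiv
  rw [contDiffOn_infty]
  exact fun n => this n hq b

end Multiplier

end Multipliers

/-! ### Space-time and data convolutions on bounded continuous families -/

section Operators

open scoped BoundedContinuousFunction

/-- Bounded continuous families of space-time functions; the point `(i, σ, x)` stands for the
`i`-th member of the family at time `exp σ` and position `x`. -/
abbrev Fam := (ℕ × ℝ × ℝ) →ᵇ ℝ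

/-- Bounded continuous multipliers. -/
abbrev Mul := (ℝ × ℝ) →ᵇ ℝ

section SpaceTime

variable (α : ℝ) (θ ρ : ℝ → ℝ)

/-- Past value `g(t - τ, x - τ^{1/(α+1)} z)` at time `t = θ σ`, extended by zero. -/
def past (g : Fam) (w : ℕ × ℝ × ℝ) (p : ℝ × ℝ) : ℝ :=
  if p.1 < θ w.2.1 then
    g (w.1, Real.log (θ w.2.1 - p.1), w.2.2 - p.1 ^ (1 / (α + 1)) * p.2) else 0

/-- The integrand of the space-time convolution. -/
def stIntegrand (m : Mul) (g : Fam) (w : ℕ × ℝ × ℝ) (p : ℝ × ℝ) : ℝ :=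
  ρ p.1 * (1 + p.2 ^ 2)⁻¹ * (m p * past α θ g w p)

variable {α θ ρ}

lemma abs_past_le (g : Fam) (w : ℕ × ℝ × ℝ) (p : ℝ × ℝ) : |past α θ g w p| ≤ ‖g‖ := by
  unfold past
  split_ifs
  · exact g.norm_coe_le_norm _
  · simp

lemma measurable_past (g : Fam) (w : ℕ × ℝ × ℝ) : Measurable (past α θ g w) := by
  unfold past
  refine Measurable.ite (measurableSet_lt (by fun_prop) (by fun_prop)) ?_ measurable_const
  exact g.continuous.measurable.comp (by fun_prop)

lemma integrable_weight (hρ : Integrable ρ) :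
    Integrable (fun p : ℝ × ℝ => ρ p.1 * (1 + p.2 ^ 2)⁻¹) :=
  hρ.mul_prod integrable_inv_one_add_sq

lemma abs_stIntegrand_le (m : Mul) (g : Fam) (w : ℕ × ℝ × ℝ) (p : ℝ × ℝ) :
    ‖stIntegrand α θ ρ m g w p‖ ≤ ‖ρ p.1 * (1 + p.2 ^ 2)⁻¹‖ * (‖m‖ * ‖g‖) := by
  unfold stIntegrand
  rw [norm_mul, norm_mul (m p)]
  gcongr
  · exact m.norm_coe_le_norm _
  · exact abs_past_le g w p

lemma integrable_stIntegrand (hρ : Integrable ρ) (m : Mul) (g : Fam) (w : ℕ × ℝ × ℝ) :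
    Integrable (stIntegrand α θ ρ m g w) := by
  refine ((integrable_weight hρ).norm.mul_const (‖m‖ * ‖g‖)).mono' ?_
    (Eventually.of_forall (abs_stIntegrand_le m g w))
  exact (integrable_weight hρ).aestronglyMeasurable.mul
    ((m.continuous.measurable.mul (measurable_past g w)).aestronglyMeasurable)

lemma norm_integral_stIntegrand_le (hρ : Integrable ρ) (m : Mul) (g : Fam) (w : ℕ × ℝ × ℝ) :
    ‖∫ p, stIntegrand α θ ρ m g w p‖ ≤ (π * ∫ τ, |ρ τ|) * ‖m‖ * ‖g‖ := by
  have h := norm_integral_le_of_norm_le ((integrable_weight hρ).norm.mul_const (‖m‖ * ‖g‖))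
    (Eventually.of_forall (abs_stIntegrand_le (α := α) (θ := θ) m g w))
  refine h.trans_eq ?_
  rw [integral_mul_const, mul_assoc (π * _)]
  congr 1
  have e : ∀ p : ℝ × ℝ, ‖ρ p.1 * (1 + p.2 ^ 2)⁻¹‖ = |ρ p.1| * (1 + p.2 ^ 2)⁻¹ := fun p => by
    rw [norm_mul, Real.norm_eq_abs, Real.norm_of_nonneg (by positivity)]
  simp_rw [e]
  rw [Measure.volume_eq_prod, integral_prod_mul (fun τ => |ρ τ|) (fun z => (1 + z ^ 2)⁻¹),
    integral_univ_inv_one_add_sq]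
  ring

/-- Extending the past by zero creates a discontinuity only where `τ` equals the current time. For a
fixed base point this is a null set, so dominated convergence still applies. -/
lemma continuous_integral_stIntegrand (hθ : Continuous θ) (hρ : Integrable ρ) (m : Mul) (g : Fam) :
    Continuous fun w => ∫ p, stIntegrand α θ ρ m g w p := by
  rw [continuous_iff_continuousAt]
  intro w₀
  refine continuousAt_of_dominated
    (bound := fun p => ‖ρ p.1 * (1 + p.2 ^ 2)⁻¹‖ * (‖m‖ * ‖g‖))
    (Eventually.of_forall fun w => (integrable_stIntegrand hρ m g w).aestronglyMeasurable)
    (Eventually.of_forall fun w => Eventually.of_forall (abs_stIntegrand_le m g w))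
    ((integrable_weight hρ).norm.mul_const _) ?_
  have hne : ∀ᵐ p : ℝ × ℝ, p.1 ≠ θ w₀.2.1 :=
    Measure.quasiMeasurePreserving_fst.ae (Measure.ae_ne volume (θ w₀.2.1))
  filter_upwards [hne] with p hp
  refine ContinuousAt.mul continuousAt_const (ContinuousAt.mul continuousAt_const ?_)
  have hθw : Continuous fun w : ℕ × ℝ × ℝ => θ w.2.1 := by fun_prop
  rcases lt_or_gt_of_ne hp with h | h
  · have hev : ∀ᶠ w in 𝓝 w₀, p.1 < θ w.2.1 := hθw.continuousAt.eventually (lt_mem_nhds h)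
    have : ContinuousAt (fun w : ℕ × ℝ × ℝ =>
        g (w.1, Real.log (θ w.2.1 - p.1), w.2.2 - p.1 ^ (1 / (α + 1)) * p.2)) w₀ := by
      refine g.continuous.continuousAt.comp (ContinuousAt.prodMk (by fun_prop)
        (ContinuousAt.prodMk (ContinuousAt.log (by fun_prop) (sub_pos.2 h).ne') (by fun_prop)))
    refine this.congr ?_
    filter_upwards [hev] with w hw
    simp [past, hw]
  · have hev : ∀ᶠ w in 𝓝 w₀, θ w.2.1 < p.1 := hθw.continuousAt.eventually (gt_mem_nhds h)
    refine (continuousAt_const (y := (0 : ℝ))).congr ?_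
    filter_upwards [hev] with w hw
    simp [past, not_lt.2 hw.le]

lemma past_add (g g' : Fam) (w : ℕ × ℝ × ℝ) (p : ℝ × ℝ) :
    past α θ (g + g') w p = past α θ g w p + past α θ g' w p := by
  unfold past; split_ifs <;> simp

lemma past_smul (c : ℝ) (g : Fam) (w : ℕ × ℝ × ℝ) (p : ℝ × ℝ) :
    past α θ (c • g) w p = c * past α θ g w p := by
  unfold past; split_ifs <;> simp

variable (α) in
/-- Space-time convolution, as a bounded bilinear operator of the multiplier and the source. -/
def stConv (hθ : Continuous θ) (hρ : Integrable ρ) : Mul →L[ℝ] Fam →L[ℝ] Fam :=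
  LinearMap.mkContinuous₂
    (LinearMap.mk₂ ℝ (fun (m : Mul) (g : Fam) => (BoundedContinuousFunction.ofNormedAddCommGroup
        (fun w => ∫ p, stIntegrand α θ ρ m g w p) (continuous_integral_stIntegrand hθ hρ m g)
        ((π * ∫ τ, |ρ τ|) * ‖m‖ * ‖g‖) (norm_integral_stIntegrand_le hρ m g) : Fam))
      (fun m m' g => by
        ext w
        change ∫ p, stIntegrand α θ ρ (m + m') g w p = (∫ p, stIntegrand α θ ρ m g w p) +
          ∫ p, stIntegrand α θ ρ m' g w p
        rw [← integral_add (integrable_stIntegrand hρ m g w) (integrable_stIntegrand hρ m' g w)]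
        refine integral_congr_ae (Eventually.of_forall fun p => ?_)
        simp only [stIntegrand, BoundedContinuousFunction.coe_add, Pi.add_apply]
        ring)
      (fun c m g => by
        ext w
        change ∫ p, stIntegrand α θ ρ (c • m) g w p = c * ∫ p, stIntegrand α θ ρ m g w p
        rw [← integral_const_mul]
        refine integral_congr_ae (Eventually.of_forall fun p => ?_)
        simp only [stIntegrand, BoundedContinuousFunction.coe_smul, smul_eq_mul]
        ring)
      (fun m g g' => by
        ext w
        change ∫ p, stIntegrand α θ ρ m (g + g') w p = (∫ p, stIntegrand α θ ρ m g w p) +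
          ∫ p, stIntegrand α θ ρ m g' w p
        rw [← integral_add (integrable_stIntegrand hρ m g w) (integrable_stIntegrand hρ m g' w)]
        refine integral_congr_ae (Eventually.of_forall fun p => ?_)
        simp only [stIntegrand, past_add]
        ring)
      (fun c m g => by
        ext w
        change ∫ p, stIntegrand α θ ρ m (c • g) w p = c * ∫ p, stIntegrand α θ ρ m g w p
        rw [← integral_const_mul]
        refine integral_congr_ae (Eventually.of_forall fun p => ?_)
        simp only [stIntegrand, past_smul]
        ring))
    (π * ∫ τ, |ρ τ|)
    (fun m g => by
      refine (BoundedContinuousFunction.norm_le ?_).2 (norm_integral_stIntegrand_le hρ m g)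
      have : 0 ≤ ∫ τ, |ρ τ| := integral_nonneg fun _ => abs_nonneg _
      positivity)

lemma stConv_apply (hθ : Continuous θ) (hρ : Integrable ρ) (m : Mul) (g : Fam) (w : ℕ × ℝ × ℝ) :
    stConv α hθ hρ m g w = ∫ p, stIntegrand α θ ρ m g w p := rfl

lemma norm_stConv_le (hθ : Continuous θ) (hρ : Integrable ρ) (m : Mul) (g : Fam) :
    ‖stConv α hθ hρ m g‖ ≤ (π * ∫ τ, |ρ τ|) * ‖m‖ * ‖g‖ := by
  refine (BoundedContinuousFunction.norm_le ?_).2 (norm_integral_stIntegrand_le hρ m g)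
  have : 0 ≤ ∫ τ, |ρ τ| := integral_nonneg fun _ => abs_nonneg _
  positivity

end SpaceTime

section Datum

variable (α : ℝ) (θ : ℝ → ℝ) (u₀ : ℕ → ℝ → ℝ)

/-- The integrand of the spatial convolution with the data, in self-similar variables. -/
def datIntegrand (m : Mul) (w : ℕ × ℝ × ℝ) (z : ℝ) : ℝ :=
  (1 + z ^ 2)⁻¹ * (m (θ w.2.1, z) * u₀ w.1 (w.2.2 - θ w.2.1 ^ (1 / (α + 1)) * z))

variable {α θ u₀} {M : ℝ}

lemma abs_datIntegrand_le (hM : ∀ i y, |u₀ i y| ≤ M) (m : Mul) (w : ℕ × ℝ × ℝ) (z : ℝ) :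
    ‖datIntegrand α θ u₀ m w z‖ ≤ (1 + z ^ 2)⁻¹ * (‖m‖ * M) := by
  unfold datIntegrand
  rw [norm_mul, norm_mul (m _), Real.norm_of_nonneg (by positivity : 0 ≤ (1 + z ^ 2)⁻¹)]
  gcongr
  · exact m.norm_coe_le_norm _
  · exact hM _ _

lemma aestronglyMeasurable_comp_sub_mul {g : ℝ → ℝ} (hg : AEStronglyMeasurable g) (x : ℝ) {r : ℝ}
    (hr : 0 < r) : AEStronglyMeasurable fun z => g (x - r * z) := by
  have h1 : Measure.QuasiMeasurePreserving (fun z : ℝ => r * z) volume volume :=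
    ⟨by fun_prop, by
      rw [Real.map_volume_mul_left hr.ne']
      exact Measure.smul_absolutelyContinuous⟩
  have h2 : Measure.QuasiMeasurePreserving (fun z : ℝ => x - z) volume volume :=
    (Measure.measurePreserving_sub_left volume x).quasiMeasurePreserving
  exact hg.comp_quasiMeasurePreserving (h2.comp h1)

lemma integrable_datIntegrand (hθ : ∀ σ, 0 < θ σ) (hm : ∀ i, AEStronglyMeasurable (u₀ i))
    (hM : ∀ i y, |u₀ i y| ≤ M) (m : Mul) (w : ℕ × ℝ × ℝ) :
    Integrable (datIntegrand α θ u₀ m w) := by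
  refine (integrable_inv_one_add_sq.mul_const (‖m‖ * M)).mono' ?_
    (Eventually.of_forall (abs_datIntegrand_le hM m w))
  refine integrable_inv_one_add_sq.aestronglyMeasurable.mul (AEStronglyMeasurable.mul ?_
    (aestronglyMeasurable_comp_sub_mul (hm _) _ (Real.rpow_pos_of_pos (hθ _) _)))
  exact (m.continuous.comp (by fun_prop)).aestronglyMeasurable

lemma norm_integral_datIntegrand_le (hM : ∀ i y, |u₀ i y| ≤ M) (m : Mul) (w : ℕ × ℝ × ℝ) :
    ‖∫ z, datIntegrand α θ u₀ m w z‖ ≤ (π * M) * ‖m‖ := by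
  have h := norm_integral_le_of_norm_le (integrable_inv_one_add_sq.mul_const (‖m‖ * M))
    (Eventually.of_forall (abs_datIntegrand_le (α := α) (θ := θ) hM m w))
  refine h.trans_eq ?_
  rw [integral_mul_const, integral_univ_inv_one_add_sq]
  ring

lemma integral_datIntegrand_eq (hθ : ∀ σ, 0 < θ σ) (m : Mul) (w : ℕ × ℝ × ℝ) :
    ∫ z, datIntegrand α θ u₀ m w z = (θ w.2.1 ^ (1 / (α + 1)))⁻¹ * ∫ y,
      (1 + ((w.2.2 - y) / θ w.2.1 ^ (1 / (α + 1))) ^ 2)⁻¹ *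
        (m (θ w.2.1, (w.2.2 - y) / θ w.2.1 ^ (1 / (α + 1))) * u₀ w.1 y) := by
  have hr : 0 < θ w.2.1 ^ (1 / (α + 1)) := Real.rpow_pos_of_pos (hθ _) _
  conv_rhs => rw [integral_comp_sub_mul _ w.2.2 hr]
  rw [smul_eq_mul, ← mul_assoc, inv_mul_cancel₀ hr.ne', one_mul]
  refine integral_congr_ae (Eventually.of_forall fun z => ?_)
  simp only [datIntegrand]
  rw [show (w.2.2 - (w.2.2 - θ w.2.1 ^ (1 / (α + 1)) * z)) / θ w.2.1 ^ (1 / (α + 1)) = z by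
    field_simp; ring]

/-- A majorant independent of centre and scale within a bounded range, used to dominate the data
integral locally. -/
lemma inv_one_add_sq_le {x y r R : ℝ} (hr : 0 < r) (hrR : r ≤ R) (hx : |x| ≤ R) :
    (1 + ((x - y) / r) ^ 2)⁻¹ ≤ 2 * (1 + R ^ 2) ^ 2 * (1 + y ^ 2)⁻¹ := by
  have hR : 0 < R := hr.trans_le hrR
  rw [← div_eq_mul_inv, inv_le_iff_one_le_mul₀ (by positivity), ← mul_div_right_comm,
    le_div_iff₀ (by positivity), one_mul]
  have h1 : (x - y) ^ 2 ≤ R ^ 2 * ((x - y) / r) ^ 2 := by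
    rw [div_pow, ← mul_div_assoc, le_div_iff₀ (by positivity)]
    have : r ^ 2 ≤ R ^ 2 := by gcongr
    nlinarith [sq_nonneg (x - y)]
  have h2 : x ^ 2 ≤ R ^ 2 := by rw [← sq_abs x]; gcongr
  set D := ((x - y) / r) ^ 2 with hD
  have hD0 : 0 ≤ D := by positivity
  have h3 : y ^ 2 ≤ 2 * x ^ 2 + 2 * (x - y) ^ 2 := by nlinarith [sq_nonneg (2 * x - y)]
  have h4 : 0 ≤ R ^ 2 * D := by positivity
  have h5 : 0 ≤ R ^ 2 * R ^ 2 * D := by positivity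
  nlinarith [sq_nonneg (R ^ 2)]

/-- The data are only measurable and cannot be evaluated along moving points continuously. A change
of variables fixes the argument of the datum and leaves the dependence on space-time in continuous
factors. -/
lemma continuous_integral_datIntegrand (hθc : Continuous θ) (hθ : ∀ σ, 0 < θ σ)
    (hm : ∀ i, AEStronglyMeasurable (u₀ i)) (hM : ∀ i y, |u₀ i y| ≤ M) (m : Mul) :
    Continuous fun w => ∫ z, datIntegrand α θ u₀ m w z := by
  have hrpos : ∀ w : ℕ × ℝ × ℝ, 0 < θ w.2.1 ^ (1 / (α + 1)) := fun w =>
    Real.rpow_pos_of_pos (hθ _) _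
  have hrc : Continuous fun w : ℕ × ℝ × ℝ => θ w.2.1 ^ (1 / (α + 1)) :=
    (hθc.comp (by fun_prop)).rpow_const fun w => Or.inl (hθ _).ne'
  simp_rw [integral_datIntegrand_eq hθ]
  refine (hrc.inv₀ fun w => (hrpos w).ne').mul ?_
  rw [continuous_iff_continuousAt]
  intro w₀
  have hmeas : ∀ w : ℕ × ℝ × ℝ, AEStronglyMeasurable fun y =>
      (1 + ((w.2.2 - y) / θ w.2.1 ^ (1 / (α + 1))) ^ 2)⁻¹ *
        (m (θ w.2.1, (w.2.2 - y) / θ w.2.1 ^ (1 / (α + 1))) * u₀ w.1 y) := by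
    intro w
    refine AEStronglyMeasurable.mul (Measurable.aestronglyMeasurable (by fun_prop))
      (AEStronglyMeasurable.mul ?_ (hm _))
    exact (m.continuous.comp (by fun_prop)).aestronglyMeasurable
  -- A common bound for position and length scale near the base point. The discrete family index is
  -- locally constant.
  set R := max (θ w₀.2.1 ^ (1 / (α + 1))) |w₀.2.2| + 1 with hR
  have hev : ∀ᶠ w : ℕ × ℝ × ℝ in 𝓝 w₀, θ w.2.1 ^ (1 / (α + 1)) < R ∧ |w.2.2| < R ∧ w.1 = w₀.1 := by
    refine (hrc.continuousAt.eventually (gt_mem_nhds ?_)).and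
      (((by fun_prop : Continuous fun w : ℕ × ℝ × ℝ => |w.2.2|).continuousAt.eventually
        (gt_mem_nhds ?_)).and ?_)
    · exact (le_max_left _ _).trans_lt (lt_add_one _)
    · exact (le_max_right _ _).trans_lt (lt_add_one _)
    · exact (continuous_fst.continuousAt (x := w₀)).eventually
        ((isOpen_discrete {w₀.1}).mem_nhds rfl)
  have hcont : ContinuousAt (fun w : ℕ × ℝ × ℝ => ∫ y,
      (1 + ((w.2.2 - y) / θ w.2.1 ^ (1 / (α + 1))) ^ 2)⁻¹ *
        (m (θ w.2.1, (w.2.2 - y) / θ w.2.1 ^ (1 / (α + 1))) * u₀ w₀.1 y)) w₀ := by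
    refine continuousAt_of_dominated
      (bound := fun y => 2 * (1 + R ^ 2) ^ 2 * (1 + y ^ 2)⁻¹ * (‖m‖ * M)) ?_ ?_
      ((integrable_inv_one_add_sq.const_mul _).mul_const _) ?_
    · filter_upwards [hev] with w hw
      rw [← hw.2.2]
      exact hmeas w
    · filter_upwards [hev] with w hw
      refine Eventually.of_forall fun y => ?_
      rw [norm_mul, norm_mul (m _), Real.norm_of_nonneg (by positivity)]
      gcongr
      · exact inv_one_add_sq_le (hrpos w) hw.1.le hw.2.1.le
      · exact m.norm_coe_le_norm _
      · exact hM _ _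
    · refine Eventually.of_forall fun y => Continuous.continuousAt ?_
      have hd : Continuous fun w : ℕ × ℝ × ℝ => (w.2.2 - y) / θ w.2.1 ^ (1 / (α + 1)) :=
        (by fun_prop : Continuous fun w : ℕ × ℝ × ℝ => w.2.2 - y).div hrc fun w => (hrpos w).ne'
      refine Continuous.mul (Continuous.inv₀ (by fun_prop) fun w => by positivity)
        (Continuous.mul (m.continuous.comp (by fun_prop)) continuous_const)
  refine hcont.congr ?_
  filter_upwards [hev] with w hw
  rw [hw.2.2]

variable (α) in
/-- Spatial convolution with the data, as a bounded linear operator of the multiplier. -/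
def datConv (hθc : Continuous θ) (hθ : ∀ σ, 0 < θ σ)
    (hm : ∀ i, AEStronglyMeasurable (u₀ i)) (hM : ∀ i y, |u₀ i y| ≤ M) : Mul →L[ℝ] Fam :=
  LinearMap.mkContinuous
    { toFun := fun m => BoundedContinuousFunction.ofNormedAddCommGroup
        (fun w => ∫ z, datIntegrand α θ u₀ m w z)
        (continuous_integral_datIntegrand hθc hθ hm hM m) ((π * M) * ‖m‖)
        (norm_integral_datIntegrand_le hM m)
      map_add' := fun m m' => by
        ext w
        change ∫ z, datIntegrand α θ u₀ (m + m') w z = (∫ z, datIntegrand α θ u₀ m w z) +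
          ∫ z, datIntegrand α θ u₀ m' w z
        rw [← integral_add (integrable_datIntegrand hθ hm hM m w)
          (integrable_datIntegrand hθ hm hM m' w)]
        refine integral_congr_ae (Eventually.of_forall fun p => ?_)
        simp only [datIntegrand, BoundedContinuousFunction.coe_add, Pi.add_apply]
        ring
      map_smul' := fun c m => by
        ext w
        change ∫ z, datIntegrand α θ u₀ (c • m) w z = c * ∫ z, datIntegrand α θ u₀ m w z
        rw [← integral_const_mul]
        refine integral_congr_ae (Eventually.of_forall fun p => ?_)
        simp only [datIntegrand, BoundedContinuousFunction.coe_smul, smul_eq_mul]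
        ring }
    (π * M)
    (fun m => by
      refine (BoundedContinuousFunction.norm_le ?_).2 (norm_integral_datIntegrand_le hM m)
      have : 0 ≤ M := (abs_nonneg _).trans (hM 0 0)
      positivity)

lemma datConv_apply (hθc : Continuous θ) (hθ : ∀ σ, 0 < θ σ)
    (hm : ∀ i, AEStronglyMeasurable (u₀ i)) (hM : ∀ i y, |u₀ i y| ≤ M) (m : Mul)
    (w : ℕ × ℝ × ℝ) : datConv α hθc hθ hm hM m w = ∫ z, datIntegrand α θ u₀ m w z := rfl

end Datum

section Identification

variable {α : ℝ} (h0 : 0 < α) (h1 : α < 1) {θ ρ : ℝ → ℝ}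

/-- The data operator applied to the multiplier of order zero is the semigroup in a moving frame. -/
lemma datConv_mult (hθc : Continuous θ) (hθ : ∀ σ, 0 < θ σ) {u₀ : ℕ → ℝ → ℝ} {M : ℝ}
    (hm : ∀ i, AEStronglyMeasurable (u₀ i)) (hM : ∀ i y, |u₀ i y| ≤ M) {p : ℝ × ℝ}
    (hp : p ∈ params) (w : ℕ × ℝ × ℝ) (hw : θ w.2.1 ≤ 1 ∨ p.2 = 0) :
    datConv α hθc hθ hm hM (mult h0 h1 admissible_zero 0 p) w =
      conv α 0 (θ w.2.1 * p.1) (u₀ w.1) (w.2.2 + p.2 * θ w.2.1) := by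
  rw [conv_frame h0 (hθ _), zero_div, neg_zero, Real.rpow_zero, one_mul, datConv_apply]
  refine integral_congr_ae (Eventually.of_forall fun z => ?_)
  simp only [datIntegrand, mult_apply h0 h1 _ _ hp, pow_zero, one_mul]
  -- The truncation inside `nu` has no effect for times at most one, and it is irrelevant when `μ =
  -- 0`.
  have : p.2 * nu α (θ w.2.1) = p.2 * θ w.2.1 ^ (1 - 1 / (α + 1)) := by
    rcases hw with h | h
    · rw [nu_of_mem (hθ _).le h]
    · rw [h]; simp
  rw [this]
  field_simp

/-- The space-time operator applied to the multiplier of order one is the source term of the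
Duhamel formula in a moving frame, with an exponential weight. -/
lemma stConv_mult (hθc : Continuous θ) (hρ : Integrable ρ) {γ : ℝ} {p : ℝ × ℝ}
    (hp : p ∈ params) (g : Fam) (F : ℝ → ℝ → ℝ) (w : ℕ × ℝ × ℝ) (hθ : 0 < θ w.2.1)
    (hw : θ w.2.1 ≤ 1 ∨ p.2 = 0) (hρ0 : ∀ τ ≤ 0, ρ τ = 0)
    (hρ1 : ∀ τ ∈ Ioo 0 (θ w.2.1), ρ τ = Real.exp (-(γ * τ)) * τ ^ (-(1 / (α + 1))))
    (hg : ∀ s ∈ Ioo 0 (θ w.2.1), ∀ y, g (w.1, Real.log s, y) =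
      Real.exp (-(γ * s)) * F (p.1 * s) (y + p.2 * s)) :
    stConv α hθc hρ (p.1 • mult h0 h1 admissible_one 0 p) g w =
      Real.exp (-(γ * θ w.2.1)) * src α F (p.1 * θ w.2.1) (w.2.2 + p.2 * θ w.2.1) := by
  set t := θ w.2.1 with ht
  have hp1 : 0 < p.1 := by rw [mem_params, abs_lt] at hp; linarith
  rw [stConv_apply, Measure.volume_eq_prod, integral_prod _ (by
    rw [← Measure.volume_eq_prod]; exact integrable_stIntegrand hρ _ g w)]
  rw [src_eq (by positivity)]
  -- Outside `(0, t)` either the weight vanishes or the past has been extended by zero.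
  have e1 : ∀ τ, τ ∉ Ioo 0 t → ∫ z, stIntegrand α θ ρ
      (p.1 • mult h0 h1 admissible_one 0 p) g w (τ, z) = 0 := by
    intro τ hτ
    have : ∀ z, stIntegrand α θ ρ
        (p.1 • mult h0 h1 admissible_one 0 p) g w (τ, z) = 0 := by
      intro z
      unfold stIntegrand past
      by_cases h : 0 < τ
      · rw [if_neg (fun h' => hτ ⟨h, h'⟩)]; simp
      · rw [hρ0 τ (not_lt.1 h)]; simp
    simp [this]
  rw [← setIntegral_eq_integral_of_forall_compl_eq_zero (fun τ hτ => e1 τ hτ)]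
  -- The weight `e^{-γτ}` combines with `e^{-γ(t-τ)}` from the source into `e^{-γt}`. The factor `λ`
  -- is the Jacobian of the rescaled time.
  have e2 : ∀ τ ∈ Ioo 0 t, ∫ z, stIntegrand α θ ρ
      (p.1 • mult h0 h1 admissible_one 0 p) g w (τ, z) =
      Real.exp (-(γ * t)) * (p.1 *
        conv α 1 (p.1 * τ) (F (p.1 * t - p.1 * τ)) (w.2.2 + p.2 * t)) := by
    intro τ hτ
    have := conv_frame (q := 1) (t := τ) (l := p.1) (m := p.2) h0 hτ.1 (F (p.1 * t - p.1 * τ))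
      (w.2.2 + p.2 * (t - τ))
    rw [show w.2.2 + p.2 * (t - τ) + p.2 * τ = w.2.2 + p.2 * t by ring, mul_comm τ p.1] at this
    rw [this, ← integral_const_mul, ← integral_const_mul, ← integral_const_mul]
    refine integral_congr_ae (Eventually.of_forall fun z => ?_)
    have hnu : p.2 * nu α τ = p.2 * τ ^ (1 - 1 / (α + 1)) := by
      rcases hw with h | h
      · rw [nu_of_mem hτ.1.le (hτ.2.le.trans h)]
      · rw [h]; simp
    simp only [stIntegrand, past, ← ht, if_pos hτ.2, BoundedContinuousFunction.coe_smul,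
      smul_eq_mul, mult_apply h0 h1 _ _ hp, pow_zero, one_mul, hρ1 τ hτ, hnu]
    rw [hg (t - τ) ⟨by linarith [hτ.2], by linarith [hτ.1]⟩]
    rw [show w.2.2 - τ ^ (1 / (α + 1)) * z + p.2 * (t - τ) =
      w.2.2 + p.2 * (t - τ) - τ ^ (1 / (α + 1)) * z by ring, mul_sub p.1,
      show -(γ * t) = -(γ * τ) + -(γ * (t - τ)) by ring, Real.exp_add]
    field_simp
  rw [setIntegral_congr_fun measurableSet_Ioo e2, integral_const_mul, integral_const_mul]
  congr 1
  have := intervalIntegral.integral_comp_mul_left (a := 0) (b := t)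
    (fun τ => conv α 1 τ (F (p.1 * t - τ)) (w.2.2 + p.2 * t)) hp1.ne'
  rw [mul_zero, intervalIntegral.integral_of_le hθ.le,
    intervalIntegral.integral_of_le (by positivity), integral_Ioc_eq_integral_Ioo,
    integral_Ioc_eq_integral_Ioo, smul_eq_mul] at this
  rw [this, ← mul_assoc, mul_inv_cancel₀ hp1.ne', one_mul]

end Identification

end Operators

/-! ### Global mild solutions for compactly supported flux -/

section Existence

open scoped BoundedContinuousFunction

/-- `u` is continuous for positive times, vanishes for nonpositive times, and satisfies the Duhamel
formula at every point. -/
structure GlobalMild (α : ℝ) (f u₀ : ℝ → ℝ) (u : ℝ → ℝ → ℝ) : Prop where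
  cont : ContinuousOn (Function.uncurry u) (Ioi 0 ×ˢ univ)
  zero : ∀ t ≤ 0, ∀ x, u t x = 0
  eq : ∀ t, 0 < t → ∀ x, u t x = conv α 0 t u₀ x - src α (fun s y => f (u s y)) t x

/-- The singular time weight `e^{-γτ} τ^{-1/(α+1)}` on `τ > 0`. -/
def expWeight (α γ : ℝ) : ℝ → ℝ :=
  (Ioi (0 : ℝ)).indicator fun τ => Real.exp (-(γ * τ)) * τ ^ (-(1 / (α + 1)))

lemma integrable_expWeight {α γ : ℝ} (h0 : 0 < α) (hγ : 0 < γ) : Integrable (expWeight α γ) := by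
  have h := integrableOn_rpow_mul_exp_neg_mul_rpow (p := 1) (s := -(1 / (α + 1))) (b := γ)
    (by rw [neg_lt_neg_iff, div_lt_one (by linarith)]; linarith) one_pos hγ
  refine (integrable_indicator_iff measurableSet_Ioi).2 (h.congr_fun (fun τ _ => ?_)
    measurableSet_Ioi)
  simp [mul_comm]

lemma integral_expWeight {α γ : ℝ} (h0 : 0 < α) (hγ : 0 < γ) :
    ∫ τ, |expWeight α γ τ| = (1 / γ) ^ (1 - 1 / (α + 1)) * Real.Gamma (1 - 1 / (α + 1)) := by
  rw [← Real.integral_rpow_mul_exp_neg_mul_Ioi (one_sub_pos h0) hγ, ← integral_indicator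
    measurableSet_Ioi]
  refine integral_congr_ae (Eventually.of_forall fun τ => ?_)
  by_cases h : τ ∈ Ioi (0 : ℝ)
  · have h' : (0 : ℝ) < τ := h
    simp only [expWeight, indicator_of_mem h]
    rw [abs_of_pos (by positivity), mul_comm]
    congr 2
    ring
  · simp [expWeight, indicator_of_notMem h]

lemma tendsto_integral_expWeight {α : ℝ} (h0 : 0 < α) :
    Tendsto (fun γ => ∫ τ, |expWeight α γ τ|) atTop (𝓝 0) := by
  have h := ((tendsto_rpow_neg_atTop (one_sub_pos h0)).mul_const (Real.Gamma (1 - 1 / (α + 1))))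
  rw [zero_mul] at h
  refine h.congr' ?_
  filter_upwards [eventually_gt_atTop 0] with γ hγ
  rw [integral_expWeight h0 hγ, Real.rpow_neg hγ.le, one_div, one_div, Real.inv_rpow hγ.le]

lemma one_zero_mem_params : ((1 : ℝ), (0 : ℝ)) ∈ params := by
  simp [params]

/-- The weighted superposition operator `v ↦ e^{-γt} f(e^{γt} v)`. -/
def weightedNem (γ : ℝ) (hγ : 0 ≤ γ) (f : ℝ →ᵇ ℝ) (v : Fam) : Fam :=
  BoundedContinuousFunction.ofNormedAddCommGroup
    (fun w => Real.exp (-(γ * Real.exp w.2.1)) * f (Real.exp (γ * Real.exp w.2.1) * v w))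
    (by fun_prop) ‖f‖ (fun w => by
      rw [norm_mul, Real.norm_of_nonneg (Real.exp_pos _).le]
      refine (mul_le_of_le_one_left (norm_nonneg _) ?_).trans (f.norm_coe_le_norm _)
      rw [Real.exp_le_one_iff]
      have := Real.exp_pos w.2.1
      nlinarith)

lemma norm_weightedNem_sub_le {γ : ℝ} (hγ : 0 ≤ γ) {f f' : ℝ →ᵇ ℝ}
    (h1 : ∀ x, HasDerivAt f (f' x) x) (v v' : Fam) :
    ‖weightedNem γ hγ f v - weightedNem γ hγ f v'‖ ≤ ‖f'‖ * ‖v - v'‖ := by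
  rw [BoundedContinuousFunction.norm_le (by positivity)]
  intro w
  change ‖Real.exp (-(γ * Real.exp w.2.1)) * f (Real.exp (γ * Real.exp w.2.1) * v w) -
    Real.exp (-(γ * Real.exp w.2.1)) * f (Real.exp (γ * Real.exp w.2.1) * v' w)‖ ≤ _
  rw [← mul_sub, norm_mul, Real.norm_of_nonneg (Real.exp_pos _).le]
  have h2 := nem_lipschitz h1 (Real.exp (γ * Real.exp w.2.1) * v w)
    (Real.exp (γ * Real.exp w.2.1) * v' w)
  rw [← mul_sub, abs_mul, abs_of_pos (Real.exp_pos _)] at h2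
  have h3 : |v w - v' w| ≤ ‖v - v'‖ := (v - v').norm_coe_le_norm w
  calc _ ≤ Real.exp (-(γ * Real.exp w.2.1)) *
        (‖f'‖ * (Real.exp (γ * Real.exp w.2.1) * |v w - v' w|)) := by gcongr; exact h2
    _ = (Real.exp (-(γ * Real.exp w.2.1)) * Real.exp (γ * Real.exp w.2.1)) *
        (‖f'‖ * |v w - v' w|) := by ring
    _ = ‖f'‖ * |v w - v' w| := by rw [← Real.exp_add]; simp
    _ ≤ _ := by gcongr

/-- Global existence of mild solutions when the flux is smooth with compact support. -/
theorem exists_globalMild {α : ℝ} (h0 : 0 < α) (h1 : α < 1) {f : ℝ → ℝ} (hf : ContDiff ℝ ∞ f)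
    (hs : HasCompactSupport f) {u₀ : ℝ → ℝ} {M : ℝ} (hm : AEStronglyMeasurable u₀)
    (hM : ∀ y, |u₀ y| ≤ M) : ∃ u, GlobalMild α f u₀ u := by
  set m : Mul := (1 : ℝ) • mult h0 h1 admissible_one 0 ((1 : ℝ), (0 : ℝ)) with hmdef
  set L := ‖iterBdd hf hs 1‖ with hL
  -- The mass of the weighted time kernel tends to zero as `γ → ∞`, so one `γ` gives a contraction
  -- on all of `(0, ∞)` at once.
  obtain ⟨γ, hγ0, hγ⟩ : ∃ γ : ℝ, 0 < γ ∧ (π * ∫ τ, |expWeight α γ τ|) * ‖m‖ * L ≤ 1 / 2 := by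
    have h := (((tendsto_integral_expWeight h0).const_mul π).mul_const ‖m‖).mul_const L
    simp only [mul_zero, zero_mul] at h
    obtain ⟨γ, hγ⟩ := ((eventually_gt_atTop 0).and (h.eventually (gt_mem_nhds
      (by norm_num : (0 : ℝ) < 1 / 2)))).exists
    exact ⟨γ, hγ.1, hγ.2.le⟩
  have hρ := integrable_expWeight h0 hγ0
  set B : Fam := datConv α (u₀ := fun _ => u₀) Real.continuous_exp Real.exp_pos (fun _ => hm)
    (fun _ => hM) (mult h0 h1 admissible_zero 0 ((1 : ℝ), (0 : ℝ))) with hB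
  set E : Fam := BoundedContinuousFunction.ofNormedAddCommGroup
    (fun w : ℕ × ℝ × ℝ => Real.exp (-(γ * Real.exp w.2.1))) (by fun_prop) 1 (fun w => by
      rw [Real.norm_of_nonneg (Real.exp_pos _).le, Real.exp_le_one_iff]
      have := Real.exp_pos w.2.1
      nlinarith) with hE
  set Φ : Fam → Fam := fun v => E * B - stConv α Real.continuous_exp hρ m
    (weightedNem γ hγ0.le (iterBdd hf hs 0) v) with hΦ
  have hcontr : ContractingWith (1 / 2 : NNReal) Φ := by
    refine ⟨by rw [← NNReal.coe_lt_coe]; norm_num, LipschitzWith.of_dist_le_mul fun v v' => ?_⟩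
    rw [dist_eq_norm, dist_eq_norm]
    have e : Φ v - Φ v' = stConv α Real.continuous_exp hρ m
        (weightedNem γ hγ0.le (iterBdd hf hs 0) v' - weightedNem γ hγ0.le (iterBdd hf hs 0) v) := by
      simp only [hΦ, map_sub]; abel
    rw [e]
    refine (norm_stConv_le _ hρ m _).trans ?_
    have h2 := norm_weightedNem_sub_le hγ0.le (hasDerivAt_iterBdd hf hs 0) v' v
    have hI : 0 ≤ ∫ τ, |expWeight α γ τ| := integral_nonneg fun _ => abs_nonneg _
    calc _ ≤ (π * ∫ τ, |expWeight α γ τ|) * ‖m‖ * (L * ‖v' - v‖) := by gcongr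
      _ = ((π * ∫ τ, |expWeight α γ τ|) * ‖m‖ * L) * ‖v - v'‖ := by rw [norm_sub_rev]; ring
      _ ≤ _ := by
        push_cast
        gcongr
  set v := hcontr.fixedPoint with hv
  have hfix : Φ v = v := hcontr.fixedPoint_isFixedPt
  -- The fixed point is `e^{-γt} u` in logarithmic time. Only one member of the family is used here.
  refine ⟨fun t x => if 0 < t then Real.exp (γ * t) * v (0, Real.log t, x) else 0, ?_, ?_, ?_⟩
  · have : ContinuousOn (fun p : ℝ × ℝ => Real.exp (γ * p.1) * v (0, Real.log p.1, p.2))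
        (Ioi 0 ×ˢ univ) := by
      refine ContinuousOn.mul (by fun_prop) (v.continuous.comp_continuousOn ?_)
      refine continuousOn_const.prodMk (ContinuousOn.prodMk ?_ (by fun_prop))
      exact ContinuousOn.log (by fun_prop) fun p hp => (ne_of_gt hp.1)
    refine this.congr fun p hp => ?_
    have hp' : 0 < p.1 := hp.1
    simp [Function.uncurry, hp']
  · intro t ht x
    simp [not_lt.2 ht]
  · intro t ht x
    have hw := congrArg (fun g : Fam => g (0, Real.log t, x)) hfix
    have hst := stConv_mult h0 h1 Real.continuous_exp hρ (γ := γ) one_zero_mem_params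
      (weightedNem γ hγ0.le (iterBdd hf hs 0) v)
      (fun s y => f (if 0 < s then Real.exp (γ * s) * v (0, Real.log s, y) else 0))
      (0, Real.log t, x) (Real.exp_pos _) (Or.inr rfl)
      (fun τ hτ => by simp [expWeight, hτ])
      (fun τ hτ => by simp [expWeight, hτ.1]) (by
        intro s hs' y
        have hs0 : 0 < s := hs'.1
        change Real.exp (-(γ * Real.exp (Real.log s))) * iterBdd hf hs 0
          (Real.exp (γ * Real.exp (Real.log s)) * v (0, Real.log s, y)) = _
        rw [Real.exp_log hs0, iterBdd_zero]
        simp [hs0])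
    have hdt := datConv_mult h0 h1 (u₀ := fun _ => u₀) Real.continuous_exp Real.exp_pos
      (fun _ => hm) (fun _ => hM) one_zero_mem_params (0, Real.log t, x) (Or.inr rfl)
    simp only [Real.exp_log ht, one_mul, mul_one, zero_mul, add_zero] at hst hdt
    simp only [hΦ, BoundedContinuousFunction.coe_sub, Pi.sub_apply,
      BoundedContinuousFunction.coe_mul, Pi.mul_apply] at hw
    rw [hmdef, hst, hB, hdt] at hw
    have hEt : E (0, Real.log t, x) = Real.exp (-(γ * t)) := by
      change Real.exp (-(γ * Real.exp (Real.log t))) = _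
      rw [Real.exp_log ht]
    rw [hEt] at hw
    simp only [if_pos ht]
    rw [← hw, ← mul_sub, ← mul_assoc, ← Real.exp_add]
    simp

end Existence

/-! ### Interior smoothness by the implicit function theorem in moving frames -/

section Regularity

open scoped BoundedContinuousFunction

/-- The singular time weight `τ^{-1/(α+1)}` on `(0, T)`. -/
def cutWeight (α T : ℝ) : ℝ → ℝ := (Ioo (0 : ℝ) T).indicator fun τ => τ ^ (-(1 / (α + 1)))

lemma integrable_cutWeight {α : ℝ} (h0 : 0 < α) (T : ℝ) : Integrable (cutWeight α T) :=
  (integrable_indicator_iff measurableSet_Ioo).2 (integrableOn_time h0 T)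

lemma integral_time {α : ℝ} (h0 : 0 < α) {T : ℝ} (hT : 0 ≤ T) :
    ∫ τ in Ioo 0 T, τ ^ (-(1 / (α + 1))) = T ^ (1 - 1 / (α + 1)) / (1 - 1 / (α + 1)) := by
  have hp := one_sub_pos h0
  rw [← integral_Ioc_eq_integral_Ioo, ← intervalIntegral.integral_of_le hT,
    integral_rpow (Or.inl (by linarith))]
  rw [show -(1 / (α + 1)) + 1 = 1 - 1 / (α + 1) by ring, Real.zero_rpow hp.ne', sub_zero]

lemma integral_cutWeight {α : ℝ} (h0 : 0 < α) {T : ℝ} (hT : 0 ≤ T) :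
    ∫ τ, |cutWeight α T τ| = T ^ (1 - 1 / (α + 1)) / (1 - 1 / (α + 1)) := by
  rw [← integral_time h0 hT, ← integral_indicator measurableSet_Ioo]
  refine integral_congr_ae (Eventually.of_forall fun τ => ?_)
  by_cases h : τ ∈ Ioo (0 : ℝ) T
  · simp only [cutWeight, indicator_of_mem h]
    exact abs_of_pos (Real.rpow_pos_of_pos h.1 _)
  · simp [cutWeight, indicator_of_notMem h]

lemma tendsto_rpow_nhdsGT_zero {α : ℝ} (h0 : 0 < α) :
    Tendsto (fun T : ℝ => T ^ (1 - 1 / (α + 1))) (𝓝[>] 0) (𝓝 0) := by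
  have := (Real.continuousAt_rpow_const 0 _ (Or.inr (one_sub_pos h0).le)).tendsto
  rw [Real.zero_rpow (one_sub_pos h0).ne'] at this
  exact this.mono_left nhdsWithin_le_nhds

/-- The logarithmic time variable, stopped at time `T`. -/
def stopTime (T σ : ℝ) : ℝ := min (Real.exp σ) T

lemma continuous_stopTime (T : ℝ) : Continuous (stopTime T) := by
  unfold stopTime; fun_prop

lemma stopTime_pos {T : ℝ} (hT : 0 < T) (σ : ℝ) : 0 < stopTime T σ := lt_min (Real.exp_pos _) hT

lemma stopTime_log {T s : ℝ} (hs : 0 < s) (hsT : s ≤ T) : stopTime T (Real.log s) = s := by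
  simp [stopTime, Real.exp_log hs, hsT]

/-- The family `u_i` in the frame with parameters `p = (λ, μ)`: `u_i(λt, x + μt)`. -/
def frameFun (T : ℝ) (u : ℕ → ℝ → ℝ → ℝ) (p : ℝ × ℝ) (w : ℕ × ℝ × ℝ) : ℝ :=
  u w.1 (p.1 * stopTime T w.2.1) (w.2.2 + p.2 * stopTime T w.2.1)

lemma continuous_frameFun {T : ℝ} (hT : 0 < T) {u : ℕ → ℝ → ℝ → ℝ}
    (hc : ∀ i, ContinuousOn (Function.uncurry (u i)) (Ioi 0 ×ˢ univ)) {p : ℝ × ℝ} (hp : p ∈ params) :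
    Continuous (frameFun T u p) := by
  have hst := continuous_stopTime T
  have hp1 : 0 < p.1 := by rw [mem_params, abs_lt] at hp; linarith
  rw [continuous_prod_of_discrete_left]
  intro i
  have : Continuous fun q : ℝ × ℝ => (p.1 * stopTime T q.1, q.2 + p.2 * stopTime T q.1) := by
    fun_prop
  exact (hc i).comp_continuous this fun q => ⟨mul_pos hp1 (stopTime_pos hT _), mem_univ _⟩

/-- The bundled version of `frameFun`. -/
def frame {T : ℝ} (hT : 0 < T) (hT1 : T ≤ 1) {u : ℕ → ℝ → ℝ → ℝ}
    (hc : ∀ i, ContinuousOn (Function.uncurry (u i)) (Ioi 0 ×ˢ univ)) {M : ℝ}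
    (hb : ∀ i, ∀ t ≤ 2, ∀ x, |u i t x| ≤ M) (p : ℝ × ℝ) : Fam :=
  open Classical in
  if hp : p ∈ params then
    BoundedContinuousFunction.ofNormedAddCommGroup (frameFun T u p) (continuous_frameFun hT hc hp)
      M (fun w => hb _ _ (by
        have hle : p.1 ≤ 3 / 2 := by rw [mem_params, abs_lt] at hp; linarith
        have hst : stopTime T w.2.1 ≤ T := min_le_right _ _
        have hpos := stopTime_pos hT w.2.1
        nlinarith) _)
  else 0

lemma frame_apply {T : ℝ} (hT : 0 < T) (hT1 : T ≤ 1) {u : ℕ → ℝ → ℝ → ℝ}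
    (hc : ∀ i, ContinuousOn (Function.uncurry (u i)) (Ioi 0 ×ˢ univ)) {M : ℝ}
    (hb : ∀ i, ∀ t ≤ 2, ∀ x, |u i t x| ≤ M) {p : ℝ × ℝ} (hp : p ∈ params) (w : ℕ × ℝ × ℝ) :
    frame hT hT1 hc hb p w = frameFun T u p w := by
  rw [frame, dif_pos hp]; rfl

section

variable {α : ℝ} (h0 : 0 < α) (h1 : α < 1)

/-- A time step on which the fixed point map is a contraction, uniformly in the parameters. -/
lemma exists_step {L : ℝ} (hL : 0 ≤ L) : ∃ T : ℝ, 0 < T ∧ T ≤ 1 ∧ ∀ p ∈ params,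
    (π * ∫ τ, |cutWeight α T τ|) * ‖p.1 • mult h0 h1 admissible_one 0 p‖ * L ≤ 1 / 2 := by
  obtain ⟨C, hC, H⟩ := norm_mult_le h0 h1 admissible_one
  have h := ((tendsto_rpow_nhdsGT_zero h0).div_const (1 - 1 / (α + 1))).const_mul
    (π * (3 / 2 * C) * |L|)
  simp only [zero_div, mul_zero] at h
  obtain ⟨T, hT, hT0, hT1⟩ := ((h.eventually (gt_mem_nhds (by norm_num : (0 : ℝ) < 1 / 2))).and
    (Ioc_mem_nhdsGT (one_pos : (0:ℝ) < 1))).exists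
  refine ⟨T, hT0, hT1, fun p hp => ?_⟩
  rw [integral_cutWeight h0 hT0.le]
  have hp1 : |p.1| ≤ 3 / 2 := by
    rw [mem_params, abs_lt] at hp
    exact abs_le.2 ⟨by linarith, by linarith⟩
  have hn : ‖p.1 • mult h0 h1 admissible_one 0 p‖ ≤ 3 / 2 * C := by
    rw [norm_smul]
    exact mul_le_mul hp1 (H 0 p) (norm_nonneg _) (by norm_num)
  have hpos : 0 ≤ T ^ (1 - 1 / (α + 1)) / (1 - 1 / (α + 1)) :=
    div_nonneg (Real.rpow_nonneg hT0.le _) (one_sub_pos h0).le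
  calc _ ≤ π * (T ^ (1 - 1 / (α + 1)) / (1 - 1 / (α + 1))) * (3 / 2 * C) * |L| := by
        gcongr
        exact le_abs_self L
    _ = (π * (3 / 2 * C) * |L|) * (T ^ (1 - 1 / (α + 1)) / (1 - 1 / (α + 1))) := by ring
    _ ≤ 1 / 2 := hT.le

variable {f : ℝ → ℝ} (hf : ContDiff ℝ ∞ f) (hs : HasCompactSupport f)

/-- The implicit equation satisfied by the solutions in moving frames. -/
def implicitEq {T : ℝ} (hT : 0 < T) {u₀ : ℕ → ℝ → ℝ} {M : ℝ}
    (hm : ∀ i, AEStronglyMeasurable (u₀ i)) (hM : ∀ i y, |u₀ i y| ≤ M) (q : (ℝ × ℝ) × Fam) : Fam :=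
  q.2 - datConv α (continuous_stopTime T) (stopTime_pos hT) hm hM
      (mult h0 h1 admissible_zero 0 q.1) +
    stConv α (continuous_stopTime T) (integrable_cutWeight h0 T)
      (q.1.1 • mult h0 h1 admissible_one 0 q.1) (nem (iterBdd hf hs 0) q.2)

/-- Evaluating Duhamel's formula at `(λt, x + μt)` and scaling to self-similar variables puts all
explicit parameter dependence into the multipliers. The condition `T ≤ 1` is what makes the
truncated `nu` the true displacement. -/
lemma implicitEq_frame {T : ℝ} (hT : 0 < T) (hT1 : T ≤ 1) {u₀ : ℕ → ℝ → ℝ} {M : ℝ}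
    (hm : ∀ i, AEStronglyMeasurable (u₀ i)) (hM : ∀ i y, |u₀ i y| ≤ M) {u : ℕ → ℝ → ℝ → ℝ} {M' : ℝ}
    (hu : ∀ i, GlobalMild α f (u₀ i) (u i)) (hb : ∀ i, ∀ t ≤ 2, ∀ x, |u i t x| ≤ M')
    {p : ℝ × ℝ} (hp : p ∈ params) :
    implicitEq h0 h1 hf hs hT hm hM (p, frame hT hT1 (fun i => (hu i).cont) hb p) = 0 := by
  have hp1 : 0 < p.1 := by rw [mem_params, abs_lt] at hp; linarith
  ext w
  have ht := stopTime_pos hT w.2.1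
  have htT : stopTime T w.2.1 ≤ T := min_le_right _ _
  have hst := stConv_mult h0 h1 (continuous_stopTime T) (integrable_cutWeight h0 T) (γ := 0) hp
    (nem (iterBdd hf hs 0) (frame hT hT1 (fun i => (hu i).cont) hb p))
    (fun s y => f (u w.1 s y)) w ht (Or.inl (htT.trans hT1))
    (fun τ hτ => by simp [cutWeight, not_lt.2 hτ])
    (fun τ hτ => by simp [cutWeight, hτ.1, hτ.2.trans_le htT]) (by
      intro s hs' y
      rw [nem_apply, frame_apply hT hT1 _ hb hp, iterBdd_zero, frameFun]
      simp only
      rw [stopTime_log hs'.1 (hs'.2.le.trans htT)]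
      simp)
  have hdt := datConv_mult h0 h1 (continuous_stopTime T) (stopTime_pos hT) hm hM hp w
    (Or.inl (htT.trans hT1))
  simp only [zero_mul, neg_zero, Real.exp_zero, one_mul] at hst
  simp only [implicitEq, BoundedContinuousFunction.coe_add, BoundedContinuousFunction.coe_sub,
    Pi.add_apply, Pi.sub_apply, BoundedContinuousFunction.coe_zero, Pi.zero_apply]
  rw [hst, hdt, frame_apply hT hT1 _ hb hp, frameFun, (hu w.1).eq _ (mul_pos hp1 ht),
    mul_comm p.1]
  ring

lemma contDiffAt_implicitEq {T : ℝ} (hT : 0 < T) {u₀ : ℕ → ℝ → ℝ} {M : ℝ}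
    (hm : ∀ i, AEStronglyMeasurable (u₀ i)) (hM : ∀ i y, |u₀ i y| ≤ M) {q : (ℝ × ℝ) × Fam}
    (hq : q.1 ∈ params) : ContDiffAt ℝ ∞ (implicitEq h0 h1 hf hs hT hm hM) q := by
  have hopen : params ∈ 𝓝 q.1 := Metric.isOpen_ball.mem_nhds hq
  have c0 : ContDiffAt ℝ ∞ (fun q : (ℝ × ℝ) × Fam => mult h0 h1 admissible_zero 0 q.1) q :=
    ((contDiffOn_mult h0 h1 admissible_zero 0).contDiffAt hopen).comp q contDiffAt_fst
  have c1 : ContDiffAt ℝ ∞ (fun q : (ℝ × ℝ) × Fam => mult h0 h1 admissible_one 0 q.1) q :=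
    ((contDiffOn_mult h0 h1 admissible_one 0).contDiffAt hopen).comp q contDiffAt_fst
  have c2 : ContDiffAt ℝ ∞ (fun q : (ℝ × ℝ) × Fam => nem (iterBdd hf hs 0) q.2) q :=
    (contDiff_nem (hasDerivAt_iterBdd hf hs)).contDiffAt.comp q contDiffAt_snd
  have c3 : ContDiffAt ℝ ∞ (fun q : (ℝ × ℝ) × Fam => q.1.1) q :=
    contDiffAt_fst.comp q contDiffAt_fst
  unfold implicitEq
  refine (contDiffAt_snd.sub ?_).add ?_
  · exact (datConv α (continuous_stopTime T) (stopTime_pos hT) hm hM).contDiff.contDiffAt.comp q c0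
  · exact ((stConv α (continuous_stopTime T)
      (integrable_cutWeight h0 T)).contDiff.contDiffAt.comp q (c3.smul c1)).clm_apply c2

lemma isInvertible_one_add {E : Type*} [NormedAddCommGroup E] [NormedSpace ℝ E] [CompleteSpace E]
    {A : E →L[ℝ] E} (hA : ‖A‖ < 1) : (ContinuousLinearMap.id ℝ E + A).IsInvertible := by
  refine ⟨ContinuousLinearEquiv.ofUnit (Units.oneSub (-A) (by rwa [norm_neg])), ?_⟩
  ext x
  change ((Units.oneSub (-A) (by rwa [norm_neg]) : (E →L[ℝ] E)ˣ) : E →L[ℝ] E) x = _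
  rw [Units.val_oneSub]
  simp

/-- Solutions in moving frames depend smoothly on the frame. -/
lemma contDiffAt_frame {T : ℝ} (hT : 0 < T) (hT1 : T ≤ 1)
    (hstep : ∀ p ∈ params, (π * ∫ τ, |cutWeight α T τ|) *
      ‖p.1 • mult h0 h1 admissible_one 0 p‖ * ‖iterBdd hf hs 1‖ ≤ 1 / 2)
    {u₀ : ℕ → ℝ → ℝ} {M : ℝ}
    (hm : ∀ i, AEStronglyMeasurable (u₀ i)) (hM : ∀ i y, |u₀ i y| ≤ M) {u : ℕ → ℝ → ℝ → ℝ} {M' : ℝ}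
    (hu : ∀ i, GlobalMild α f (u₀ i) (u i)) (hb : ∀ i, ∀ t ≤ 2, ∀ x, |u i t x| ≤ M') :
    ContDiffAt ℝ ∞ (frame hT hT1 (fun i => (hu i).cont) hb) ((1 : ℝ), (0 : ℝ)) := by
  set v := frame hT hT1 (fun i => (hu i).cont) hb with hv
  set p₀ : ℝ × ℝ := ((1 : ℝ), (0 : ℝ)) with hp₀
  have hp₀m : p₀ ∈ params := one_zero_mem_params
  set Ψ := implicitEq h0 h1 hf hs hT hm hM with hΨ
  have hI : 0 ≤ π * ∫ τ, |cutWeight α T τ| :=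
    mul_nonneg Real.pi_pos.le (integral_nonneg fun _ => abs_nonneg _)
  have cdf : ContDiffAt ℝ ∞ Ψ (p₀, v p₀) := contDiffAt_implicitEq h0 h1 hf hs hT hm hM hp₀m
  set A : Fam →L[ℝ] Fam := stConv α (continuous_stopTime T) (integrable_cutWeight h0 T)
    (p₀.1 • mult h0 h1 admissible_one 0 p₀) with hA
  -- The short step was chosen so that the linearized source term has norm at most one half. A
  -- Neumann series then inverts the partial derivative in the unknown.
  have hAd : ‖A ∘L bddMul (nem (iterBdd hf hs 1) (v p₀))‖ < 1 := by
    refine lt_of_le_of_lt (ContinuousLinearMap.opNorm_le_bound _ (by norm_num : (0:ℝ) ≤ 1 / 2)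
      fun g => ?_) (by norm_num)
    simp only [ContinuousLinearMap.comp_apply, bddMul_apply]
    refine (norm_stConv_le _ _ _ _).trans ?_
    have h2 : ‖nem (iterBdd hf hs 1) (v p₀) * g‖ ≤ ‖iterBdd hf hs 1‖ * ‖g‖ := by
      refine (norm_mul_le _ _).trans ?_
      gcongr
      exact (BoundedContinuousFunction.norm_le (norm_nonneg _)).2 fun w =>
        (iterBdd hf hs 1).norm_coe_le_norm _
    calc _ ≤ (π * ∫ τ, |cutWeight α T τ|) * ‖p₀.1 • mult h0 h1 admissible_one 0 p₀‖ *
          (‖iterBdd hf hs 1‖ * ‖g‖) := by gcongr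
      _ = ((π * ∫ τ, |cutWeight α T τ|) * ‖p₀.1 • mult h0 h1 admissible_one 0 p₀‖ *
          ‖iterBdd hf hs 1‖) * ‖g‖ := by ring
      _ ≤ 1 / 2 * ‖g‖ := by gcongr; exact hstep p₀ hp₀m
  have hfd : fderiv ℝ Ψ (p₀, v p₀) ∘L .inr ℝ (ℝ × ℝ) Fam =
      ContinuousLinearMap.id ℝ Fam + A ∘L bddMul (nem (iterBdd hf hs 1) (v p₀)) := by
    have d1 : HasFDerivAt Ψ (fderiv ℝ Ψ (p₀, v p₀)) (p₀, v p₀) :=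
      (cdf.differentiableAt (by simp)).hasFDerivAt
    have d2 : HasFDerivAt (fun g : Fam => (p₀, g)) (ContinuousLinearMap.inr ℝ (ℝ × ℝ) Fam) (v p₀) :=
      hasFDerivAt_prodMk_right p₀ (v p₀)
    have d3 := d1.comp (v p₀) d2
    have d4 : HasFDerivAt (fun g : Fam => Ψ (p₀, g))
        (ContinuousLinearMap.id ℝ Fam + A ∘L bddMul (nem (iterBdd hf hs 1) (v p₀))) (v p₀) := by
      have d5 := hasFDerivAt_nem (hasDerivAt_iterBdd hf hs 0) (hasDerivAt_iterBdd hf hs 1) (v p₀)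
      exact ((hasFDerivAt_id (v p₀)).sub_const (datConv α (continuous_stopTime T)
        (stopTime_pos hT) hm hM (mult h0 h1 admissible_zero 0 p₀))).add
          (A.hasFDerivAt.comp (v p₀) d5)
    exact d3.unique d4
  have hinv : (fderiv ℝ Ψ (p₀, v p₀) ∘L .inr ℝ (ℝ × ℝ) Fam).IsInvertible := by
    rw [hfd]; exact isInvertible_one_add hAd
  have himp := cdf.contDiffAt_implicitFunction (by simp) hinv
  refine himp.congr_of_eventuallyEq ?_
  have hzero : Ψ (p₀, v p₀) = 0 := implicitEq_frame h0 h1 hf hs hT hT1 hm hM hu hb hp₀m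
  filter_upwards [cdf.eventually_apply_implicitFunction (by simp) hinv,
    Metric.isOpen_ball.mem_nhds hp₀m] with p hp hpm
  rw [hzero] at hp
  set g := cdf.implicitFunction (by simp) hinv p with hg
  have hvp : Ψ (p, v p) = 0 := implicitEq_frame h0 h1 hf hs hT hT1 hm hM hu hb hpm
  -- The implicit function need not a priori be the frame solution. Both solve the same equation,
  -- and the contraction estimate for the difference forces them to coincide.
  have hdiff : v p - g = stConv α (continuous_stopTime T) (integrable_cutWeight h0 T)
      (p.1 • mult h0 h1 admissible_one 0 p)
      (nem (iterBdd hf hs 0) g - nem (iterBdd hf hs 0) (v p)) := by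
    have := hvp.trans hp.symm
    simp only [hΨ, implicitEq] at this
    rw [map_sub]
    rw [sub_add_eq_add_sub, sub_add_eq_add_sub, sub_left_inj] at this
    rw [sub_eq_sub_iff_add_eq_add, this]
    abel
  have hle : ‖v p - g‖ ≤ 1 / 2 * ‖v p - g‖ := by
    conv_lhs => rw [hdiff]
    refine (norm_stConv_le _ _ _ _).trans ?_
    have h2 := norm_nem_sub_le (hasDerivAt_iterBdd hf hs 0) g (v p)
    calc _ ≤ (π * ∫ τ, |cutWeight α T τ|) * ‖p.1 • mult h0 h1 admissible_one 0 p‖ *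
          (‖iterBdd hf hs 1‖ * ‖g - v p‖) := by gcongr
      _ = ((π * ∫ τ, |cutWeight α T τ|) * ‖p.1 • mult h0 h1 admissible_one 0 p‖ *
          ‖iterBdd hf hs 1‖) * ‖v p - g‖ := by rw [norm_sub_rev]; ring
      _ ≤ 1 / 2 * ‖v p - g‖ := by gcongr; exact hstep p hpm
  have : ‖v p - g‖ = 0 := by linarith [norm_nonneg (v p - g)]
  exact sub_eq_zero.1 (norm_eq_zero.1 this)

/-- Each derivative of a dilation contributes one factor of its ratio. With ratio `t⁻¹` this
produces the blow-up rate as `t → 0`. -/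
lemma norm_iteratedFDeriv_comp_affine_le {F : Type*} [NormedAddCommGroup F] [NormedSpace ℝ F]
    (W : ℝ × ℝ → F) (q p₀ : ℝ × ℝ) {c : ℝ} (hc : 0 < c) (n : ℕ) :
    ‖iteratedFDeriv ℝ n (fun q' => W (c • (q' - q) + p₀)) q‖ ≤
      ‖iteratedFDeriv ℝ n W p₀‖ * c ^ n := by
  set e : (ℝ × ℝ) ≃L[ℝ] (ℝ × ℝ) := ContinuousLinearEquiv.smulLeft (Units.mk0 c hc.ne') with he
  have e1 : iteratedFDeriv ℝ n (fun q' => W (c • (q' - q) + p₀)) q =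
      iteratedFDeriv ℝ n ((fun y => W (y + p₀)) ∘ e) 0 := by
    have := iteratedFDeriv_comp_sub (𝕜 := ℝ) (f := (fun y => W (y + p₀)) ∘ e) n q q
    rw [sub_self] at this
    rw [← this]
    rfl
  have e2 := e.iteratedFDerivWithin_comp_right (fun y => W (y + p₀)) uniqueDiffOn_univ
    (x := 0) (mem_univ _) n
  rw [preimage_univ, iteratedFDerivWithin_univ, iteratedFDerivWithin_univ] at e2
  rw [e1, e2, iteratedFDeriv_comp_add_right, map_zero, zero_add]
  refine (ContinuousMultilinearMap.norm_compContinuousLinearMap_le _ _).trans ?_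
  gcongr
  rw [Finset.prod_const, Finset.card_univ, Fintype.card_fin]
  gcongr
  refine ContinuousLinearMap.opNorm_le_bound _ hc.le fun y => ?_
  change ‖c • y‖ ≤ _
  rw [norm_smul, Real.norm_of_nonneg hc.le]

/-- Interior regularity, uniform over families of solutions with uniformly bounded data. -/
theorem regularity {α : ℝ} (h0 : 0 < α) (h1 : α < 1) {f : ℝ → ℝ} (hf : ContDiff ℝ ∞ f)
    (hs : HasCompactSupport f) : ∃ T : ℝ, 0 < T ∧ T ≤ 1 ∧ ∀ (u₀ : ℕ → ℝ → ℝ) (u : ℕ → ℝ → ℝ → ℝ) (M M' : ℝ),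
    (∀ i, AEStronglyMeasurable (u₀ i)) → (∀ i y, |u₀ i y| ≤ M) →
    (∀ i, GlobalMild α f (u₀ i) (u i)) → (∀ i, ∀ t ≤ 2, ∀ x, |u i t x| ≤ M') →
    (∀ i, ∀ t ∈ Ioc 0 T, ∀ x, ContDiffAt ℝ ∞ (Function.uncurry (u i)) (t, x)) ∧
    ∀ n : ℕ, ∃ C : ℝ, 0 ≤ C ∧ ∀ i, ∀ t ∈ Ioc 0 T, ∀ x,
      ‖iteratedFDeriv ℝ n (Function.uncurry (u i)) (t, x)‖ ≤ C * t⁻¹ ^ n := by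
  obtain ⟨T, hT, hT1, hstep⟩ := exists_step h0 h1 (norm_nonneg (iterBdd hf hs 1))
  refine ⟨T, hT, hT1, fun u₀ u M M' hm hM hu hb => ?_⟩
  have hv := contDiffAt_frame h0 h1 hf hs hT hT1 hstep hm hM hu hb
  set v := frame hT hT1 (fun i => (hu i).cont) hb with hvdef
  set p₀ : ℝ × ℝ := ((1 : ℝ), (0 : ℝ)) with hp₀
  have hp₀m : p₀ ∈ params := one_zero_mem_params
  -- A nearby point `(t', x')` is reached from `(t, x)` by the frame with `λ = t'/t` and `μ = (x' -
  -- x)/t`. Locally `u` is therefore the frame map followed by evaluation at one fixed point.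
  have hrep : ∀ i, ∀ t ∈ Ioc 0 T, ∀ x, Function.uncurry (u i) =ᶠ[𝓝 (t, x)]
      fun q' => ((BoundedContinuousFunction.evalCLM ℝ (i, Real.log t, x) : Fam →L[ℝ] ℝ) ∘ v)
        (t⁻¹ • (q' - (t, x)) + p₀) := by
    intro i t ht x
    have hcont : ContinuousAt (fun q' : ℝ × ℝ => t⁻¹ • (q' - (t, x)) + p₀) (t, x) := by fun_prop
    have hev : ∀ᶠ q' in 𝓝 ((t, x) : ℝ × ℝ), t⁻¹ • (q' - (t, x)) + p₀ ∈ params :=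
      hcont.eventually ((Metric.isOpen_ball : IsOpen params).mem_nhds 
        (by simp only [sub_self, smul_zero, zero_add]; exact hp₀m))
    filter_upwards [hev] with q' hq'
    have ht0 : t ≠ 0 := ht.1.ne'
    simp only [Function.comp, BoundedContinuousFunction.evalCLM_apply]
    rw [hvdef, frame_apply hT hT1 _ hb hq', frameFun]
    simp only [stopTime_log ht.1 ht.2, hp₀, Prod.fst_add, Prod.snd_add, Prod.smul_fst,
      Prod.smul_snd, Prod.fst_sub, Prod.snd_sub, smul_eq_mul, Function.uncurry]
    congr 1 <;> field_simp <;> ring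
  refine ⟨fun i t ht x => ?_, fun n => ⟨‖iteratedFDeriv ℝ n v p₀‖, norm_nonneg _, ?_⟩⟩
  · refine ContDiffAt.congr_of_eventuallyEq ?_ (hrep i t ht x)
    have h2 : ContDiffAt ℝ ∞
        ((BoundedContinuousFunction.evalCLM ℝ (i, Real.log t, x) : Fam →L[ℝ] ℝ) ∘ v) p₀ :=
      (ContinuousLinearMap.contDiff _).contDiffAt.comp p₀ hv
    have h3 : ContDiffAt ℝ ∞ (fun q' : ℝ × ℝ => t⁻¹ • (q' - (t, x)) + p₀) (t, x) := by fun_prop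
    refine ContDiffAt.comp (t, x) (g := (BoundedContinuousFunction.evalCLM ℝ (i, Real.log t, x) :
      Fam →L[ℝ] ℝ) ∘ v) ?_ h3
    simpa using h2
  · intro i t ht x
    rw [Filter.EventuallyEq.eq_of_nhds (Filter.EventuallyEq.iteratedFDeriv ℝ (hrep i t ht x) n)]
    refine (norm_iteratedFDeriv_comp_affine_le _ _ _ (inv_pos.2 ht.1) n).trans ?_
    have hpos : (0 : ℝ) < t⁻¹ := inv_pos.2 ht.1
    gcongr
    refine (ContinuousLinearMap.norm_iteratedFDeriv_comp_left _ hv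
      (by exact_mod_cast le_top)).trans ?_
    refine mul_le_of_le_one_left (norm_nonneg _)
      (ContinuousLinearMap.opNorm_le_bound _ zero_le_one fun g => ?_)
    rw [one_mul]
    exact g.norm_coe_le_norm _

end

end Regularity

/-! ### Singular integrals on the half line -/

section HalfLine

lemma integrableOn_Ioi_of_bounds {k : ℝ → ℝ} {C a b : ℝ} (ha : -1 < a) (hb : b < -1)
    (hk : ContinuousOn k (Ioi 0)) (h1 : ∀ s ∈ Ioc (0 : ℝ) 1, |k s| ≤ C * s ^ a)
    (h2 : ∀ s ∈ Ioi (1 : ℝ), |k s| ≤ C * s ^ b) : IntegrableOn k (Ioi 0) := by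
  rw [← Ioc_union_Ioi_eq_Ioi zero_le_one]
  refine IntegrableOn.union ?_ ?_
  · have := (intervalIntegral.intervalIntegrable_rpow' (a := 0) (b := 1) ha).const_mul C
    rw [intervalIntegrable_iff_integrableOn_Ioc_of_le zero_le_one] at this
    refine this.mono' ((hk.mono Ioc_subset_Ioi_self).aestronglyMeasurable measurableSet_Ioc) ?_
    filter_upwards [ae_restrict_mem measurableSet_Ioc] with s hs using h1 s hs
  · have := (integrableOn_Ioi_rpow_of_lt hb one_pos).const_mul C
    refine Integrable.mono' this ((hk.mono (Ioi_subset_Ioi zero_le_one)).aestronglyMeasurable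
      measurableSet_Ioi) ?_
    filter_upwards [ae_restrict_mem measurableSet_Ioi] with s hs using h2 s hs

/-- Integration by parts against a negative power, on `(0, N)`. -/
lemma integral_deriv_mul_rpow {h h' : ℝ → ℝ} {C r σ N : ℝ} (hN : 0 < N) (hrσ : -1 < r - σ)
    (hd : ∀ s, HasDerivAt h (h' s) s) (hc : Continuous h')
    (hh : ∀ s ∈ Ioc 0 N, |h s| ≤ C * s ^ (r + 1)) (hh' : ∀ s ∈ Ioc 0 N, |h' s| ≤ C * s ^ r) :
    IntervalIntegrable (fun s => h' s * s ^ (-σ)) volume 0 N ∧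
    IntervalIntegrable (fun s => h s * s ^ (-σ - 1)) volume 0 N ∧
    ∫ s in (0 : ℝ)..N, h' s * s ^ (-σ) =
      h N * N ^ (-σ) + σ * ∫ s in (0 : ℝ)..N, h s * s ^ (-σ - 1) := by
  have hhc : Continuous h := continuous_iff_continuousAt.2 fun s => (hd s).continuousAt
  have hpc : ∀ e : ℝ, ContinuousOn (fun s : ℝ => s ^ e) (Ioc 0 N) := fun e s hs =>
    (Real.continuousAt_rpow_const s e (Or.inl hs.1.ne')).continuousWithinAt
  have hdom := (intervalIntegral.intervalIntegrable_rpow' (a := 0) (b := N) hrσ).const_mul C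
  rw [intervalIntegrable_iff_integrableOn_Ioc_of_le hN.le] at hdom
  have i1 : IntervalIntegrable (fun s => h' s * s ^ (-σ)) volume 0 N := by
    rw [intervalIntegrable_iff_integrableOn_Ioc_of_le hN.le]
    refine Integrable.mono' hdom ((hc.continuousOn.mul (hpc _)).aestronglyMeasurable
      measurableSet_Ioc) ?_
    filter_upwards [ae_restrict_mem measurableSet_Ioc] with s hs
    have hs0 : 0 < s := hs.1
    rw [norm_mul, Real.norm_eq_abs, Real.norm_of_nonneg (by positivity)]
    calc |h' s| * s ^ (-σ) ≤ C * s ^ r * s ^ (-σ) := by gcongr; exact hh' s hs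
      _ = C * s ^ (r - σ) := by rw [mul_assoc, ← Real.rpow_add hs0]; ring_nf
  have i2 : IntervalIntegrable (fun s => h s * s ^ (-σ - 1)) volume 0 N := by
    rw [intervalIntegrable_iff_integrableOn_Ioc_of_le hN.le]
    refine Integrable.mono' hdom ((hhc.continuousOn.mul (hpc _)).aestronglyMeasurable
      measurableSet_Ioc) ?_
    filter_upwards [ae_restrict_mem measurableSet_Ioc] with s hs
    have hs0 : 0 < s := hs.1
    rw [norm_mul, Real.norm_eq_abs, Real.norm_of_nonneg (by positivity)]
    calc |h s| * s ^ (-σ - 1) ≤ C * s ^ (r + 1) * s ^ (-σ - 1) := by gcongr; exact hh s hs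
      _ = C * s ^ (r - σ) := by rw [mul_assoc, ← Real.rpow_add hs0]; ring_nf
  refine ⟨i1, i2, ?_⟩
  have hlim0 : Tendsto (fun s => h s * s ^ (-σ)) (𝓝[>] 0) (𝓝 0) := by
    have hz : Tendsto (fun s : ℝ => C * s ^ (r - σ + 1)) (𝓝[>] 0) (𝓝 0) := by
      have := (Real.continuousAt_rpow_const 0 (r - σ + 1) (Or.inr (by linarith))).tendsto
      rw [Real.zero_rpow (by linarith)] at this
      simpa using (this.mono_left nhdsWithin_le_nhds).const_mul C
    refine squeeze_zero_norm' ?_ hz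
    filter_upwards [Ioc_mem_nhdsGT hN] with s hs
    have hs0 : 0 < s := hs.1
    rw [norm_mul, Real.norm_eq_abs, Real.norm_of_nonneg (by positivity)]
    calc |h s| * s ^ (-σ) ≤ C * s ^ (r + 1) * s ^ (-σ) := by gcongr; exact hh s hs
      _ = C * s ^ (r - σ + 1) := by rw [mul_assoc, ← Real.rpow_add hs0]; ring_nf
  have hlimN : Tendsto (fun s => h s * s ^ (-σ)) (𝓝[<] N) (𝓝 (h N * N ^ (-σ))) :=
    (hhc.continuousAt.mul (Real.continuousAt_rpow_const N _ (Or.inl hN.ne'))).tendsto.mono_left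
      nhdsWithin_le_nhds
  have hder : ∀ s ∈ Ioo 0 N, HasDerivAt (fun s => h s * s ^ (-σ))
      (h' s * s ^ (-σ) - σ * (h s * s ^ (-σ - 1))) s := by
    intro s hs
    have := (hd s).mul (Real.hasDerivAt_rpow_const (p := -σ) (Or.inl hs.1.ne'))
    refine this.congr_deriv ?_
    ring
  have := intervalIntegral.integral_eq_sub_of_hasDerivAt_of_tendsto hN hder
    (i1.sub (i2.const_mul σ)) hlim0 hlimN
  rw [intervalIntegral.integral_sub i1 (i2.const_mul σ), intervalIntegral.integral_const_mul] at this
  linarith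

end HalfLine

/-! ### Fractional derivatives in difference form -/

/-- The Marchaud form of the fractional derivative. -/
def marchaud (α : ℝ) (g : ℝ → ℝ) (x : ℝ) : ℝ :=
  (Real.Gamma (1 - α))⁻¹ * (α * ∫ z in Ioi (0 : ℝ), (g x - g (x - z)) * z ^ (-α - 1))

section Fractional

variable {α : ℝ} {g g' g'' : ℝ → ℝ} {C : ℝ}

lemma abs_sub_le_of_deriv (hg : ∀ x, HasDerivAt g (g' x) x) (hC' : ∀ x, |g' x| ≤ C) (x y : ℝ) :
    |g x - g y| ≤ C * |x - y| := by
  have := Convex.norm_image_sub_le_of_norm_hasDerivWithin_le (f := g) (f' := g') (s := univ)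
    (C := C) (x := y) (y := x) (fun x _ => (hg x).hasDerivWithinAt)
    (fun x _ => hC' x) convex_univ (mem_univ _) (mem_univ _)
  simpa using this

lemma integrableOn_marchaud (h0 : 0 < α) (h1 : α < 1) (hg : ∀ x, HasDerivAt g (g' x) x)
    (hC : ∀ x, |g x| ≤ C) (hC' : ∀ x, |g' x| ≤ C) (x : ℝ) :
    IntegrableOn (fun z => (g x - g (x - z)) * z ^ (-α - 1)) (Ioi 0) := by
  have hgc : Continuous g := continuous_iff_continuousAt.2 fun s => (hg s).continuousAt
  have hC0 : 0 ≤ C := (abs_nonneg _).trans (hC 0)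
  refine integrableOn_Ioi_of_bounds (C := 2 * C) (a := -α) (b := -α - 1) (by linarith)
    (by linarith) ?_ ?_ ?_
  · refine ContinuousOn.mul (by fun_prop) fun s hs => ?_
    exact (Real.continuousAt_rpow_const s _ (Or.inl (ne_of_gt hs))).continuousWithinAt
  · intro s hs
    have hs0 : 0 < s := hs.1
    have h2 := abs_sub_le_of_deriv hg hC' x (x - s)
    rw [sub_sub_cancel, abs_of_pos hs0] at h2
    rw [abs_mul, abs_of_pos (by positivity : 0 < s ^ (-α - 1))]
    calc _ ≤ C * s * s ^ (-α - 1) := by gcongr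
      _ = C * s ^ (-α) := by
        rw [mul_assoc, ← Real.rpow_one_add' hs0.le (by linarith)]; ring_nf
      _ ≤ 2 * C * s ^ (-α) := by gcongr; linarith
  · intro s hs
    have hs0 : 0 < s := one_pos.trans hs
    rw [abs_mul, abs_of_pos (by positivity : 0 < s ^ (-α - 1))]
    gcongr
    calc |g x - g (x - s)| ≤ |g x| + |g (x - s)| := abs_sub _ _
      _ ≤ 2 * C := by linarith [hC x, hC (x - s)]

/-- Integration by parts against `g(x) - g(x - s)`, which vanishes at `s = 0`, leaves an absolutely
convergent integral. The boundary term at distance `N` is bounded by `2C N^{-α}`, so the conditional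
limit exists. -/
lemma fracDer_eq_marchaud (h0 : 0 < α) (h1 : α < 1) (hg : ∀ x, HasDerivAt g (g' x) x)
    (hg'c : Continuous g') (hC : ∀ x, |g x| ≤ C) (hC' : ∀ x, |g' x| ≤ C) (x : ℝ) :
    fracDer α g x = marchaud α g x := by
  have hC0 : 0 ≤ C := (abs_nonneg _).trans (hC 0)
  unfold fracDer marchaud
  congr 1
  have hd : ∀ s, HasDerivAt (fun s => g x - g (x - s)) (g' (x - s)) s := by
    intro s
    have := ((hg (x - s)).comp s ((hasDerivAt_id s).const_sub x)).const_sub (g x)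
    simpa using this
  have hInt := integrableOn_marchaud h0 h1 hg hC hC' x
  have key : ∀ a < x, ∫ z in a..x, deriv g z / (x - z) ^ α =
      (g x - g (x - (x - a))) * (x - a) ^ (-α) +
        α * ∫ s in (0 : ℝ)..(x - a), (g x - g (x - s)) * s ^ (-α - 1) := by
    intro a ha
    rw [← (integral_deriv_mul_rpow (C := C) (r := 0) (σ := α) (sub_pos.2 ha) (by linarith) hd
      (by fun_prop) ?_ ?_).2.2]
    · have := intervalIntegral.integral_comp_sub_left (a := a) (b := x)
        (fun s => g' (x - s) * s ^ (-α)) x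
      rw [sub_self] at this
      rw [← this]
      refine intervalIntegral.integral_congr fun z hz => ?_
      rw [uIcc_of_le ha.le] at hz
      simp only [sub_sub_cancel]
      rw [(hg z).deriv, Real.rpow_neg (by linarith [hz.2]), div_eq_mul_inv]
    · intro s hs
      have h2 := abs_sub_le_of_deriv hg hC' x (x - s)
      rw [sub_sub_cancel, abs_of_pos hs.1] at h2
      simpa using h2
    · intro s hs
      simpa using hC' (x - s)
  have hN : Tendsto (fun a : ℝ => x - a) atBot atTop := by
    simpa only [sub_eq_add_neg, id] using tendsto_atTop_add_const_left atBot x tendsto_neg_atBot_atTop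
  have lim1 : Tendsto (fun N : ℝ => (g x - g (x - N)) * N ^ (-α)) atTop (𝓝 0) := by
    have hz : Tendsto (fun N : ℝ => 2 * C * N ^ (-α)) atTop (𝓝 0) := by
      simpa using (tendsto_rpow_neg_atTop h0).const_mul (2 * C)
    refine squeeze_zero_norm' ?_ hz
    filter_upwards [eventually_gt_atTop 0] with N hN
    rw [norm_mul, Real.norm_eq_abs, Real.norm_of_nonneg (by positivity)]
    gcongr
    calc |g x - g (x - N)| ≤ |g x| + |g (x - N)| := abs_sub _ _
      _ ≤ 2 * C := by linarith [hC x, hC (x - N)]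
  have lim2 := intervalIntegral_tendsto_integral_Ioi 0 hInt tendsto_id
  have lim := (lim1.add (lim2.const_mul α)).comp hN
  rw [zero_add] at lim
  refine Tendsto.limUnder_eq (lim.congr' ?_)
  filter_upwards [eventually_lt_atBot x] with a ha
  rw [key a ha]
  rfl

/-- Increments of the derivative are linear in `z` near zero and bounded at infinity, giving a
majorant uniform in `x` for differentiation under the integral. -/
lemma hasDerivAt_marchaud (h0 : 0 < α) (h1 : α < 1) (hg : ∀ x, HasDerivAt g (g' x) x)
    (hg' : ∀ x, HasDerivAt g' (g'' x) x) (hC : ∀ x, |g x| ≤ C) (hC' : ∀ x, |g' x| ≤ C)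
    (hC'' : ∀ x, |g'' x| ≤ C) (x : ℝ) :
    HasDerivAt (marchaud α g) (marchaud α g' x) x := by
  have hC0 : 0 ≤ C := (abs_nonneg _).trans (hC 0)
  unfold marchaud
  refine HasDerivAt.const_mul _ (HasDerivAt.const_mul _ ?_)
  have hbint : IntegrableOn (fun z : ℝ => 2 * C * min z 1 * z ^ (-α - 1)) (Ioi 0) := by
    refine integrableOn_Ioi_of_bounds (C := 2 * C) (a := -α) (b := -α - 1) (by linarith)
      (by linarith) ?_ ?_ ?_
    · refine ContinuousOn.mul (by fun_prop) fun s hs => ?_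
      exact (Real.continuousAt_rpow_const s _ (Or.inl (ne_of_gt hs))).continuousWithinAt
    · intro s hs
      have hs0 : 0 < s := hs.1
      rw [min_eq_left hs.2, abs_of_nonneg (by positivity), mul_assoc,
        ← Real.rpow_one_add' hs0.le (by linarith)]
      apply le_of_eq; ring_nf
    · intro s hs
      have hs1 : 1 < s := hs
      have hs0 : 0 < s := one_pos.trans hs
      rw [min_eq_right hs1.le, mul_one, abs_of_nonneg (by positivity)]
  refine (hasDerivAt_integral_of_dominated_loc_of_deriv_le (𝕜 := ℝ)
    (μ := volume.restrict (Ioi (0 : ℝ)))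
    (F := fun x z => (g x - g (x - z)) * z ^ (-α - 1))
    (F' := fun x z => (g' x - g' (x - z)) * z ^ (-α - 1))
    (bound := fun z => 2 * C * min z 1 * z ^ (-α - 1)) (s := univ) univ_mem
    (Eventually.of_forall fun x => (integrableOn_marchaud h0 h1 hg hC hC' x).aestronglyMeasurable)
    (integrableOn_marchaud h0 h1 hg hC hC' x)
    (integrableOn_marchaud h0 h1 hg' hC' hC'' x).aestronglyMeasurable ?_ hbint ?_).2
  · filter_upwards [ae_restrict_mem measurableSet_Ioi] with z hz y _
    have hz0 : 0 < z := hz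
    rw [norm_mul, Real.norm_eq_abs, Real.norm_of_nonneg (by positivity)]
    gcongr
    rcases le_total z 1 with h | h
    · rw [min_eq_left h]
      have h2 := abs_sub_le_of_deriv hg' hC'' y (y - z)
      rw [sub_sub_cancel, abs_of_pos hz0] at h2
      nlinarith
    · rw [min_eq_right h, mul_one]
      calc |g' y - g' (y - z)| ≤ |g' y| + |g' (y - z)| := abs_sub _ _
        _ ≤ 2 * C := by linarith [hC' y, hC' (y - z)]
  · refine Eventually.of_forall fun z y _ => ?_
    have := ((hg y).sub ((hg (y - z)).comp y ((hasDerivAt_id y).sub_const z))).mul_const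
      (z ^ (-α - 1))
    simpa using this

lemma deriv_fracDer (h0 : 0 < α) (h1 : α < 1) (hg : ∀ x, HasDerivAt g (g' x) x)
    (hg' : ∀ x, HasDerivAt g' (g'' x) x) (hC : ∀ x, |g x| ≤ C) (hC' : ∀ x, |g' x| ≤ C)
    (hC'' : ∀ x, |g'' x| ≤ C) (x : ℝ) : deriv (fracDer α g) x = marchaud α g' x := by
  have hg'c : Continuous g' := continuous_iff_continuousAt.2 fun s => (hg' s).continuousAt
  have : fracDer α g = marchaud α g := funext (fracDer_eq_marchaud h0 h1 hg hg'c hC hC')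
  rw [this]
  exact (hasDerivAt_marchaud h0 h1 hg hg' hC hC' hC'' x).deriv

/-- The Marchaud derivative of a derivative, in second-order form. -/
lemma marchaud_deriv_eq (h0 : 0 < α) (h1 : α < 1) (hg : ∀ x, HasDerivAt g (g' x) x)
    (hg' : ∀ x, HasDerivAt g' (g'' x) x) (hC : ∀ x, |g x| ≤ C) (hC' : ∀ x, |g' x| ≤ C)
    (hC'' : ∀ x, |g'' x| ≤ C) (x : ℝ) :
    IntegrableOn (fun z => (g (x - z) - g x + z * g' x) * z ^ (-(α + 1) - 1)) (Ioi 0) ∧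
    marchaud α g' x = (Real.Gamma (1 - α))⁻¹ * (α * ((α + 1) *
      ∫ z in Ioi (0 : ℝ), (g (x - z) - g x + z * g' x) * z ^ (-(α + 1) - 1))) := by
  have hC0 : 0 ≤ C := (abs_nonneg _).trans (hC 0)
  have hg'c : Continuous g' := continuous_iff_continuousAt.2 fun s => (hg' s).continuousAt
  have hgc : Continuous g := continuous_iff_continuousAt.2 fun s => (hg s).continuousAt
  set h : ℝ → ℝ := fun z => g (x - z) - g x + z * g' x with hh
  have hd : ∀ s, HasDerivAt h (g' x - g' (x - s)) s := by
    intro s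
    have := (((hg (x - s)).comp s ((hasDerivAt_id s).const_sub x)).sub_const (g x)).add
      ((hasDerivAt_id s).mul_const (g' x))
    refine this.congr_deriv ?_
    simp; ring
  have hb' : ∀ s, 0 < s → |g' x - g' (x - s)| ≤ C * s := by
    intro s hs
    have h2 := abs_sub_le_of_deriv hg' hC'' x (x - s)
    rwa [sub_sub_cancel, abs_of_pos hs] at h2
  have hz : h 0 = 0 := by simp [hh]
  -- Quadratic smallness compensates `z^{-α-2}` at the origin. The linear bound `hb1` handles
  -- infinity.
  have hb2 : ∀ s, 0 < s → |h s| ≤ C * s ^ (2 : ℝ) := by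
    intro s hs
    have := norm_image_sub_le_of_norm_deriv_le_segment' (f := h)
      (f' := fun s => g' x - g' (x - s)) (C := C * s) (a := 0) (b := s)
      (fun y _ => (hd y).hasDerivWithinAt) (fun y hy => by
        rcases hy.1.eq_or_lt with rfl | hy0
        · simp; positivity
        · exact (hb' y hy0).trans (by gcongr; exact hy.2.le)) s (right_mem_Icc.2 hs.le)
    rw [hz, sub_zero, sub_zero, Real.norm_eq_abs] at this
    refine this.trans_eq ?_
    rw [Real.rpow_two]; ring
  have hb1 : ∀ s, 0 < s → |h s| ≤ 2 * C * s := by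
    intro s hs
    have h2 := abs_sub_le_of_deriv hg hC' (x - s) x
    rw [show x - s - x = -s by ring, abs_neg, abs_of_pos hs] at h2
    have h3 : |s * g' x| ≤ C * s := by
      rw [abs_mul, abs_of_pos hs, mul_comm]; gcongr; exact hC' x
    calc |h s| ≤ |g (x - s) - g x| + |s * g' x| := abs_add_le _ _
      _ ≤ 2 * C * s := by linarith
  have hpc : ContinuousOn (fun z : ℝ => z ^ (-(α + 1) - 1)) (Ioi 0) := fun s hs =>
    (Real.continuousAt_rpow_const s _ (Or.inl (ne_of_gt hs))).continuousWithinAt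
  have hInt : IntegrableOn (fun z => h z * z ^ (-(α + 1) - 1)) (Ioi 0) := by
    refine integrableOn_Ioi_of_bounds (C := 2 * C) (a := -α) (b := -α - 1) (by linarith)
      (by linarith) (ContinuousOn.mul (by fun_prop) hpc) ?_ ?_
    · intro s hs
      have hs0 : 0 < s := hs.1
      rw [abs_mul, abs_of_pos (by positivity : 0 < s ^ (-(α + 1) - 1))]
      calc _ ≤ C * s ^ (2 : ℝ) * s ^ (-(α + 1) - 1) := by gcongr; exact hb2 s hs0
        _ = C * s ^ (-α) := by rw [mul_assoc, ← Real.rpow_add hs0]; ring_nf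
        _ ≤ 2 * C * s ^ (-α) := by gcongr; linarith
    · intro s hs
      have hs0 : 0 < s := one_pos.trans hs
      rw [abs_mul, abs_of_pos (by positivity : 0 < s ^ (-(α + 1) - 1))]
      calc _ ≤ 2 * C * s * s ^ (-(α + 1) - 1) := by gcongr; exact hb1 s hs0
        _ = 2 * C * s ^ (-α - 1) := by
          rw [mul_assoc, ← Real.rpow_one_add' hs0.le (by linarith)]; ring_nf
  refine ⟨hInt, ?_⟩
  unfold marchaud
  congr 2
  -- A second integration by parts exposes the positive weight. Both sides are then compared as `N →
  -- ∞`.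
  have hparts : ∀ N, 0 < N → ∫ s in (0 : ℝ)..N, (g' x - g' (x - s)) * s ^ (-(α + 1)) =
      h N * N ^ (-(α + 1)) + (α + 1) * ∫ s in (0 : ℝ)..N, h s * s ^ (-(α + 1) - 1) := by
    intro N hN
    refine (integral_deriv_mul_rpow (C := C) (r := 1) (σ := α + 1) hN (by linarith) hd
      (by fun_prop) (fun s hs => ?_) (fun s hs => ?_)).2.2
    · rw [one_add_one_eq_two]; exact hb2 s hs.1
    · rw [Real.rpow_one]; exact hb' s hs.1
  have lim1 : Tendsto (fun N : ℝ => h N * N ^ (-(α + 1))) atTop (𝓝 0) := by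
    have hz : Tendsto (fun N : ℝ => 2 * C * N ^ (-α)) atTop (𝓝 0) := by
      simpa using (tendsto_rpow_neg_atTop h0).const_mul (2 * C)
    refine squeeze_zero_norm' ?_ hz
    filter_upwards [eventually_gt_atTop 0] with N hN
    rw [norm_mul, Real.norm_eq_abs, Real.norm_of_nonneg (by positivity)]
    calc _ ≤ 2 * C * N * N ^ (-(α + 1)) := by gcongr; exact hb1 N hN
      _ = 2 * C * N ^ (-α) := by
        rw [mul_assoc, ← Real.rpow_one_add' hN.le (by linarith)]; ring_nf
  have lim2 := intervalIntegral_tendsto_integral_Ioi 0 hInt tendsto_id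
  have lim3 := intervalIntegral_tendsto_integral_Ioi 0
    (integrableOn_marchaud h0 h1 hg' hC' hC'' x) tendsto_id
  have lim := lim1.add (lim2.const_mul (α + 1))
  rw [zero_add] at lim
  refine tendsto_nhds_unique lim3 (lim.congr' ?_)
  filter_upwards [eventually_gt_atTop 0] with N hN
  simp only [id_eq]
  rw [← hparts N hN, show -α - 1 = -(α + 1) by ring]

/-- The action of the generator on the barrier `√(1 + x²)` is at most this constant. -/
def barrierConst (α : ℝ) : ℝ := (Real.Gamma (1 - α))⁻¹ * (α * ((α + 1) *
      ∫ z in Ioi (0 : ℝ), min (z ^ 2) (2 * z) * z ^ (-(α + 1) - 1)))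

lemma integrableOn_barrier (h0 : 0 < α) (h1 : α < 1) :
    IntegrableOn (fun z : ℝ => min (z ^ 2) (2 * z) * z ^ (-(α + 1) - 1)) (Ioi 0) := by
  refine integrableOn_Ioi_of_bounds (C := 2) (a := -α) (b := -α - 1) (by linarith)
    (by linarith) ?_ ?_ ?_
  · refine ContinuousOn.mul (by fun_prop) fun s hs => ?_
    exact (Real.continuousAt_rpow_const s _ (Or.inl (ne_of_gt hs))).continuousWithinAt
  · intro s hs
    have hs0 : 0 < s := hs.1
    rw [abs_mul, abs_of_pos (by positivity : 0 < s ^ (-(α + 1) - 1)),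
      abs_of_nonneg (by positivity : 0 ≤ min (s ^ 2) (2 * s))]
    calc _ ≤ s ^ (2 : ℝ) * s ^ (-(α + 1) - 1) := by
          gcongr; rw [Real.rpow_two]; exact min_le_left _ _
      _ = 1 * s ^ (-α) := by rw [← Real.rpow_add hs0]; ring_nf
      _ ≤ 2 * s ^ (-α) := by gcongr; norm_num
  · intro s hs
    have hs0 : 0 < s := one_pos.trans hs
    rw [abs_mul, abs_of_pos (by positivity : 0 < s ^ (-(α + 1) - 1)),
      abs_of_nonneg (by positivity : 0 ≤ min (s ^ 2) (2 * s))]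
    calc _ ≤ 2 * s * s ^ (-(α + 1) - 1) := by gcongr; exact min_le_right _ _
      _ = 2 * s ^ (-α - 1) := by
          rw [mul_assoc, ← Real.rpow_one_add' hs0.le (by linarith)]; ring_nf

lemma barrierConst_nonneg (h0 : 0 < α) (h1 : α < 1) : 0 ≤ barrierConst α := by
  have hG : 0 < Real.Gamma (1 - α) := Real.Gamma_pos_of_pos (by linarith)
  have : 0 ≤ ∫ z in Ioi (0 : ℝ), min (z ^ 2) (2 * z) * z ^ (-(α + 1) - 1) :=
    setIntegral_nonneg measurableSet_Ioi fun z hz => by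
      have : (0 : ℝ) < z := hz
      positivity
  unfold barrierConst
  positivity

/-- Positivity of the weight `z^{-α-2}` lets a one-sided bound on the second-order difference pass
to the operator. This is the point where ellipticity enters. -/
lemma marchaud_deriv_le (h0 : 0 < α) (h1 : α < 1) (hg : ∀ x, HasDerivAt g (g' x) x)
    (hg' : ∀ x, HasDerivAt g' (g'' x) x) (hC : ∀ x, |g x| ≤ C) (hC' : ∀ x, |g' x| ≤ C)
    (hC'' : ∀ x, |g'' x| ≤ C) {x η : ℝ}
    (hle : ∀ z, 0 < z → g (x - z) - g x + z * g' x ≤ η * min (z ^ 2) (2 * z)) :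
    marchaud α g' x ≤ η * barrierConst α := by
  obtain ⟨hi, he⟩ := marchaud_deriv_eq h0 h1 hg hg' hC hC' hC'' x
  have hG : 0 < Real.Gamma (1 - α) := Real.Gamma_pos_of_pos (by linarith)
  have : ∫ z in Ioi (0 : ℝ), (g (x - z) - g x + z * g' x) * z ^ (-(α + 1) - 1) ≤
      η * ∫ z in Ioi (0 : ℝ), min (z ^ 2) (2 * z) * z ^ (-(α + 1) - 1) := by
    rw [← integral_const_mul]
    refine setIntegral_mono_on hi ((integrableOn_barrier h0 h1).const_mul η) measurableSet_Ioi
      fun z hz => ?_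
    have hz0 : (0 : ℝ) < z := hz
    rw [← mul_assoc]
    exact mul_le_mul_of_nonneg_right (hle z hz0) (by positivity)
  rw [he]
  unfold barrierConst
  calc _ ≤ (Real.Gamma (1 - α))⁻¹ * (α * ((α + 1) *
      (η * ∫ z in Ioi (0 : ℝ), min (z ^ 2) (2 * z) * z ^ (-(α + 1) - 1)))) := by gcongr
    _ = _ := by ring

lemma marchaud_neg (x : ℝ) : marchaud α (fun y => -g y) x = -marchaud α g x := by
  unfold marchaud
  have : ∀ z, (-g x - -g (x - z)) * z ^ (-α - 1) = -((g x - g (x - z)) * z ^ (-α - 1)) := by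
    intro z; ring
  simp_rw [this]
  rw [integral_neg]
  ring

end Fractional

/-! ### Essential suprema of continuous functions -/

section SupNorm

lemma supNorm_le {g : ℝ → ℝ} {M : ℝ} (h : ∀ x, |g x| ≤ M) : supNorm g ≤ ENNReal.ofReal M := by
  unfold supNorm
  rw [eLpNorm_exponent_top]
  refine eLpNormEssSup_le_of_ae_bound (Eventually.of_forall h)

lemma ae_abs_le_supNorm {g : ℝ → ℝ} (h : supNorm g ≠ ⊤) :
    ∀ᵐ x, |g x| ≤ (supNorm g).toReal := by
  filter_upwards [ae_le_eLpNormEssSup (f := g) (μ := volume)] with x hx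
  rw [← Real.norm_eq_abs, ← toReal_enorm]
  refine ENNReal.toReal_mono h ?_
  unfold supNorm
  rwa [eLpNorm_exponent_top]

lemma forall_le_of_ae_le {g : ℝ → ℝ} {M : ℝ} (hg : Continuous g) (h : ∀ᵐ x, g x ≤ M) (x : ℝ) :
    g x ≤ M := by
  have ho : IsOpen {x | M < g x} := isOpen_lt continuous_const hg
  have : volume {x | M < g x} = 0 := by
    refine measure_mono_null (fun x hx => ?_) h
    simpa using hx
  have hemp := (ho.measure_eq_zero_iff volume).1 this
  by_contra! hx
  exact (hemp ▸ (show x ∈ {x | M < g x} from hx) : x ∈ (∅ : Set ℝ))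

lemma abs_le_supNorm {g : ℝ → ℝ} (hg : Continuous g) (h : supNorm g ≠ ⊤) (x : ℝ) :
    |g x| ≤ (supNorm g).toReal :=
  forall_le_of_ae_le hg.abs (ae_abs_le_supNorm h) x

end SupNorm

/-! ### Regularity on strips and its one-dimensional slices -/

section Strip

lemma isOpen_timeIoo (δ : ℝ) (T : EReal) : IsOpen (timeIoo δ T) :=
  (isOpen_lt continuous_const continuous_id).inter
    (isOpen_lt continuous_coe_real_ereal continuous_const)

lemma isOpen_strip (δ : ℝ) (T : EReal) : IsOpen (strip δ T) :=
  (isOpen_timeIoo δ T).prod isOpen_univ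

lemma CbOn.mono {k l : ℕ∞} {U : Set (ℝ × ℝ)} {w : ℝ × ℝ → ℝ} (h : CbOn l U w) (hkl : k ≤ l) :
    CbOn k U w :=
  ⟨h.1.of_le (by exact_mod_cast hkl), fun m hm => h.2 m (hm.trans hkl)⟩

/-- A function with its first two derivatives, all three bounded by `C`. -/
structure BddDerivs (C : ℝ) (g g' g'' : ℝ → ℝ) : Prop where
  d1 : ∀ x, HasDerivAt g (g' x) x
  d2 : ∀ x, HasDerivAt g' (g'' x) x
  b0 : ∀ x, |g x| ≤ C
  b1 : ∀ x, |g' x| ≤ C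
  b2 : ∀ x, |g'' x| ≤ C

lemma BddDerivs.neg {C : ℝ} {g g' g'' : ℝ → ℝ} (h : BddDerivs C g g' g'') :
    BddDerivs C (fun x => -g x) (fun x => -g' x) (fun x => -g'' x) :=
  ⟨fun x => (h.d1 x).neg, fun x => (h.d2 x).neg, fun x => by simpa using h.b0 x,
    fun x => by simpa using h.b1 x, fun x => by simpa using h.b2 x⟩

lemma CbOn.slices {δ : ℝ} {T : EReal} {u : ℝ → ℝ → ℝ}
    (h : CbOn 2 (strip δ T) (Function.uncurry u)) :
    ∃ (C : ℝ) (ux : ℝ → ℝ → ℝ), 0 ≤ C ∧ ContinuousOn (Function.uncurry ux) (strip δ T) ∧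
      ∀ t ∈ timeIoo δ T, (∃ g'', BddDerivs C (u t) (ux t) g'') ∧
        ∀ x, DifferentiableAt ℝ (fun s => u s x) t := by
  set w := Function.uncurry u
  obtain ⟨C0, hC0⟩ := h.2 0 (by norm_num)
  obtain ⟨C1, hC1⟩ := h.2 1 (by norm_num)
  obtain ⟨C2, hC2⟩ := h.2 2 le_rfl
  have hcd : ∀ p ∈ strip δ T, ContDiffAt ℝ 2 w p := fun p hp =>
    h.1.contDiffAt ((isOpen_strip δ T).mem_nhds hp)
  have hd : ∀ p ∈ strip δ T, HasFDerivAt w (fderiv ℝ w p) p := fun p hp =>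
    ((hcd p hp).differentiableAt (by norm_num)).hasFDerivAt
  have hd2 : ∀ p ∈ strip δ T, HasFDerivAt (fderiv ℝ w) (fderiv ℝ (fderiv ℝ w) p) p := fun p hp =>
    (((hcd p hp).fderiv_right (m := 1) (by norm_num)).differentiableAt (by norm_num)).hasFDerivAt
  refine ⟨max (max C0 C1) (max C2 0), fun t x => fderiv ℝ w (t, x) (0, 1), by simp,
    fun p hp => ?_, fun t ht => ?_⟩
  · exact ((hd2 p hp).continuousAt.clm_apply continuousAt_const).continuousWithinAt
  have hp : ∀ x, (t, x) ∈ strip δ T := fun x => ⟨ht, mem_univ _⟩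
  have hline : ∀ x : ℝ, HasDerivAt (fun y : ℝ => (t, y)) ((0 : ℝ), (1 : ℝ)) x := fun x =>
    (hasDerivAt_const x t).prodMk (hasDerivAt_id x)
  have hone : ‖((0 : ℝ), (1 : ℝ))‖ ≤ 1 := by simp
  refine ⟨⟨fun x => fderiv ℝ (fderiv ℝ w) (t, x) (0, 1) (0, 1),
    ⟨fun x => ?_, fun x => ?_, fun x => ?_, fun x => ?_, fun x => ?_⟩⟩, fun x => ?_⟩
  · exact (hd _ (hp x)).comp_hasDerivAt x (hline x)
  · have := ((hd2 _ (hp x)).comp_hasDerivAt x (hline x)).clm_apply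
      (hasDerivAt_const x ((0 : ℝ), (1 : ℝ)))
    simpa using this
  · have := hC0 _ (hp x)
    rw [norm_iteratedFDeriv_zero] at this
    exact this.trans (by simp)
  · have := hC1 _ (hp x)
    rw [norm_iteratedFDeriv_one] at this
    refine ((fderiv ℝ w (t, x)).le_of_opNorm_le_of_le this hone).trans (by simp)
  · have := hC2 _ (hp x)
    rw [← norm_iteratedFDeriv_fderiv, norm_iteratedFDeriv_one] at this
    have h2 := (fderiv ℝ (fderiv ℝ w) (t, x)).le_of_opNorm_le_of_le this hone
    refine ((fderiv ℝ (fderiv ℝ w) (t, x) (0, 1)).le_of_opNorm_le_of_le h2 hone).trans (by simp)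
  · have : HasDerivAt (fun s : ℝ => (s, x)) ((1 : ℝ), (0 : ℝ)) t :=
      (hasDerivAt_id t).prodMk (hasDerivAt_const t x)
    exact ((hd _ (hp x)).comp_hasDerivAt t this).differentiableAt

end Strip

/-! ### The maximum principle -/

section MaxPrinciple

lemma hasDerivAt_sqrt_one_add_sq (x : ℝ) :
    HasDerivAt (fun y : ℝ => √(1 + y ^ 2)) (x / √(1 + x ^ 2)) x := by
  have h := ((hasDerivAt_pow 2 x).const_add 1).sqrt (by positivity)
  convert h using 1
  simp
  field_simp

/-- The barrier has first and second derivatives bounded by one. These bounds account for the linear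
and the quadratic alternative respectively, so its singular integral is finite uniformly in `x`. -/
lemma sqrt_barrier (x : ℝ) {z : ℝ} (hz : 0 < z) :
    √(1 + (x - z) ^ 2) - √(1 + x ^ 2) + z * (x / √(1 + x ^ 2)) ≤ min (z ^ 2) (2 * z) := by
  set p := √(1 + x ^ 2) with hp
  set q := √(1 + (x - z) ^ 2) with hq
  have hp2 : p ^ 2 = 1 + x ^ 2 := Real.sq_sqrt (by positivity)
  have hq2 : q ^ 2 = 1 + (x - z) ^ 2 := Real.sq_sqrt (by positivity)
  have hp1 : 1 ≤ p := by rw [hp, Real.one_le_sqrt]; nlinarith [sq_nonneg x]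
  have hxp : |x| ≤ p := Real.abs_le_sqrt (by linarith)
  have hx := abs_le.1 hxp
  refine le_min ?_ ?_
  · have : q - p + z * (x / p) = (p * q - p ^ 2 + z * x) / p := by field_simp
    rw [this, div_le_iff₀ (by linarith)]
    nlinarith [sq_nonneg (q - p), mul_le_mul_of_nonneg_left hp1 (sq_nonneg z)]
  · have h1 : q ≤ p + z := by
      rw [hq, Real.sqrt_le_left (by linarith)]
      nlinarith
    have h2 : x / p ≤ 1 := by rw [div_le_one (by linarith)]; exact hx.2
    nlinarith

lemma abs_div_sqrt_le (x : ℝ) : |x / √(1 + x ^ 2)| ≤ 1 := by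
  have hp1 : 0 < √(1 + x ^ 2) := by positivity
  rw [abs_div, abs_of_pos hp1, div_le_one hp1]
  exact Real.abs_le_sqrt (by linarith)

/-- Only earlier times are compared, because the maximum may occur at the final time of the
interval. -/
lemma deriv_nonneg_of_left_max {h : ℝ → ℝ} {d a s : ℝ} (has : a < s) (hd : HasDerivAt h d s)
    (hm : ∀ r ∈ Ioo a s, h r ≤ h s) : 0 ≤ d := by
  have := (hasDerivAt_iff_tendsto_slope_left_right.1 hd).1
  refine ge_of_tendsto this ?_
  filter_upwards [Ioo_mem_nhdsLT has] with r hr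
  rw [slope_def_field]
  exact div_nonneg_of_nonpos (by linarith [hm r hr]) (by linarith [hr.2])

variable {α C A M t' t : ℝ} {u : ℝ → ℝ → ℝ}

/-- One-sided comparison with a constant for `∂ₜu + a ∂ₓu = ∂ₓ D^α u`. -/
lemma le_const_of_linear (h0 : 0 < α) (h1 : α < 1) (hlt : t' < t)
    (hcont : ContinuousOn (Function.uncurry u) (Icc t' t ×ˢ univ))
    (hC : ∀ s ∈ Icc t' t, ∀ x, |u s x| ≤ C)
    (hs : ∀ s ∈ Ioc t' t, ∃ g' g'', BddDerivs C (u s) g' g'' ∧ ∀ x, ∃ d a,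
      HasDerivAt (fun r => u r x) d s ∧ |a| ≤ A ∧ d + a * g' x = marchaud α g' x)
    (hM : ∀ x, u t' x ≤ M) (x₁ : ℝ) : u t x₁ ≤ M := by
  by_contra! hlt'
  set D := u t x₁ - M with hD
  have hD0 : 0 < D := by linarith
  set B := barrierConst α
  have hB : 0 ≤ B := barrierConst_nonneg h0 h1
  have hA : 0 ≤ A := by
    obtain ⟨g', g'', -, h⟩ := hs t ⟨hlt, le_rfl⟩
    obtain ⟨d, a, -, ha, -⟩ := h 0
    exact (abs_nonneg _).trans ha
  -- The excess `D` is shared out: a quarter for the drift in time, a quarter for the barrier at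
  -- `x₁`, so the penalized function still exceeds `M` by `D/2`.
  set ε := D / (4 * (t - t')) with hε
  have hε0 : 0 < ε := by have : 0 < t - t' := by linarith
                         positivity
  have hεt : ε * (t - t') = D / 4 := by
    rw [hε]; have : t - t' ≠ 0 := by linarith
    field_simp
  set ψ : ℝ → ℝ := fun x => √(1 + x ^ 2) with hψ
  have hψ0 : ∀ x, 0 < ψ x := fun x => by simp only [hψ]; positivity
  -- The second bound keeps the total effect of the barrier, through both the nonlocal operator and
  -- the transport term, strictly below `ε`.
  set η := min (D / (4 * ψ x₁)) (ε / (2 * (B + A + 1))) with hη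
  have hη0 : 0 < η := lt_min (by have := hψ0 x₁; positivity) (by positivity)
  have hη1 : η * ψ x₁ ≤ D / 4 := by
    have : η ≤ D / (4 * ψ x₁) := min_le_left _ _
    calc η * ψ x₁ ≤ D / (4 * ψ x₁) * ψ x₁ := by gcongr
      _ = D / 4 := by have := (hψ0 x₁).ne'; field_simp
  have hη2 : η * (B + A) < ε := by
    have h2 : η ≤ ε / (2 * (B + A + 1)) := min_le_right _ _
    calc η * (B + A) ≤ ε / (2 * (B + A + 1)) * (B + A + 1) :=
          mul_le_mul h2 (by linarith) (by linarith) (by positivity)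
      _ = ε / 2 := by field_simp
      _ < ε := by linarith
  set w : ℝ × ℝ → ℝ := fun p => u p.1 p.2 - ε * (p.1 - t') - η * ψ p.2 with hw
  have hw1 : M + D / 2 ≤ w (t, x₁) := by simp only [hw]; linarith
  -- Beyond `R` the barrier outweighs the bound `C`, so a maximum over a compact rectangle is a
  -- maximum over the strip.
  set R := max |x₁| ((C - w (t, x₁)) / η) with hR
  have hψabs : ∀ x, |x| ≤ ψ x := fun x => Real.abs_le_sqrt (by linarith)
  have hcomp : IsCompact (Icc t' t ×ˢ Icc (-R) R) := isCompact_Icc.prod isCompact_Icc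
  have hx1R : x₁ ∈ Icc (-R) R := abs_le.1 (le_max_left _ _)
  obtain ⟨p₀, hp₀, hmax⟩ := hcomp.exists_isMaxOn (f := w) ⟨(t, x₁), ⟨hlt.le, le_rfl⟩, hx1R⟩ (by
    have : ContinuousOn (Function.uncurry u) (Icc t' t ×ˢ Icc (-R) R) :=
      hcont.mono (prod_mono le_rfl (subset_univ _))
    refine (this.sub ?_).sub ?_ <;> fun_prop)
  obtain ⟨s₀, x₀⟩ := p₀
  have hbase : w (t, x₁) ≤ w (s₀, x₀) := hmax ⟨⟨hlt.le, le_rfl⟩, hx1R⟩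
  have hglob : ∀ s ∈ Icc t' t, ∀ x, w (s, x) ≤ w (s₀, x₀) := by
    intro s hs' x
    by_cases hx : x ∈ Icc (-R) R
    · exact hmax ⟨hs', hx⟩
    · have hx' : R < |x| := by
        by_contra! hc
        exact hx (abs_le.1 hc)
      have h2 : (C - w (t, x₁)) / η < ψ x := (le_max_right _ _).trans_lt (hx'.trans_le (hψabs x))
      rw [div_lt_iff₀ hη0] at h2
      have h3 := (abs_le.1 (hC s hs' x)).2
      have h4 : 0 ≤ ε * (s - t') := mul_nonneg hε0.le (by linarith [hs'.1])
      refine le_trans ?_ hbase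
      have : w (s, x) = u s x - ε * (s - t') - η * ψ x := rfl
      linarith
  -- At the initial time the penalized function lies below `M`, so the maximum is attained later,
  -- where the equation is available.
  have hs₀ : s₀ ∈ Ioc t' t := by
    refine ⟨lt_of_le_of_ne hp₀.1.1 ?_, hp₀.1.2⟩
    rintro rfl
    have h2 : w (t', x₀) = u t' x₀ - ε * (t' - t') - η * ψ x₀ := rfl
    have h3 := mul_pos hη0 (hψ0 x₀)
    have h4 := hM x₀
    rw [sub_self, mul_zero] at h2
    linarith
  obtain ⟨g', g'', hg, hx⟩ := hs s₀ hs₀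
  obtain ⟨d, a, hd, ha, heq⟩ := hx x₀
  have hspace : ∀ x, u s₀ x - η * ψ x ≤ u s₀ x₀ - η * ψ x₀ := fun x => by
    have := hglob s₀ hp₀.1 x
    simp only [hw] at this
    linarith
  have hg'0 : g' x₀ = η * (x₀ / ψ x₀) := by
    have hloc : IsLocalMax (fun x => u s₀ x - η * ψ x) x₀ := Eventually.of_forall hspace
    have := hloc.hasDerivAt_eq_zero
      ((hg.d1 x₀).sub ((hasDerivAt_sqrt_one_add_sq x₀).const_mul η))
    linarith
  have hmar : marchaud α g' x₀ ≤ η * B := by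
    refine marchaud_deriv_le h0 h1 hg.d1 hg.d2 hg.b0 hg.b1 hg.b2 fun z hz => ?_
    have h2 := mul_le_mul_of_nonneg_left (sqrt_barrier x₀ hz) hη0.le
    have h3 := hspace (x₀ - z)
    rw [hg'0]
    simp only [hψ] at h3 ⊢
    linarith
  have hdε : 0 ≤ d - ε := by
    refine deriv_nonneg_of_left_max (h := fun r => u r x₀ - ε * r) hs₀.1
      (hd.sub (by simpa using (hasDerivAt_id s₀).const_mul ε)) fun r hr => ?_
    have := hglob r ⟨hr.1.le, hr.2.le.trans hs₀.2⟩ x₀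
    simp only [hw] at this
    linarith
  have hag : |a * g' x₀| ≤ A * η := by
    rw [abs_mul, hg'0, abs_mul, abs_of_pos hη0]
    have := abs_div_sqrt_le x₀
    calc |a| * (η * |x₀ / ψ x₀|) ≤ A * (η * 1) := by gcongr
      _ = A * η := by ring
  have := (abs_le.1 hag).1
  -- At the maximum `d ≥ ε` and `a g' ≥ -Aη`, whereas the right-hand side is at most `ηB`. This
  -- contradicts `η(B + A) < ε`.
  nlinarith

/-- Leaving the coefficient `a` arbitrary makes the comparison linear. It therefore applies to `-u`
with the same `a`, although the nonlinear equation is not odd. -/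
lemma abs_le_const_of_linear (h0 : 0 < α) (h1 : α < 1) (hlt : t' < t)
    (hcont : ContinuousOn (Function.uncurry u) (Icc t' t ×ˢ univ))
    (hC : ∀ s ∈ Icc t' t, ∀ x, |u s x| ≤ C)
    (hs : ∀ s ∈ Ioc t' t, ∃ g' g'', BddDerivs C (u s) g' g'' ∧ ∀ x, ∃ d a,
      HasDerivAt (fun r => u r x) d s ∧ |a| ≤ A ∧ d + a * g' x = marchaud α g' x)
    (hM : ∀ x, |u t' x| ≤ M) (x : ℝ) : |u t x| ≤ M := by
  refine abs_le'.2 ⟨le_const_of_linear h0 h1 hlt hcont hC hs (fun x => (abs_le'.1 (hM x)).1) x,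
    le_const_of_linear (u := fun s x => -u s x) (A := A) h0 h1 hlt hcont.neg (fun s hs x => by
      simpa using hC s hs x) (fun s hs' => ?_) (fun x => (abs_le'.1 (hM x)).2) x⟩
  obtain ⟨g', g'', hg, hx⟩ := hs s hs'
  refine ⟨_, _, hg.neg, fun x => ?_⟩
  obtain ⟨d, a, hd, ha, heq⟩ := hx x
  refine ⟨-d, a, hd.neg, ha, ?_⟩
  rw [marchaud_neg, ← heq]
  ring

/-- Maximum principle, pointwise form. -/
theorem abs_le_of_solvesEquation (h0 : 0 < α) (h1 : α < 1) {f : ℝ → ℝ} (hf : ContDiff ℝ ∞ f)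
    {T : EReal} (hu : CbAwayFromZero 2 T u) (hsol : SolvesEquation α f T u) (ht' : 0 < t')
    (hlt : t' < t) (htT : (t : EReal) < T) (hM : ∀ x, |u t' x| ≤ M) (x : ℝ) : |u t x| ≤ M := by
  have hcb := hu (t' / 2) (by linarith)
  obtain ⟨C, ux, hC0, -, hC⟩ := hcb.slices
  have hmem : ∀ s ∈ Icc t' t, s ∈ timeIoo (t' / 2) T := fun s hs =>
    ⟨by linarith [hs.1], lt_of_le_of_lt (EReal.coe_le_coe_iff.2 hs.2) htT⟩
  have hfd : Differentiable ℝ f := hf.differentiable (by simp)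
  have hf' : Continuous (deriv f) := hf.continuous_deriv (by simp)
  obtain ⟨A, hA⟩ := (isCompact_Icc (a := -C) (b := C)).exists_bound_of_continuousOn
    hf'.continuousOn
  refine abs_le_const_of_linear (C := C) (A := A) h0 h1 hlt (hcb.1.continuousOn.mono fun p hp =>
    ⟨hmem _ hp.1, mem_univ _⟩) (fun s hs x => ?_) (fun s hs => ?_) hM x
  · obtain ⟨⟨g'', hg⟩, -⟩ := hC s (hmem s hs)
    exact hg.b0 x
  · obtain ⟨⟨g'', hg⟩, hd⟩ := hC s (hmem s ⟨hs.1.le, hs.2⟩)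
    refine ⟨ux s, g'', hg, fun x => ⟨_, deriv f (u s x), (hd x).hasDerivAt,
      hA _ (abs_le.1 (hg.b0 x)), ?_⟩⟩
    have h2 := hsol s ⟨by linarith [hs.1], (hmem s ⟨hs.1.le, hs.2⟩).2⟩ x
    have h3 : HasDerivAt (fun y => f (u s y)) (deriv f (u s x) * ux s x) x :=
      (hfd _).hasDerivAt.comp x (hg.d1 x)
    rwa [deriv_fracDer h0 h1 hg.d1 hg.d2 hg.b0 hg.b1 hg.b2, h3.deriv] at h2

theorem supNorm_antitone (h0 : 0 < α) (h1 : α < 1) {f : ℝ → ℝ} (hf : ContDiff ℝ ∞ f)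
    {T : EReal} (hu : CbAwayFromZero 2 T u) (hsol : SolvesEquation α f T u) (ht' : 0 < t')
    (hlt : t' < t) (htT : (t : EReal) < T) : supNorm (u t) ≤ supNorm (u t') := by
  obtain ⟨C, ux, hC0, -, hC⟩ := (hu (t' / 2) (by linarith)).slices
  obtain ⟨⟨g'', hg⟩, -⟩ := hC t' ⟨by linarith, (EReal.coe_lt_coe_iff.2 hlt).trans htT⟩
  have hfin : supNorm (u t') ≠ ⊤ := ((supNorm_le hg.b0).trans_lt ENNReal.ofReal_lt_top).ne
  have hc : Continuous (u t') := continuous_iff_continuousAt.2 fun x => (hg.d1 x).continuousAt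
  rw [← ENNReal.ofReal_toReal hfin]
  exact supNorm_le (abs_le_of_solvesEquation h0 h1 hf hu hsol ht' hlt htT
    (abs_le_supNorm hc hfin))

end MaxPrinciple

/-! ### The Fourier symbol of the Marchaud derivative -/

section Symbol

variable {α : ℝ}

lemma integrableOn_min_mul_rpow (h0 : 0 < α) (h1 : α < 1) :
    IntegrableOn (fun z : ℝ => min z 1 * z ^ (-α - 1)) (Ioi 0) := by
  refine integrableOn_Ioi_of_bounds (C := 1) (a := -α) (b := -α - 1) (by linarith)
    (by linarith) ?_ ?_ ?_
  · refine ContinuousOn.mul (by fun_prop) fun s hs => ?_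
    exact (Real.continuousAt_rpow_const s _ (Or.inl (ne_of_gt hs))).continuousWithinAt
  · intro s hs
    have hs0 : 0 < s := hs.1
    rw [min_eq_left hs.2, abs_of_nonneg (by positivity), one_mul,
      ← Real.rpow_one_add' hs0.le (by linarith)]
    apply le_of_eq; ring_nf
  · intro s hs
    have hs1 : 1 < s := hs
    have hs0 : 0 < s := one_pos.trans hs
    rw [min_eq_right hs1.le, one_mul, abs_of_nonneg (by positivity)]

lemma norm_one_sub_exp_neg_le {w : ℂ} (hw : 0 ≤ w.re) :
    ‖1 - Complex.exp (-w)‖ ≤ 2 * min ‖w‖ 1 := by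
  have h2 : ‖1 - Complex.exp (-w)‖ ≤ 2 := by
    refine (norm_sub_le _ _).trans ?_
    rw [norm_one, Complex.norm_exp]
    have : Real.exp (-w).re ≤ 1 := Real.exp_le_one_iff.2 (by simpa using hw)
    linarith
  rcases le_total ‖w‖ 1 with h | h
  · rw [min_eq_left h, norm_sub_rev]
    simpa using Complex.norm_exp_sub_one_le (x := -w) (by simpa using h)
  · rwa [min_eq_right h, mul_one]

lemma norm_one_sub_exp_neg_mul_le {r : ℂ} (hr : 0 ≤ r.re) {z : ℝ} (hz : 0 < z) :
    ‖1 - Complex.exp (-(r * z))‖ ≤ 2 * (1 + ‖r‖) * min z 1 := by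
  refine (norm_one_sub_exp_neg_le (by rw [Complex.re_mul_ofReal]; positivity)).trans ?_
  rw [norm_mul, Complex.norm_real, Real.norm_of_nonneg hz.le, mul_assoc]
  gcongr
  have := norm_nonneg r
  rcases le_total z 1 with h | h
  · rw [min_eq_left h]
    exact (min_le_left _ _).trans (by nlinarith)
  · rw [min_eq_right h]
    exact (min_le_right _ _).trans (by nlinarith)

/-- The Laplace exponent `∫₀^∞ (1 - e^{-rz}) z^{-α-1} dz`. -/
def laplaceExp (α : ℝ) (r : ℂ) : ℂ :=
  ∫ z in Ioi (0 : ℝ), (1 - Complex.exp (-(r * z))) * ((z ^ (-α - 1) : ℝ) : ℂ)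

lemma norm_laplace_integrand_le {r : ℂ} (hr : 0 ≤ r.re) {z : ℝ} (hz : 0 < z) :
    ‖(1 - Complex.exp (-(r * z))) * ((z ^ (-α - 1) : ℝ) : ℂ)‖ ≤
      2 * (1 + ‖r‖) * (min z 1 * z ^ (-α - 1)) := by
  rw [norm_mul, Complex.norm_real, Real.norm_of_nonneg (by positivity), ← mul_assoc]
  exact mul_le_mul_of_nonneg_right (norm_one_sub_exp_neg_mul_le hr hz) (by positivity)

lemma continuousOn_rpow_complex (q : ℝ) :
    ContinuousOn (fun z : ℝ => ((z ^ q : ℝ) : ℂ)) (Ioi 0) :=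
  Complex.continuous_ofReal.comp_continuousOn
    (continuousOn_id.rpow_const fun _ hz => Or.inl (ne_of_gt hz))

lemma aestronglyMeasurable_laplace (r : ℂ) : AEStronglyMeasurable
    (fun z : ℝ => (1 - Complex.exp (-(r * z))) * ((z ^ (-α - 1) : ℝ) : ℂ))
      (volume.restrict (Ioi 0)) :=
  (ContinuousOn.mul (by fun_prop) (continuousOn_rpow_complex _)).aestronglyMeasurable
    measurableSet_Ioi

lemma integrableOn_laplace (h0 : 0 < α) (h1 : α < 1) {r : ℂ} (hr : 0 ≤ r.re) : IntegrableOn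
    (fun z : ℝ => (1 - Complex.exp (-(r * z))) * ((z ^ (-α - 1) : ℝ) : ℂ)) (Ioi 0) := by
  refine Integrable.mono' ((integrableOn_min_mul_rpow h0 h1).const_mul (2 * (1 + ‖r‖)))
    (aestronglyMeasurable_laplace r) ?_
  filter_upwards [ae_restrict_mem measurableSet_Ioi] with z hz
  exact norm_laplace_integrand_le hr hz

lemma integrableOn_rpow_mul_exp_neg (h1 : α < 1) {c : ℝ} (hc : 0 < c) :
    IntegrableOn (fun z : ℝ => z ^ (-α) * Real.exp (-c * z)) (Ioi 0) := by
  have := integrableOn_rpow_mul_exp_neg_mul_rpow (p := 1) (s := -α) (b := c) (by linarith)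
    one_pos hc
  simpa using this

lemma norm_exp_neg_mul_rpow_le {r : ℂ} {c : ℝ} (hr : c ≤ r.re) {z : ℝ} (hz : 0 < z) :
    ‖Complex.exp (-(r * z)) * ((z ^ (-α) : ℝ) : ℂ)‖ ≤ z ^ (-α) * Real.exp (-c * z) := by
  rw [norm_mul, Complex.norm_real, Real.norm_of_nonneg (by positivity), mul_comm,
    Complex.norm_exp]
  gcongr
  rw [Complex.neg_re, Complex.re_mul_ofReal, neg_mul]
  gcongr

lemma integrableOn_exp_neg_mul_rpow (h1 : α < 1) {r : ℂ} (hr : 0 < r.re) :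
    IntegrableOn (fun z : ℝ => Complex.exp (-(r * z)) * ((z ^ (-α) : ℝ) : ℂ)) (Ioi 0) := by
  refine Integrable.mono' (integrableOn_rpow_mul_exp_neg h1 hr)
    ((ContinuousOn.mul (by fun_prop) (continuousOn_rpow_complex _)).aestronglyMeasurable
      measurableSet_Ioi) ?_
  filter_upwards [ae_restrict_mem measurableSet_Ioi] with z hz
  exact norm_exp_neg_mul_rpow_le le_rfl hz

/-- Integration by parts lowers the singularity to `z^{-α}`, where the Laplace integral converges
separately. It needs `Re r > 0`, so the imaginary axis is reached only by a limit. -/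
lemma laplaceExp_eq (h0 : 0 < α) (h1 : α < 1) {r : ℂ} (hr : 0 < r.re) :
    α * laplaceExp α r =
      r * ∫ z in Ioi (0 : ℝ), Complex.exp (-(r * z)) * ((z ^ (-α) : ℝ) : ℂ) := by
  have hα : (α : ℂ) ≠ 0 := by exact_mod_cast h0.ne'
  have hlim : ∀ l : Filter ℝ, (∀ᶠ z in l, 0 < z) →
      Tendsto (fun z : ℝ => min z 1 * z ^ (-α)) l (𝓝 0) →
      Tendsto ((fun z : ℝ => 1 - Complex.exp (-(r * z))) *
        (fun z : ℝ => -(α : ℂ)⁻¹ * ((z ^ (-α) : ℝ) : ℂ))) l (𝓝 0) := by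
    intro l hl h
    refine squeeze_zero_norm' (a := fun z => 2 * (1 + ‖r‖) * ‖(α : ℂ)⁻¹‖ * (min z 1 * z ^ (-α)))
      ?_ (by simpa using h.const_mul (2 * (1 + ‖r‖) * ‖(α : ℂ)⁻¹‖))
    filter_upwards [hl] with z hz
    rw [Pi.mul_apply, norm_mul, norm_mul, norm_neg, Complex.norm_real,
      Real.norm_of_nonneg (by positivity)]
    have := norm_one_sub_exp_neg_mul_le hr.le hz
    calc _ ≤ 2 * (1 + ‖r‖) * min z 1 * (‖(α : ℂ)⁻¹‖ * z ^ (-α)) := by gcongr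
      _ = _ := by ring
  have key := integral_Ioi_mul_deriv_eq_deriv_mul (A := ℂ) (a := 0) (a' := 0) (b' := 0)
    (u := fun z : ℝ => 1 - Complex.exp (-(r * z))) (u' := fun z : ℝ => r * Complex.exp (-(r * z)))
    (v := fun z : ℝ => -(α : ℂ)⁻¹ * ((z ^ (-α) : ℝ) : ℂ))
    (v' := fun z : ℝ => ((z ^ (-α - 1) : ℝ) : ℂ)) ?_ ?_ ?_ ?_ ?_ ?_
  · unfold laplaceExp
    rw [key, ← integral_const_mul, sub_zero, zero_sub, ← integral_neg, ← integral_const_mul]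
    refine integral_congr_ae (Eventually.of_forall fun z => ?_)
    simp only
    field_simp
  · intro z _
    have h2 : HasDerivAt (fun z : ℝ => -(r * z)) (-r) z := by
      exact ((hasDerivAt_id' z).ofReal_comp.const_mul r).fun_neg.congr_deriv (by simp)
    exact ((h2.cexp).const_sub 1).congr_deriv (by ring)
  · intro z hz
    have h2 := ((Real.hasDerivAt_rpow_const (p := -α) (Or.inl (ne_of_gt hz))).ofReal_comp).const_mul
      (-(α : ℂ)⁻¹)
    refine h2.congr_deriv ?_
    push_cast
    field_simp
  · exact integrableOn_laplace h0 h1 hr.le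
  · have := (integrableOn_exp_neg_mul_rpow h1 hr).const_mul (r * -(α : ℂ)⁻¹)
    refine this.congr (Eventually.of_forall fun z => ?_)
    simp only [Pi.mul_apply]
    ring
  · refine hlim _ self_mem_nhdsWithin ?_
    have h2 : Tendsto (fun z : ℝ => z ^ (1 - α)) (𝓝[>] 0) (𝓝 0) := by
      have h3 := (Real.continuousAt_rpow_const 0 (1 - α) (Or.inr (by linarith))).tendsto
      rw [Real.zero_rpow (by linarith)] at h3
      exact h3.mono_left nhdsWithin_le_nhds
    refine h2.congr' ?_
    filter_upwards [Ioo_mem_nhdsGT one_pos] with z hz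
    rw [min_eq_left hz.2.le, ← Real.rpow_one_add' hz.1.le (by linarith)]
    ring_nf
  · refine hlim _ (eventually_gt_atTop 0) ?_
    refine (tendsto_rpow_neg_atTop h0).congr' ?_
    filter_upwards [eventually_ge_atTop 1] with z hz
    rw [min_eq_right hz, one_mul]

/-- The point `e^{iθ}` of the unit circle. -/
def unitPt (θ : ℝ) : ℂ := Complex.exp (Complex.I * θ)

lemma unitPt_re (θ : ℝ) : (unitPt θ).re = Real.cos θ := by
  rw [unitPt, mul_comm, Complex.exp_ofReal_mul_I_re]

lemma norm_unitPt (θ : ℝ) : ‖unitPt θ‖ = 1 := by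
  rw [unitPt, mul_comm, Complex.norm_exp_ofReal_mul_I]

lemma hasDerivAt_unitPt (θ : ℝ) : HasDerivAt unitPt (Complex.I * unitPt θ) θ := by
  have h2 : HasDerivAt (fun θ : ℝ => Complex.I * (θ : ℂ)) Complex.I θ := by
    simpa using (hasDerivAt_id θ).ofReal_comp.const_mul Complex.I
  have := h2.cexp
  rw [mul_comm]
  exact this

/-- Differentiating under the integral produces the right-hand side of `laplaceExp_eq` times `i`.
Along the unit circle the exponent thus satisfies a linear ODE, which replaces a contour rotation.
-/
lemma hasDerivAt_laplaceExp_unitPt (h0 : 0 < α) (h1 : α < 1) {θ : ℝ} (hθ : 0 < Real.cos θ) :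
    HasDerivAt (fun θ => laplaceExp α (unitPt θ)) (Complex.I * α * laplaceExp α (unitPt θ)) θ := by
  obtain ⟨c, hc0, hc⟩ := exists_between hθ
  have hnhds : {s | c < Real.cos s} ∈ 𝓝 θ :=
    (isOpen_lt continuous_const Real.continuous_cos).mem_nhds hc
  have hcongr : ∀ s z : ℝ, 0 < z → Complex.I * unitPt s * z * Complex.exp (-(unitPt s * z)) *
      ((z ^ (-α - 1) : ℝ) : ℂ) = Complex.I * unitPt s *
        (Complex.exp (-(unitPt s * z)) * ((z ^ (-α) : ℝ) : ℂ)) := by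
    intro s z hz
    have : z ^ (-α) = z * z ^ (-α - 1) := by
      rw [← Real.rpow_one_add' hz.le (by linarith)]; ring_nf
    rw [this]
    push_cast
    ring
  have key := (hasDerivAt_integral_of_dominated_loc_of_deriv_le (𝕜 := ℝ)
    (μ := volume.restrict (Ioi (0 : ℝ)))
    (F := fun s z => (1 - Complex.exp (-(unitPt s * z))) * ((z ^ (-α - 1) : ℝ) : ℂ))
    (F' := fun s z => Complex.I * unitPt s * z * Complex.exp (-(unitPt s * z)) *
      ((z ^ (-α - 1) : ℝ) : ℂ))
    (bound := fun z => z ^ (-α) * Real.exp (-c * z)) (x₀ := θ) hnhds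
    (Eventually.of_forall fun s => aestronglyMeasurable_laplace _)
    (integrableOn_laplace h0 h1 (by rw [unitPt_re]; exact hθ.le))
    ((ContinuousOn.mul (by fun_prop) (continuousOn_rpow_complex _)).aestronglyMeasurable
      measurableSet_Ioi) ?_ (integrableOn_rpow_mul_exp_neg h1 hc0) ?_).2
  · refine key.congr_deriv (Eq.symm ?_)
    have : Complex.I * α * laplaceExp α (unitPt θ) =
        Complex.I * (α * laplaceExp α (unitPt θ)) := by ring
    rw [this, laplaceExp_eq h0 h1 (by rw [unitPt_re]; exact hθ), ← mul_assoc,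
      ← integral_const_mul]
    exact setIntegral_congr_fun measurableSet_Ioi fun z hz => (hcongr θ z hz).symm
  · filter_upwards [ae_restrict_mem measurableSet_Ioi] with z hz s hs
    rw [hcongr s z hz, norm_mul, norm_mul, Complex.norm_I, norm_unitPt, one_mul, one_mul]
    exact norm_exp_neg_mul_rpow_le (by rw [unitPt_re]; exact le_of_lt hs) hz
  · refine Eventually.of_forall fun z s _ => ?_
    have h2 := (((hasDerivAt_unitPt s).mul_const (z : ℂ)).fun_neg.cexp.const_sub 1).mul_const
      ((z ^ (-α - 1) : ℝ) : ℂ)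
    exact h2.congr_deriv (by ring)

lemma laplaceExp_one (h0 : 0 < α) (h1 : α < 1) :
    laplaceExp α 1 = ((Real.Gamma (1 - α) / α : ℝ) : ℂ) := by
  have hα : (α : ℂ) ≠ 0 := by exact_mod_cast h0.ne'
  have h2 := laplaceExp_eq h0 h1 (r := 1) (by simp)
  have h3 : ∫ z in Ioi (0 : ℝ), Complex.exp (-(1 * z)) * ((z ^ (-α) : ℝ) : ℂ) =
      ((Real.Gamma (1 - α) : ℝ) : ℂ) := by
    rw [Real.Gamma_eq_integral (by linarith), ← integral_complex_ofReal]
    refine integral_congr_ae (Eventually.of_forall fun z => ?_)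
    simp only
    rw [show 1 - α - 1 = -α by ring]
    push_cast
    rw [one_mul]
  rw [h3, one_mul] at h2
  push_cast
  rw [← h2]
  field_simp

/-- The ODE gives growth `e^{iαθ}` from the Gamma value at `θ = 0`. It holds only for `θ < π/2`, but
the exponent is continuous up to `π/2`, which is the point `i`. -/
lemma laplaceExp_I (h0 : 0 < α) (h1 : α < 1) : laplaceExp α Complex.I =
    ((Real.Gamma (1 - α) / α : ℝ) : ℂ) * Complex.exp (Complex.I * (π * α / 2 : ℝ)) := by
  have hcos : ∀ θ ∈ Ico 0 (π / 2), 0 < Real.cos θ := fun θ hθ =>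
    Real.cos_pos_of_mem_Ioo ⟨by linarith [hθ.1, Real.pi_pos], hθ.2⟩
  have hcexp : ∀ θ : ℝ, HasDerivAt (fun θ : ℝ => Complex.exp (-(Complex.I * α * θ)))
      (Complex.exp (-(Complex.I * α * θ)) * -(Complex.I * α)) θ := fun θ => by
    have h2 : HasDerivAt (fun θ : ℝ => -(Complex.I * α * (θ : ℂ))) (-(Complex.I * α)) θ := by
      exact ((hasDerivAt_id' θ).ofReal_comp.const_mul (Complex.I * α)).fun_neg.congr_deriv (by simp)
    exact h2.cexp
  have hcont : ContinuousOn (fun θ => laplaceExp α (unitPt θ)) (Icc 0 (π / 2)) := by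
    unfold laplaceExp
    refine continuousOn_of_dominated (bound := fun z => 2 * (1 + 1) * (min z 1 * z ^ (-α - 1)))
      (fun θ _ => aestronglyMeasurable_laplace _) (fun θ hθ => ?_)
      ((integrableOn_min_mul_rpow h0 h1).const_mul _) ?_
    · filter_upwards [ae_restrict_mem measurableSet_Ioi] with z hz
      have h2 : 0 ≤ (unitPt θ).re := by
        rw [unitPt_re]
        exact Real.cos_nonneg_of_mem_Icc ⟨by linarith [hθ.1, Real.pi_pos], hθ.2⟩
      have h3 := norm_laplace_integrand_le (α := α) h2 (z := z) hz
      rwa [norm_unitPt] at h3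
    · refine Eventually.of_forall fun z => Continuous.continuousOn ?_
      have : Continuous unitPt := continuous_iff_continuousAt.2 fun θ =>
        (hasDerivAt_unitPt θ).continuousAt
      fun_prop
  have hconst := constant_of_has_deriv_right_zero
    (f := fun θ : ℝ => Complex.exp (-(Complex.I * α * θ)) * laplaceExp α (unitPt θ))
    (a := 0) (b := π / 2) (ContinuousOn.mul (by fun_prop) hcont) (fun θ hθ => by
      have := (hcexp θ).mul (hasDerivAt_laplaceExp_unitPt h0 h1 (hcos θ hθ))
      refine HasDerivAt.hasDerivWithinAt ?_
      exact this.congr_deriv (by ring)) (π / 2) ⟨by positivity, le_rfl⟩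
  have e0 : unitPt 0 = 1 := by simp [unitPt]
  have e1 : unitPt (π / 2) = Complex.I := exp_I_pi_half
  simp only [e0, e1, Complex.ofReal_zero, mul_zero, neg_zero, Complex.exp_zero, one_mul] at hconst
  rw [← laplaceExp_one h0 h1, ← hconst, mul_right_comm, ← Complex.exp_add]
  have : -(Complex.I * α * ((π / 2 : ℝ) : ℂ)) + Complex.I * ((π * α / 2 : ℝ) : ℂ) = 0 := by
    push_cast; ring
  rw [this, Complex.exp_zero, one_mul]

lemma laplaceExp_mul (ξ : ℝ) (hξ : 0 < ξ) (r : ℂ) :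
    laplaceExp α (r * ξ) = ((ξ ^ α : ℝ) : ℂ) * laplaceExp α r := by
  unfold laplaceExp
  have h2 := integral_comp_mul_left_Ioi
    (fun z : ℝ => (1 - Complex.exp (-(r * z))) * ((z ^ (-α - 1) : ℝ) : ℂ)) 0 hξ
  rw [mul_zero] at h2
  have h3 : ((ξ ^ α : ℝ) : ℂ) = ((ξ ^ (α + 1) : ℝ) : ℂ) * (ξ : ℂ)⁻¹ := by
    rw [Real.rpow_add_one hξ.ne']
    push_cast
    have : (ξ : ℂ) ≠ 0 := by exact_mod_cast hξ.ne'
    field_simp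
  have h4 := congrArg (fun w => ((ξ ^ (α + 1) : ℝ) : ℂ) * w) h2
  rw [Complex.real_smul, ← mul_assoc, Complex.ofReal_inv, ← h3] at h4
  rw [← h4, ← integral_const_mul]
  refine setIntegral_congr_fun measurableSet_Ioi fun z hz => ?_
  have hz0 : (0 : ℝ) < z := hz
  rw [Real.mul_rpow hξ.le hz0.le]
  have h5 : ξ ^ (α + 1) * ξ ^ (-α - 1) = 1 := by
    rw [← Real.rpow_add hξ, show α + 1 + (-α - 1) = 0 by ring, Real.rpow_zero]
  have h6 : ((ξ ^ (α + 1) : ℝ) : ℂ) * ((ξ ^ (-α - 1) : ℝ) : ℂ) = 1 := by exact_mod_cast h5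
  push_cast
  rw [mul_assoc r]
  linear_combination (-(1 - Complex.exp (-(r * (ξ * z)))) * ((z ^ (-α - 1) : ℝ) : ℂ)) * h6

end Symbol

/-! ### The generator of the semigroup and its action on smooth functions -/

section Generator

variable {α s C : ℝ} {g g' : ℝ → ℝ}

lemma symb_shift (q y z ξ : ℝ) :
    symb α q s (y - z) ξ = symb α q s y ξ * Complex.exp (-(Complex.I * ξ * z)) := by
  unfold symb
  rw [mul_assoc ((ξ ^ q : ℝ) : ℂ), ← Complex.exp_add]
  congr 2
  push_cast
  ring

lemma symb_mul_exp {ξ : ℝ} (hξ : 0 < ξ) (y : ℝ) :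
    symb α 1 s y ξ * (((ξ ^ α : ℝ) : ℂ) * Complex.exp (Complex.I * (π * α / 2 : ℝ))) =
      symb α (α + 1) s y ξ := by
  unfold symb
  have h2 : ξ ^ (α + 1) = ξ ^ (1 : ℝ) * ξ ^ α := by rw [add_comm, Real.rpow_add hξ]
  have h3 : Complex.exp (Complex.I * (π * (α + 1) / 2 : ℝ) +
      (s : ℂ) * omega α * ((ξ ^ (α + 1) : ℝ) : ℂ) + Complex.I * ξ * y) =
      Complex.exp (Complex.I * (π * 1 / 2 : ℝ) +
      (s : ℂ) * omega α * ((ξ ^ (α + 1) : ℝ) : ℂ) + Complex.I * ξ * y) *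
      Complex.exp (Complex.I * (π * α / 2 : ℝ)) := by
    rw [← Complex.exp_add]
    congr 1
    push_cast
    ring
  rw [h3]
  nth_rewrite 2 [h2]
  push_cast
  ring

/-- The generator acts on the kernel by raising the order of the symbol. -/
lemma marchaud_G (h0 : 0 < α) (h1 : α < 1) (hs : 0 < s) (y : ℝ) :
    marchaud α (G α 1 s) y = G α (α + 1) s y := by
  have hq : (-1 : ℝ) < 1 := by norm_num
  set k : ℝ → ℝ → ℂ := fun z ξ => symb α 1 s y ξ *
    ((1 - Complex.exp (-(Complex.I * ξ * z))) * ((z ^ (-α - 1) : ℝ) : ℂ)) with hk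
  have hdiff : ∀ z, ((G α 1 s y - G α 1 s (y - z)) * z ^ (-α - 1)) =
      π⁻¹ * (∫ ξ in Ioi (0 : ℝ), k z ξ).re := by
    intro z
    have h2 : ∫ ξ in Ioi (0 : ℝ), k z ξ = ((∫ ξ in Ioi (0 : ℝ), symb α 1 s y ξ) -
        ∫ ξ in Ioi (0 : ℝ), symb α 1 s (y - z) ξ) * ((z ^ (-α - 1) : ℝ) : ℂ) := by
      rw [← integral_sub (integrableOn_symb h0 h1 hq hs y)
        (integrableOn_symb h0 h1 hq hs (y - z)), ← integral_mul_const]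
      refine integral_congr_ae (Eventually.of_forall fun ξ => ?_)
      simp only [hk, symb_shift]
      ring
    rw [h2, Complex.re_mul_ofReal, Complex.sub_re]
    unfold G
    ring
  -- The factor `1 - e^{-iξz}` costs at most `1 + ξ`, so the symbols of orders one and two supply
  -- the majorant in `ξ`.
  have hInt : Integrable (Function.uncurry k)
      ((volume.restrict (Ioi (0 : ℝ))).prod (volume.restrict (Ioi (0 : ℝ)))) := by
    have hb := (integrableOn_min_mul_rpow h0 h1).mul_prod
      (((integrableOn_rpow_exp h0 h1 (q := 1) hq hs).add
        (integrableOn_rpow_exp h0 h1 (q := 2) (by norm_num) hs)).const_mul 2)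
    refine hb.mono' ?_ ?_
    · refine AEStronglyMeasurable.mul ?_ (AEStronglyMeasurable.mul ?_ ?_)
      · exact (integrableOn_symb h0 h1 hq hs y).aestronglyMeasurable.comp_snd
      · exact Continuous.aestronglyMeasurable (by fun_prop)
      · exact ((continuousOn_rpow_complex _).aestronglyMeasurable measurableSet_Ioi).comp_fst
    · rw [Measure.prod_restrict]
      filter_upwards [ae_restrict_mem (measurableSet_Ioi.prod measurableSet_Ioi)] with p hp
      obtain ⟨z, ξ⟩ := p
      have hz : (0 : ℝ) < z := hp.1
      have hξ : (0 : ℝ) < ξ := hp.2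
      have h2 := norm_laplace_integrand_le (α := α) (r := Complex.I * ξ) (by simp) hz
      have h3 : ‖Complex.I * (ξ : ℂ)‖ = ξ := by simp [abs_of_pos hξ]
      rw [h3] at h2
      simp only [Function.uncurry, hk, Pi.add_apply]
      rw [norm_mul, norm_symb hξ]
      have h4 : ξ ^ (2 : ℝ) = ξ ^ (1 : ℝ) * ξ := by
        rw [Real.rpow_one, Real.rpow_two]; ring
      rw [h4]
      calc _ ≤ ξ ^ (1 : ℝ) * Real.exp (-(decay α * s) * ξ ^ (α + 1)) *
          (2 * (1 + ξ) * (min z 1 * z ^ (-α - 1))) := by gcongr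
        _ = _ := by ring
  have hswap := integral_integral_swap hInt
  have hin : ∀ ξ ∈ Ioi (0 : ℝ), ∫ z in Ioi (0 : ℝ), k z ξ =
      ((Real.Gamma (1 - α) / α : ℝ) : ℂ) * symb α (α + 1) s y ξ := by
    intro ξ hξ
    simp only [hk]
    rw [integral_const_mul]
    have h2 := laplaceExp_mul (α := α) ξ hξ Complex.I
    unfold laplaceExp at h2
    rw [h2]
    have h3 := laplaceExp_I h0 h1
    unfold laplaceExp at h3
    rw [h3, ← symb_mul_exp hξ]
    ring
  have hre : ∫ z in Ioi (0 : ℝ), (∫ ξ in Ioi (0 : ℝ), k z ξ).re =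
      (∫ z in Ioi (0 : ℝ), ∫ ξ in Ioi (0 : ℝ), k z ξ).re :=
    integral_re (𝕜 := ℂ) hInt.integral_prod_left
  unfold marchaud
  simp_rw [hdiff]
  rw [integral_const_mul, hre, hswap, setIntegral_congr_fun measurableSet_Ioi hin,
    integral_const_mul, Complex.re_ofReal_mul]
  have hG : Real.Gamma (1 - α) ≠ 0 := (Real.Gamma_pos_of_pos (by linarith)).ne'
  unfold G
  field_simp

/-- For shifts below one the mean value theorem uses the decay of the derivative, with the factor
three from comparing weights at distance at most one. For larger shifts the triangle inequality
suffices. -/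
lemma integral_abs_G_sub_le (h0 : 0 < α) (h1 : α < 1) (hs : 0 < s) :
    ∃ D, 0 ≤ D ∧ ∀ z, 0 < z → ∫ w, |G α 1 s w - G α 1 s (w - z)| ≤ D * min z 1 := by
  have i1 := integrable_G (q := 1) h0 h1 (Or.inr le_rfl) hs
  obtain ⟨C, hC0, hC⟩ := G_decay (q := 2) (b := s) h0 h1 (Or.inr one_le_two) hs
  set N := ∫ w, |G α 1 s w| with hN
  have hN0 : 0 ≤ N := integral_nonneg fun _ => abs_nonneg _
  have hd : ∀ w, HasDerivAt (G α 1 s) (G α 2 s w) w := fun w => by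
    have := hasDerivAt_G_space (q := 1) (x := w) h0 h1 (by norm_num) hs
    norm_num at this
    exact this
  have hdi : ∀ z, Integrable fun w => G α 1 s w - G α 1 s (w - z) := fun z =>
    i1.sub (i1.comp_sub_right z)
  refine ⟨2 * N + 3 * C * π, by positivity, fun z hz => ?_⟩
  rcases le_total z 1 with h | h
  · rw [min_eq_left h]
    have hpt : ∀ w, |G α 1 s w - G α 1 s (w - z)| ≤ z * (3 * C) * (1 + w ^ 2)⁻¹ := by
      intro w
      have := Convex.norm_image_sub_le_of_norm_hasDerivWithin_le (f := G α 1 s) (f' := G α 2 s)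
        (s := Icc (w - z) w) (C := 3 * C * (1 + w ^ 2)⁻¹) (x := w - z) (y := w)
        (fun v _ => (hd v).hasDerivWithinAt) (fun v hv => ?_) (convex_Icc _ _)
        ⟨le_rfl, by linarith⟩ ⟨by linarith, le_rfl⟩
      · rw [Real.norm_eq_abs, Real.norm_eq_abs, sub_sub_cancel, abs_of_pos hz] at this
        linarith
      · refine (hC s v le_rfl le_rfl).trans ?_
        rw [mul_comm 3 C, mul_assoc]
        refine mul_le_mul_of_nonneg_left ?_ hC0
        rw [← div_eq_mul_inv, inv_le_iff_one_le_mul₀ (by positivity), ← mul_div_right_comm,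
          le_div_iff₀ (by positivity), one_mul]
        have h3 : (w - v) ^ 2 ≤ 1 := by
          have h4 : 0 ≤ w - v := by linarith [hv.2]
          have h5 : w - v ≤ 1 := by linarith [hv.1]
          nlinarith
        nlinarith [sq_nonneg (w - 2 * v)]
    calc ∫ w, |G α 1 s w - G α 1 s (w - z)| ≤ ∫ w, z * (3 * C) * (1 + w ^ 2)⁻¹ :=
          integral_mono (hdi z).abs (integrable_inv_one_add_sq.const_mul _) hpt
      _ = 3 * C * π * z := by rw [integral_const_mul, integral_univ_inv_one_add_sq]; ring
      _ ≤ (2 * N + 3 * C * π) * z := by gcongr; linarith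
  · rw [min_eq_right h, mul_one]
    calc ∫ w, |G α 1 s w - G α 1 s (w - z)| ≤ ∫ w, (|G α 1 s w| + |G α 1 s (w - z)|) :=
          integral_mono (hdi z).abs (i1.abs.add (i1.comp_sub_right z).abs) fun w => abs_sub _ _
      _ = N + N := by
          rw [integral_add i1.abs (i1.comp_sub_right z).abs,
            integral_sub_right_eq_self (fun w => |G α 1 s w|) z]
      _ ≤ _ := by
          have : 0 ≤ 3 * C * π := by positivity
          linarith

/-- The generator commutes with convolution. Fubini is licensed by the `L¹` modulus of the kernel,
which tames the singularity at `z = 0`. -/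
lemma conv_eq_marchaud (h0 : 0 < α) (h1 : α < 1) (hs : 0 < s) (hg : Continuous g)
    (hC : ∀ y, |g y| ≤ C) (x : ℝ) : conv α (α + 1) s g x = marchaud α (conv α 1 s g) x := by
  have hC0 : 0 ≤ C := (abs_nonneg _).trans (hC 0)
  obtain ⟨D, hD0, hD⟩ := integral_abs_G_sub_le h0 h1 hs
  have hGc : Continuous (G α 1 s) := continuous_G h0 h1 (by norm_num) hs
  set k : ℝ → ℝ → ℝ := fun y z =>
    (G α 1 s (x - y) - G α 1 s (x - y - z)) * z ^ (-α - 1) * g y with hk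
  have i1 := integrable_G (q := 1) h0 h1 (Or.inr le_rfl) hs
  have hmeas : AEStronglyMeasurable (Function.uncurry k)
      (volume.prod (volume.restrict (Ioi (0 : ℝ)))) := by
    refine AEStronglyMeasurable.mul (AEStronglyMeasurable.mul ?_ ?_) ?_
    · exact Continuous.aestronglyMeasurable (by fun_prop)
    · have : ContinuousOn (fun z : ℝ => z ^ (-α - 1)) (Ioi 0) :=
        continuousOn_id.rpow_const fun z hz => Or.inl (ne_of_gt hz)
      exact (this.aestronglyMeasurable measurableSet_Ioi).comp_snd
    · exact Continuous.aestronglyMeasurable (by fun_prop)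
  have hdi : ∀ z, Integrable fun y => G α 1 s (x - y) - G α 1 s (x - y - z) := fun z =>
    (i1.sub (i1.comp_sub_right z)).comp_sub_left x
  have hInt : Integrable (Function.uncurry k) (volume.prod (volume.restrict (Ioi (0 : ℝ)))) := by
    rw [integrable_prod_iff' hmeas]
    constructor
    · refine Eventually.of_forall fun z => ?_
      exact ((hdi z).mul_const (z ^ (-α - 1))).mul_bdd (c := C) hg.aestronglyMeasurable
        (Eventually.of_forall hC)
    · refine ((integrableOn_min_mul_rpow h0 h1).const_mul (D * C)).mono'
        hmeas.norm.prod_swap.integral_prod_right' ?_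
      filter_upwards [ae_restrict_mem measurableSet_Ioi] with z hz
      have hz0 : (0 : ℝ) < z := hz
      rw [Real.norm_of_nonneg (integral_nonneg fun _ => norm_nonneg _)]
      calc ∫ y, ‖Function.uncurry k (y, z)‖
          ≤ ∫ y, |G α 1 s (x - y) - G α 1 s (x - y - z)| * (z ^ (-α - 1) * C) := by
            refine integral_mono_of_nonneg (Eventually.of_forall fun _ => norm_nonneg _)
              ((hdi z).abs.mul_const _) (Eventually.of_forall fun y => ?_)
            simp only [Function.uncurry, hk]
            rw [norm_mul, norm_mul, Real.norm_eq_abs, Real.norm_of_nonneg (by positivity),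
              mul_assoc]
            gcongr
            exact hC y
        _ = (∫ w, |G α 1 s w - G α 1 s (w - z)|) * (z ^ (-α - 1) * C) := by
            rw [integral_mul_const, integral_sub_left_eq_self
              (fun w => |G α 1 s w - G α 1 s (w - z)|) volume x]
        _ ≤ D * min z 1 * (z ^ (-α - 1) * C) := by gcongr; exact hD z hz0
        _ = _ := by ring
  have e1 : conv α (α + 1) s g x = (Real.Gamma (1 - α))⁻¹ * (α *
      ∫ y, ∫ z in Ioi (0 : ℝ), k y z) := by
    unfold conv
    rw [← integral_const_mul, ← integral_const_mul]
    refine integral_congr_ae (Eventually.of_forall fun y => ?_)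
    simp only [hk]
    rw [← marchaud_G h0 h1 hs, integral_mul_const]
    unfold marchaud
    ring
  rw [e1, integral_integral_swap hInt]
  unfold marchaud
  congr 2
  refine integral_congr_ae (Eventually.of_forall fun z => ?_)
  simp only [hk]
  unfold conv
  rw [← integral_sub (integrable_G_mul h0 h1 (Or.inr le_rfl) hs hg.aestronglyMeasurable hC x)
    (integrable_G_mul h0 h1 (Or.inr le_rfl) hs hg.aestronglyMeasurable hC (x - z)),
    ← integral_mul_const]
  refine integral_congr_ae (Eventually.of_forall fun y => ?_)
  simp only
  rw [sub_right_comm x y z]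
  ring

/-- Moving the derivative onto a smooth function removes the `t^{-1/(α+1)}` singularity, which is
what makes limits at time zero accessible. -/
lemma conv_one_eq (h0 : 0 < α) (h1 : α < 1) (hs : 0 < s) (hg : ∀ y, HasDerivAt g (g' y) y)
    (hg' : Continuous g') (hC : ∀ y, |g y| ≤ C) (hC' : ∀ y, |g' y| ≤ C) (x : ℝ) :
    conv α 1 s g x = conv α 0 s g' x := by
  have hgc : Continuous g := continuous_iff_continuousAt.2 fun y => (hg y).continuousAt
  have h2 := integral_mul_deriv_eq_deriv_mul_of_integrable (A := ℝ)
    (u := fun y => G α 0 s (x - y)) (u' := fun y => -G α 1 s (x - y)) (v := g) (v' := g')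
    (fun y _ => ?_) (fun y _ => hg y)
    (integrable_G_mul h0 h1 (Or.inl rfl) hs hg'.aestronglyMeasurable hC' x) ?_
    (integrable_G_mul h0 h1 (Or.inl rfl) hs hgc.aestronglyMeasurable hC x)
  · unfold conv
    rw [h2, ← integral_neg]
    refine integral_congr_ae (Eventually.of_forall fun y => ?_)
    simp
  · have h3 := hasDerivAt_G_space (q := 0) (x := x - y) h0 h1 (by norm_num) hs
    rw [zero_add] at h3
    have := h3.comp y ((hasDerivAt_id y).const_sub x)
    simpa [Function.comp_def] using this
  · refine (integrable_G_mul h0 h1 (Or.inr le_rfl) hs hgc.aestronglyMeasurable hC x).neg.congr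
      (Eventually.of_forall fun y => ?_)
    simp

lemma hasDerivAt_conv_time (h0 : 0 < α) (h1 : α < 1) (hs : 0 < s) (hg : Continuous g)
    (hC : ∀ y, |g y| ≤ C) (x : ℝ) :
    HasDerivAt (fun r => conv α 0 r g x) (conv α (α + 1) s g x) s := by
  have hC0 : 0 ≤ C := (abs_nonneg _).trans (hC 0)
  obtain ⟨D, hD0, hD⟩ := G_decay (q := α + 1) (b := 2 * s) h0 h1 (Or.inr (by linarith))
    (half_pos hs)
  have hpos : ∀ r ∈ Ioo (s / 2) (2 * s), 0 < r := fun r hr => by linarith [hr.1]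
  refine (hasDerivAt_integral_of_dominated_loc_of_deriv_le (𝕜 := ℝ)
    (F := fun r y => G α 0 r (x - y) * g y) (F' := fun r y => G α (α + 1) r (x - y) * g y)
    (bound := fun y => D * (1 + (x - y) ^ 2)⁻¹ * C) (s := Ioo (s / 2) (2 * s))
    (Ioo_mem_nhds (by linarith) (by linarith)) ?_
    (integrable_G_mul h0 h1 (Or.inl rfl) hs hg.aestronglyMeasurable hC x)
    (integrable_G_mul h0 h1 (Or.inr (by linarith)) hs hg.aestronglyMeasurable
      hC x).aestronglyMeasurable ?_ ?_ ?_).2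
  · filter_upwards [Ioi_mem_nhds hs] with r hr
    exact (integrable_G_mul h0 h1 (Or.inl rfl) hr hg.aestronglyMeasurable hC x).aestronglyMeasurable
  · refine Eventually.of_forall fun y r hr => ?_
    rw [norm_mul, Real.norm_eq_abs, Real.norm_eq_abs]
    exact mul_le_mul (hD r _ hr.1.le hr.2.le) (hC y) (abs_nonneg _) (by positivity)
  · exact ((integrable_inv_one_add_sq.comp_sub_left x).const_mul D).mul_const C
  · refine Eventually.of_forall fun y r hr => ?_
    have := hasDerivAt_G_time (q := 0) (x := x - y) h0 h1 (by norm_num) (hpos r hr)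
    rw [zero_add] at this
    exact this.mul_const _

/-- Approximation of the identity, for varying functions. -/
lemma tendsto_conv {ι : Type*} {l : Filter ι} [l.IsCountablyGenerated] (h0 : 0 < α) (h1 : α < 1)
    {τ : ι → ℝ} {k : ι → ℝ → ℝ} {x c : ℝ} (hτ : ∀ᶠ i in l, 0 < τ i)
    (hk : ∀ᶠ i in l, AEStronglyMeasurable (k i)) (hC : ∀ᶠ i in l, ∀ y, |k i y| ≤ C)
    (hlim : ∀ z, Tendsto (fun i => k i (x - τ i ^ (1 / (α + 1)) * z)) l (𝓝 c)) :
    Tendsto (fun i => conv α 0 (τ i) (k i) x) l (𝓝 c) := by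
  have i0 := integrable_G (q := 0) h0 h1 (Or.inl rfl) one_pos
  have h2 : Tendsto (fun i => ∫ z, G α 0 1 z * k i (x - τ i ^ (1 / (α + 1)) * z)) l
      (𝓝 (∫ z, G α 0 1 z * c)) := by
    refine tendsto_integral_filter_of_dominated_convergence (fun z => |G α 0 1 z| * C) ?_ ?_
      (i0.abs.mul_const C) (Eventually.of_forall fun z => (hlim z).const_mul _)
    · filter_upwards [hτ, hk] with i hi hki
      exact i0.aestronglyMeasurable.mul (aestronglyMeasurable_comp_sub_mul hki x (by positivity))
    · filter_upwards [hC] with i hi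
      refine Eventually.of_forall fun z => ?_
      rw [norm_mul, Real.norm_eq_abs]
      exact mul_le_mul_of_nonneg_left (hi _) (abs_nonneg _)
  rw [integral_mul_const, integral_G_zero h0 h1 one_pos, one_mul] at h2
  refine h2.congr' ?_
  filter_upwards [hτ] with i hi
  rw [conv_scaled h0 hi, zero_div, neg_zero, Real.rpow_zero, one_mul]

lemma tendsto_rpow_inv_zero (h0 : 0 < α) :
    Tendsto (fun s : ℝ => s ^ (1 / (α + 1))) (𝓝[>] 0) (𝓝 0) := by
  have hp : 0 < 1 / (α + 1) := by positivity
  have h3 := (Real.continuousAt_rpow_const 0 (1 / (α + 1)) (Or.inr hp.le)).tendsto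
  rw [Real.zero_rpow hp.ne'] at h3
  exact h3.mono_left nhdsWithin_le_nhds

lemma tendsto_conv_zero (h0 : 0 < α) (h1 : α < 1) (hg : Continuous g) (hC : ∀ y, |g y| ≤ C)
    (x : ℝ) : Tendsto (fun s => conv α 0 s g x) (𝓝[>] 0) (𝓝 (g x)) := by
  refine tendsto_conv (C := C) h0 h1 self_mem_nhdsWithin
    (Eventually.of_forall fun _ => hg.aestronglyMeasurable) (Eventually.of_forall fun _ => hC)
    fun z => ?_
  refine (hg.tendsto x).comp ?_
  simpa using ((tendsto_rpow_inv_zero h0).mul_const z).const_sub x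

lemma abs_conv_sub_le (h0 : 0 < α) (h1 : α < 1) (hs : 0 < s) (hg : Continuous g)
    (hC : ∀ y, |g y| ≤ C) {L : ℝ} (x x' : ℝ) (hL : ∀ r, |g (x - r) - g (x' - r)| ≤ L) :
    |conv α 0 s g x - conv α 0 s g x'| ≤ kerNorm α 0 * L := by
  have h2 : conv α 0 s g x - conv α 0 s g x' =
      conv α 0 s (fun y => g y - g (x' - (x - y))) x := by
    have h3 : conv α 0 s g x' = conv α 0 s (fun y => g (x' - (x - y))) x := by
      unfold conv
      rw [← integral_sub_left_eq_self (fun y => G α 0 s (x' - y) * g y) volume x',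
        ← integral_sub_left_eq_self (fun y => G α 0 s (x - y) * g (x' - (x - y))) volume x]
      simp
    rw [h3]
    exact (conv_sub h0 h1 (Or.inl rfl) hs hg.aestronglyMeasurable hC
      (Continuous.aestronglyMeasurable (by fun_prop)) (fun y => hC _) x).symm
  rw [h2]
  have h4 := abs_conv_le (q := 0) (C := L) h0 h1 (Or.inl rfl) hs
    (g := fun y => g y - g (x' - (x - y))) (fun y => by
      have := hL (x - y)
      rwa [sub_sub_cancel] at this) x
  simpa using h4

/-- Write the order `α + 1` as a Marchaud derivative of order-one convolution, then move that
derivative to `g'`. The smoothed increments converge and inherit the bound `min z 1` uniformly in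
time. -/
lemma tendsto_conv_generator (h0 : 0 < α) (h1 : α < 1) {g'' : ℝ → ℝ} (hg : BddDerivs C g g' g'')
    (x : ℝ) : Tendsto (fun s => conv α (α + 1) s g x) (𝓝[>] 0) (𝓝 (marchaud α g' x)) := by
  have hgc : Continuous g := continuous_iff_continuousAt.2 fun y => (hg.d1 y).continuousAt
  have hg'c : Continuous g' := continuous_iff_continuousAt.2 fun y => (hg.d2 y).continuousAt
  have hC0 : 0 ≤ C := (abs_nonneg _).trans (hg.b0 0)
  have h2 : Tendsto (fun s => marchaud α (conv α 0 s g') x) (𝓝[>] 0) (𝓝 (marchaud α g' x)) := by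
    unfold marchaud
    refine Tendsto.const_mul _ (Tendsto.const_mul _ ?_)
    refine tendsto_integral_filter_of_dominated_convergence
      (fun z => kerNorm α 0 * (2 * C) * (min z 1 * z ^ (-α - 1))) ?_ ?_
      ((integrableOn_min_mul_rpow h0 h1).const_mul _) ?_
    · filter_upwards [self_mem_nhdsWithin] with s hs
      have hcc : AEStronglyMeasurable (conv α 0 s g') :=
        aestronglyMeasurable_conv h0 h1 (by norm_num) hs hg'c.aestronglyMeasurable
      have hr : ContinuousOn (fun z : ℝ => z ^ (-α - 1)) (Ioi 0) :=
        continuousOn_id.rpow_const fun z hz => Or.inl (ne_of_gt hz)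
      refine AEStronglyMeasurable.mul (aestronglyMeasurable_const.sub ?_)
        (hr.aestronglyMeasurable measurableSet_Ioi)
      have := aestronglyMeasurable_comp_sub_mul hcc x one_pos
      simp only [one_mul] at this
      exact this.restrict
    · filter_upwards [self_mem_nhdsWithin] with s hs
      filter_upwards [ae_restrict_mem measurableSet_Ioi] with z hz
      have hz0 : (0 : ℝ) < z := hz
      rw [norm_mul, Real.norm_eq_abs, Real.norm_of_nonneg (by positivity), ← mul_assoc,
        mul_assoc (kerNorm α 0)]
      refine mul_le_mul_of_nonneg_right ?_ (by positivity)
      refine abs_conv_sub_le h0 h1 hs hg'c hg.b1 x (x - z) fun r => ?_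
      rcases le_total z 1 with h | h
      · rw [min_eq_left h]
        have h3 := abs_sub_le_of_deriv hg.d2 hg.b2 (x - r) (x - z - r)
        rw [show x - r - (x - z - r) = z by ring, abs_of_pos hz0] at h3
        nlinarith
      · rw [min_eq_right h, mul_one]
        exact (abs_sub _ _).trans (by linarith [hg.b1 (x - r), hg.b1 (x - z - r)])
    · refine Eventually.of_forall fun z => Tendsto.mul_const _ (Tendsto.sub ?_ ?_) <;>
        exact tendsto_conv_zero h0 h1 hg'c hg.b1 _
  refine h2.congr' ?_
  filter_upwards [self_mem_nhdsWithin] with s hs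
  rw [conv_eq_marchaud h0 h1 hs hgc hg.b0]
  congr 1
  ext y
  exact (conv_one_eq h0 h1 hs hg.d1 hg'c hg.b0 hg.b1 y).symm

/-- Right derivative at time zero of the linear evolution. -/
lemma tendsto_conv_slope (h0 : 0 < α) (h1 : α < 1) {g'' : ℝ → ℝ} (hg : BddDerivs C g g' g'')
    (x : ℝ) : Tendsto (fun h => (conv α 0 h g x - g x) / h) (𝓝[>] 0) (𝓝 (marchaud α g' x)) := by
  have hgc : Continuous g := continuous_iff_continuousAt.2 fun y => (hg.d1 y).continuousAt
  -- The convolution at time zero is not `g`, so the initial value is inserted by hand. The right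
  -- derivative at zero is then the limit of derivatives at positive times.
  set φ : ℝ → ℝ := fun h => if 0 < h then conv α 0 h g x else g x with hφ
  have heq : ∀ h, 0 < h → φ h = conv α 0 h g x := fun h hh => if_pos hh
  have hd : ∀ s, 0 < s → HasDerivAt φ (conv α (α + 1) s g x) s := fun s hs =>
    (hasDerivAt_conv_time h0 h1 hs hgc hg.b0 x).congr_of_eventuallyEq (by
      filter_upwards [Ioi_mem_nhds hs] with r hr using heq r hr)
  have hφ0 : φ 0 = g x := if_neg (lt_irrefl _)
  have hdw : HasDerivWithinAt φ (marchaud α g' x) (Ici 0) 0 := by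
    refine hasDerivWithinAt_Ici_of_tendsto_deriv (s := Ioi 0)
      (fun s hs => (hd s hs).differentiableAt.differentiableWithinAt) ?_ self_mem_nhdsWithin ?_
    · have := tendsto_conv_zero h0 h1 hgc hg.b0 x
      rw [ContinuousWithinAt, hφ0]
      refine this.congr' ?_
      filter_upwards [self_mem_nhdsWithin] with h hh using (heq h hh).symm
    · refine (tendsto_conv_generator h0 h1 hg x).congr' ?_
      filter_upwards [self_mem_nhdsWithin] with s hs using (hd s hs).deriv.symm
  have h2 := (hasDerivWithinAt_iff_tendsto_slope' (s := Ioi 0) (by simp)).1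
    (hdw.mono Ioi_subset_Ici_self)
  refine h2.congr' ?_
  filter_upwards [self_mem_nhdsWithin] with h hh
  rw [slope_def_field, hφ0, heq h hh, sub_zero]

end Generator

/-! ### From the Duhamel formula to the differential equation -/

section Classical

variable {α C : ℝ} {F Fx : ℝ → ℝ → ℝ}

/-- After integration by parts the quotient is an average over `τ ∈ (0, h)` of `K(τ)` convolved with
`∂ₓF(h - τ)`. Both times tend to zero, so the integrand is uniformly close to the limit. -/
lemma tendsto_src_slope (h0 : 0 < α) (h1 : α < 1) (hF : Measurable (Function.uncurry F))
    (hC : ∀ s y, |F s y| ≤ C) {ε : ℝ} (hε : 0 < ε)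
    (hd : ∀ s ∈ Ioo 0 ε, ∀ y, HasDerivAt (F s) (Fx s y) y)
    (hc : ∀ s ∈ Ioo 0 ε, Continuous (Fx s)) (hCx : ∀ s ∈ Ioo 0 ε, ∀ y, |Fx s y| ≤ C) {x c : ℝ}
    (hlim : Tendsto (Function.uncurry Fx) (𝓝[>] 0 ×ˢ 𝓝 x) (𝓝 c)) :
    Tendsto (fun h => src α F h x / h) (𝓝[>] 0) (𝓝 c) := by
  have hmem : ∀ᶠ p in (𝓝[>] (0 : ℝ)) ×ˢ (𝓝[>] (0 : ℝ)), p.2 ∈ Ioo 0 ε :=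
    tendsto_snd.eventually (Ioo_mem_nhdsGT hε)
  -- Treating elapsed time and source time as independent small variables gives uniformity over all
  -- `τ` in `(0, h)`.
  have h2 : Tendsto (fun p : ℝ × ℝ => conv α 0 p.1 (Fx p.2) x) (𝓝[>] 0 ×ˢ 𝓝[>] 0) (𝓝 c) := by
    refine tendsto_conv (C := C) h0 h1 (tendsto_fst.eventually self_mem_nhdsWithin) ?_ ?_
      fun z => ?_
    · filter_upwards [hmem] with p hp using (hc _ hp).aestronglyMeasurable
    · filter_upwards [hmem] with p hp using hCx _ hp
    · refine hlim.comp (tendsto_snd.prodMk ?_)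
      have := (((tendsto_rpow_inv_zero h0).mul_const z).const_sub x).comp
        (tendsto_fst (f := 𝓝[>] (0 : ℝ)) (g := 𝓝[>] (0 : ℝ)))
      simpa [Function.comp_def] using this
  rw [Metric.tendsto_nhds]
  intro κ hκ
  have h3 := Metric.tendsto_nhds.1 h2 (κ / 2) (half_pos hκ)
  obtain ⟨a, ha, b, hb, hab⟩ := mem_prod_iff.1 h3
  obtain ⟨δ₁, hδ₁, hs₁⟩ := mem_nhdsGT_iff_exists_Ioo_subset.1 ha
  obtain ⟨δ₂, hδ₂, hs₂⟩ := mem_nhdsGT_iff_exists_Ioo_subset.1 hb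
  filter_upwards [Ioo_mem_nhdsGT hε, Ioo_mem_nhdsGT hδ₁, Ioo_mem_nhdsGT hδ₂] with h hhε hh₁ hh₂
  have hh : 0 < h := hhε.1
  have hInt := integrableOn_conv h0 h1 hF hC h x
  have hcint : IntegrableOn (fun _ : ℝ => c) (Ioo 0 h) := by
    rw [integrableOn_const_iff]; right; simp
  have e1 : src α F h x - h * c = ∫ τ in Ioo 0 h, (conv α 1 τ (F (h - τ)) x - c) := by
    rw [src_eq hh.le, integral_sub hInt hcint]
    simp [hh.le]
  have e2 : |src α F h x - h * c| ≤ κ / 2 * h := by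
    rw [e1, ← Real.norm_eq_abs]
    have := norm_setIntegral_le_of_norm_le_const (μ := volume) (s := Ioo 0 h) (C := κ / 2)
      (f := fun τ => conv α 1 τ (F (h - τ)) x - c) (by simp) (fun τ hτ => ?_)
    · simpa [hh.le] using this
    · have hm : h - τ ∈ Ioo 0 h := ⟨by linarith [hτ.2], by linarith [hτ.1]⟩
      have hm' : h - τ ∈ Ioo 0 ε := ⟨hm.1, hm.2.trans hhε.2⟩
      rw [conv_one_eq h0 h1 hτ.1 (hd _ hm') (hc _ hm') (hC _) (hCx _ hm') x]
      have := hab (mk_mem_prod (hs₁ ⟨hτ.1, hτ.2.trans hh₁.2⟩) (hs₂ ⟨hm.1, hm.2.trans hh₂.2⟩))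
      exact le_of_lt this
  rw [Real.dist_eq]
  have e3 : src α F h x / h - c = (src α F h x - h * c) / h := by field_simp
  rw [e3, abs_div, abs_of_pos hh, div_lt_iff₀ hh]
  nlinarith

/-- A smooth function satisfying the restarted Duhamel formula solves the equation. -/
theorem solves_at_of_restart (h0 : 0 < α) (h1 : α < 1) {f : ℝ → ℝ} (hf : ContDiff ℝ ∞ f)
    {u : ℝ → ℝ → ℝ} {δ : ℝ} {T : EReal} (hu : CbOn 2 (strip δ T) (Function.uncurry u)) {t : ℝ}
    (ht : t ∈ timeIoo δ T) (hm : Measurable (Function.uncurry fun s y => f (u (t + s) y)))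
    (hC : ∀ y, |f y| ≤ C)
    (hmild : ∀ h, 0 < h → ∀ x, u (t + h) x = conv α 0 h (u t) x -
      src α (fun s y => f (u (t + s) y)) h x) (x : ℝ) :
    deriv (fun s => u s x) t + deriv (fun y => f (u t y)) x = deriv (fracDer α (u t)) x := by
  obtain ⟨B, ux, hB0, hux, hsl⟩ := hu.slices
  obtain ⟨⟨g'', hg⟩, hdt⟩ := hsl t ht
  have hfd : Differentiable ℝ f := hf.differentiable (by simp)
  have hf' : Continuous (deriv f) := hf.continuous_deriv (by simp)
  obtain ⟨A, hA⟩ := (isCompact_Icc (a := -B) (b := B)).exists_bound_of_continuousOn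
    hf'.continuousOn
  have hA0 : 0 ≤ A := (norm_nonneg _).trans (hA 0 ⟨by linarith, hB0⟩)
  obtain ⟨ε, hε, hball⟩ := Metric.isOpen_iff.1 (isOpen_timeIoo δ T) t ht
  have hmem : ∀ s ∈ Ioo 0 ε, t + s ∈ timeIoo δ T := fun s hs => hball (by
    rw [Metric.mem_ball, Real.dist_eq, add_sub_cancel_left, abs_of_pos hs.1]; exact hs.2)
  have hchain : ∀ s ∈ timeIoo δ T, ∀ y,
      HasDerivAt (fun y => f (u s y)) (deriv f (u s y) * ux s y) y := fun s hs y => by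
    obtain ⟨⟨_, hgs⟩, -⟩ := hsl s hs
    exact (hfd _).hasDerivAt.comp y (hgs.d1 y)
  have hopen := isOpen_strip δ T
  have hshift : Tendsto (fun p : ℝ × ℝ => (t + p.1, p.2)) (𝓝[>] 0 ×ˢ 𝓝 x) (𝓝 (t, x)) := by
    have h2 : Tendsto (fun p : ℝ × ℝ => (t + p.1, p.2)) (𝓝 (0, x)) (𝓝 (t + 0, x)) :=
      Continuous.tendsto (by fun_prop) _
    rw [add_zero, nhds_prod_eq] at h2
    exact h2.mono_left (prod_mono_left _ nhdsWithin_le_nhds)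
  have hp : (t, x) ∈ strip δ T := ⟨ht, mem_univ _⟩
  have hsrc := tendsto_src_slope (x := x) (C := max C (A * B)) (c := deriv f (u t x) * ux t x)
    (F := fun s y => f (u (t + s) y))
    (Fx := fun s y => deriv f (u (t + s) y) * ux (t + s) y) h0 h1 hm
    (fun s y => (hC _).trans (le_max_left _ _)) hε (fun s hs y => hchain _ (hmem s hs) y)
    (fun s hs => by
      obtain ⟨⟨_, hgs⟩, -⟩ := hsl _ (hmem s hs)
      have c1 : Continuous (u (t + s)) :=
        continuous_iff_continuousAt.2 fun y => (hgs.d1 y).continuousAt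
      have c2 : Continuous (ux (t + s)) :=
        continuous_iff_continuousAt.2 fun y => (hgs.d2 y).continuousAt
      fun_prop)
    (fun s hs y => by
      obtain ⟨⟨_, hgs⟩, -⟩ := hsl _ (hmem s hs)
      rw [abs_mul]
      exact (mul_le_mul (hA _ (abs_le.1 (hgs.b0 y))) (hgs.b1 y) (abs_nonneg _) hA0).trans
        (le_max_right _ _))
    (by
      have c1 : ContinuousAt (Function.uncurry u) (t, x) :=
        hu.1.continuousOn.continuousAt (hopen.mem_nhds hp)
      have c2 : ContinuousAt (Function.uncurry ux) (t, x) :=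
        hux.continuousAt (hopen.mem_nhds hp)
      have c3 : ContinuousAt (fun p : ℝ × ℝ => deriv f (Function.uncurry u p) *
          Function.uncurry ux p) (t, x) := (hf'.continuousAt.comp c1).mul c2
      exact c3.tendsto.comp hshift)
  have hconv := tendsto_conv_slope h0 h1 hg x
  have htime := (hdt x).hasDerivAt.tendsto_slope_zero_right
  -- Time differentiability is already known, so computing the right derivative is enough.
  have hlim : Tendsto (fun h : ℝ => h⁻¹ • (u (t + h) x - u t x)) (𝓝[>] 0)
      (𝓝 (marchaud α (ux t) x - deriv f (u t x) * ux t x)) := by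
    refine (hconv.sub hsrc).congr' ?_
    filter_upwards [self_mem_nhdsWithin] with h hh
    rw [hmild h hh x, smul_eq_mul]
    ring
  have := tendsto_nhds_unique htime hlim
  rw [deriv_fracDer h0 h1 hg.d1 hg.d2 hg.b0 hg.b1 hg.b2, (hchain t ht x).deriv, this]
  ring

end Classical

/-! ### Bounds, restarts and global regularity of mild solutions -/

section Global

variable {α : ℝ} {f u₀ : ℝ → ℝ} {u : ℝ → ℝ → ℝ} {M Cf : ℝ}

lemma src_congr {F F' : ℝ → ℝ → ℝ} {t : ℝ} (ht : 0 ≤ t) (h : ∀ s ∈ Ioo 0 t, ∀ y, F s y = F' s y)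
    (x : ℝ) : src α F t x = src α F' t x := by
  rw [src_eq ht, src_eq ht]
  refine setIntegral_congr_fun measurableSet_Ioo fun τ hτ => ?_
  have : F (t - τ) = F' (t - τ) := funext (h _ ⟨by linarith [hτ.2], by linarith [hτ.1]⟩)
  simp only [this]

lemma measurable_of_continuousOn {w : ℝ × ℝ → ℝ} {U : Set (ℝ × ℝ)} (hU : IsOpen U)
    (hc : ContinuousOn w U) (hz : ∀ p ∉ U, w p = 0) : Measurable w := by
  classical
  have h2 : U.piecewise w (fun _ => 0) = w := by
    ext p
    by_cases hp : p ∈ U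
    · simp [hp]
    · simp [hp, hz p hp]
  rw [← h2]
  exact hc.measurable_piecewise continuousOn_const hU.measurableSet

lemma GlobalMild.measurable (hu : GlobalMild α f u₀ u) : Measurable (Function.uncurry u) := by
  refine measurable_of_continuousOn (isOpen_Ioi.prod isOpen_univ) hu.cont fun p hp => ?_
  refine hu.zero _ ?_ _
  by_contra! h
  exact hp ⟨h, mem_univ _⟩

lemma GlobalMild.continuous_slice (hu : GlobalMild α f u₀ u) {t : ℝ} (ht : 0 < t) :
    Continuous (u t) := by
  have := hu.cont.comp_continuous (f := fun x : ℝ => (t, x)) (by fun_prop)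
    fun x => ⟨ht, mem_univ _⟩
  exact this

lemma GlobalMild.abs_le (h0 : 0 < α) (h1 : α < 1) (hu : GlobalMild α f u₀ u)
    (hM : ∀ y, |u₀ y| ≤ M) (hf : ∀ y, |f y| ≤ Cf) {t : ℝ} (x : ℝ) :
    |u t x| ≤ kerNorm α 0 * M + |t| ^ (1 - 1 / (α + 1)) / (1 - 1 / (α + 1)) *
      (kerNorm α 1 * Cf) := by
  have k0 := kerNorm_nonneg α 0
  have k1 := kerNorm_nonneg α 1
  have hM0 : 0 ≤ M := (abs_nonneg _).trans (hM 0)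
  have hC0 : 0 ≤ Cf := (abs_nonneg _).trans (hf 0)
  have hp := one_sub_pos h0
  rcases le_or_gt t 0 with ht | ht
  · rw [hu.zero t ht, abs_zero]
    positivity
  · rw [hu.eq t ht, abs_of_pos ht, ← integral_time h0 ht.le]
    refine (abs_sub _ _).trans (add_le_add ?_ (abs_src_le h0 h1 ht.le (fun s _ y => hf _) x))
    simpa using abs_conv_le (q := 0) h0 h1 (Or.inl rfl) ht hM x

lemma GlobalMild.bdd_of_le (h0 : 0 < α) (h1 : α < 1) (hu : GlobalMild α f u₀ u)
    (hM : ∀ y, |u₀ y| ≤ M) (hf : ∀ y, |f y| ≤ Cf) (R : ℝ) :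
    ∃ B, ∀ t ≤ R, ∀ x, |u t x| ≤ B := by
  refine ⟨_, fun t ht x => (?_ : _ ≤ kerNorm α 0 * M + |R| ^ (1 - 1 / (α + 1)) /
    (1 - 1 / (α + 1)) * (kerNorm α 1 * Cf))⟩
  have k0 := kerNorm_nonneg α 0
  have k1 := kerNorm_nonneg α 1
  have hM0 : 0 ≤ M := (abs_nonneg _).trans (hM 0)
  have hC0 : 0 ≤ Cf := (abs_nonneg _).trans (hf 0)
  have hp := one_sub_pos h0
  rcases le_or_gt t 0 with ht0 | ht0
  · rw [hu.zero t ht0, abs_zero]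
    positivity
  · refine (hu.abs_le h0 h1 hM hf x).trans ?_
    have : |t| ≤ |R| := abs_le_abs_of_nonneg ht0.le ht
    gcongr

lemma GlobalMild.restart_eq (h0 : 0 < α) (h1 : α < 1) (hu : GlobalMild α f u₀ u)
    (hm : AEStronglyMeasurable u₀) (hM : ∀ y, |u₀ y| ≤ M) (hfm : Measurable f)
    (hf : ∀ y, |f y| ≤ Cf) {t h : ℝ} (ht : 0 < t) (hh : 0 < h) (x : ℝ) :
    u (t + h) x = conv α 0 h (u t) x - src α (fun s y => f (u (t + s) y)) h x := by
  have hF : Measurable (Function.uncurry fun s y => f (u s y)) := hfm.comp hu.measurable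
  have h2 := restart h0 h1 hF (fun s y => hf _) hm hM ht hh x
  rw [hu.eq _ (add_pos ht hh), ← h2]
  congr 2
  exact funext fun y => (hu.eq t ht y).symm

/-- Restriction of a function to times after `a`, with time measured from `a`. -/
def shiftTime (a : ℝ) (u : ℝ → ℝ → ℝ) (t x : ℝ) : ℝ := if 0 < t then u (a + t) x else 0

/-- A time shift is again a solution by the restarted formula. The case `a = 0` is separate because
these solutions are set to zero at nonpositive times, so the datum is not their value at zero. -/
lemma GlobalMild.shift (h0 : 0 < α) (h1 : α < 1) (hu : GlobalMild α f u₀ u)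
    (hm : AEStronglyMeasurable u₀) (hM : ∀ y, |u₀ y| ≤ M) (hfm : Measurable f)
    (hf : ∀ y, |f y| ≤ Cf) {a : ℝ} (ha : 0 ≤ a) :
    GlobalMild α f (if a = 0 then u₀ else u a) (shiftTime a u) := by
  refine ⟨?_, fun t ht x => if_neg (not_lt.2 ht), fun t ht x => ?_⟩
  · have h2 : ContinuousOn (fun p : ℝ × ℝ => Function.uncurry u (a + p.1, p.2))
        (Ioi 0 ×ˢ univ) := by
      refine hu.cont.comp (by fun_prop) fun p hp => ⟨?_, mem_univ _⟩
      have : (0 : ℝ) < p.1 := hp.1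
      exact add_pos_of_nonneg_of_pos ha this
    refine h2.congr fun p hp => ?_
    exact if_pos hp.1
  · have e1 : src α (fun s y => f (shiftTime a u s y)) t x =
        src α (fun s y => f (u (a + s) y)) t x :=
      src_congr ht.le (fun s hs y => by simp only [shiftTime, if_pos hs.1]) x
    rw [e1, shiftTime, if_pos ht]
    split_ifs with h
    · subst h
      simp only [zero_add]
      exact hu.eq t ht x
    · exact hu.restart_eq h0 h1 hm hM hfm hf (lt_of_le_of_ne ha (Ne.symm h)) ht x

lemma iteratedFDeriv_shiftTime {a t : ℝ} (ht : 0 < t) (x : ℝ) (n : ℕ) :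
    iteratedFDeriv ℝ n (Function.uncurry (shiftTime a u)) (t, x) =
      iteratedFDeriv ℝ n (Function.uncurry u) (a + t, x) := by
  have h2 : Function.uncurry (shiftTime a u) =ᶠ[𝓝 (t, x)]
      fun p => Function.uncurry u (p + (a, 0)) := by
    filter_upwards [(isOpen_Ioi.prod isOpen_univ).mem_nhds
      (show (t, x) ∈ Ioi (0 : ℝ) ×ˢ univ from ⟨ht, mem_univ _⟩)] with p hp
    have : Function.uncurry (shiftTime a u) p = u (a + p.1) p.2 := if_pos hp.1
    rw [this]
    simp [Function.uncurry, add_comm]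
  rw [(h2.iteratedFDeriv ℝ n).eq_of_nhds, iteratedFDeriv_comp_add_right]
  simp [add_comm]

lemma contDiffAt_of_shiftTime {a t : ℝ} (ht : 0 < t) {x : ℝ}
    (h : ContDiffAt ℝ ∞ (Function.uncurry (shiftTime a u)) (t, x)) :
    ContDiffAt ℝ ∞ (Function.uncurry u) (a + t, x) := by
  have h2 : Function.uncurry u =ᶠ[𝓝 (a + t, x)]
      fun p => Function.uncurry (shiftTime a u) (p - (a, 0)) := by
    have hU : IsOpen {p : ℝ × ℝ | a < p.1} := isOpen_lt continuous_const continuous_fst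
    filter_upwards [hU.mem_nhds (show (a + t, x) ∈ {p : ℝ × ℝ | a < p.1} by simpa using ht)] with p hp
    have hp' : 0 < p.1 - a := sub_pos.2 hp
    simp [Function.uncurry, shiftTime, hp']
  refine ContDiffAt.congr_of_eventuallyEq ?_ h2
  have h3 : ContDiffAt ℝ ∞ (Function.uncurry (shiftTime a u)) ((a + t, x) - (a, 0)) := by
    simpa using h
  exact h3.comp (a + t, x) (contDiffAt_id.sub contDiffAt_const)

/-- The regularity step `r` depends on neither datum nor solution, and its constants are common to a
whole sequence. Feeding it all restarts at multiples of `r/2` covers every positive time with a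
single constant per order. -/
theorem GlobalMild.cbAwayFromZero (h0 : 0 < α) (h1 : α < 1) (hf : ContDiff ℝ ∞ f)
    (hs : HasCompactSupport f) (hu : GlobalMild α f u₀ u) (hm : AEStronglyMeasurable u₀)
    (hM : ∀ y, |u₀ y| ≤ M) {T : EReal} (hT : 0 < T) {B : ℝ}
    (hB : ∀ t : ℝ, ((t - 3 : ℝ) : EReal) < T → ∀ x, |u t x| ≤ B) : CbAwayFromZero ⊤ T u := by
  obtain ⟨Cf, hCf⟩ := hs.exists_bound_of_continuous hf.continuous
  obtain ⟨r, hr0, hr1, hreg⟩ := regularity h0 h1 hf hs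
  classical
  -- Restart times not below `T` are replaced by zero so that every member remains controlled. The
  -- margin in `hB` covers the extra time used by each restart.
  set e : ℕ → ℝ := fun i => if ((i * (r / 2) : ℝ) : EReal) < T then i * (r / 2) else 0 with he
  have he0 : ∀ i, 0 ≤ e i := fun i => by
    simp only [he]; split_ifs
    · positivity
    · exact le_rfl
  have heT : ∀ i, (e i : EReal) < T := fun i => by
    simp only [he]; split_ifs with h
    · exact h
    · simpa using hT
  have hbd : ∀ i y, |(if e i = 0 then u₀ else u (e i)) y| ≤ max M B := by
    intro i y
    split_ifs with h
    · exact (hM y).trans (le_max_left _ _)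
    · refine (hB _ (lt_of_le_of_lt ?_ (heT i)) y).trans (le_max_right _ _)
      exact EReal.coe_le_coe_iff.2 (by linarith)
  have hB0 : 0 ≤ B := (abs_nonneg _).trans (hB 0 (lt_of_le_of_lt
    (EReal.coe_le_coe_iff.2 (by norm_num : (0 - 3 : ℝ) ≤ 0)) (by simpa using hT)) 0)
  obtain ⟨hcd, hder⟩ := hreg (fun i => if e i = 0 then u₀ else u (e i))
    (fun i => shiftTime (e i) u) (max M B) B (fun i => by
      split_ifs with h
      · exact hm
      · exact (hu.continuous_slice (lt_of_le_of_ne (he0 i) (Ne.symm h))).aestronglyMeasurable)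
    hbd (fun i => hu.shift h0 h1 hm hM hf.continuous.measurable hCf (he0 i)) (fun i t ht x => by
      simp only [shiftTime]
      split_ifs with h
      · refine hB _ (lt_of_le_of_lt ?_ (heT i)) x
        exact EReal.coe_le_coe_iff.2 (by linarith)
      · simpa using hB0)
  have hloc : ∀ δ : ℝ, 0 < δ → ∀ t ∈ timeIoo δ T, ∃ i, ∃ s ∈ Ioc 0 r, t = e i + s ∧
      min δ (r / 2) ≤ s := by
    intro δ hδ t ht
    rcases lt_or_ge t (r / 2) with h | h
    · refine ⟨0, t, ⟨hδ.trans ht.1, by linarith⟩, ?_, (min_le_left _ _).trans ht.1.le⟩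
      simp [he]
    · set k := ⌊t / (r / 2)⌋₊ with hk
      have hk1 : 1 ≤ k := Nat.le_floor (by
        rw [Nat.cast_one, one_le_div (by positivity)]; exact h)
      have hk2 : (k : ℝ) ≤ t / (r / 2) := Nat.floor_le (div_nonneg (hδ.trans ht.1).le (by positivity))
      have hk3 : t / (r / 2) < k + 1 := Nat.lt_floor_add_one _
      rw [le_div_iff₀ (by positivity)] at hk2
      rw [div_lt_iff₀ (by positivity)] at hk3
      have hcast : ((k - 1 : ℕ) : ℝ) = k - 1 := by rw [Nat.cast_sub hk1, Nat.cast_one]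
      have hei : e (k - 1) = (k - 1 : ℕ) * (r / 2) := by
        refine if_pos (lt_of_le_of_lt ?_ ht.2)
        refine EReal.coe_le_coe_iff.2 ?_
        rw [hcast]
        linarith
      refine ⟨k - 1, t - e (k - 1), ⟨?_, ?_⟩, by ring, (min_le_right _ _).trans ?_⟩ <;>
        rw [hei, hcast] <;> linarith
  intro δ hδ
  refine ⟨fun p hp => ?_, fun n _ => ?_⟩
  · obtain ⟨t, x⟩ := p
    obtain ⟨i, s, hs, rfl, -⟩ := hloc δ hδ t hp.1
    exact (contDiffAt_of_shiftTime hs.1 (hcd i s hs x)).contDiffWithinAt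
  · obtain ⟨C, hC0, hC⟩ := hder n
    refine ⟨C * (min δ (r / 2))⁻¹ ^ n, fun p hp => ?_⟩
    obtain ⟨t, x⟩ := p
    obtain ⟨i, s, hs, rfl, hle⟩ := hloc δ hδ t hp.1
    have h2 := hC i s hs x
    rw [iteratedFDeriv_shiftTime hs.1] at h2
    refine h2.trans ?_
    have : 0 < min δ (r / 2) := lt_min hδ (by positivity)
    have := hs.1
    gcongr

theorem GlobalMild.solvesEquation (h0 : 0 < α) (h1 : α < 1) (hf : ContDiff ℝ ∞ f)
    (hs : HasCompactSupport f) (hu : GlobalMild α f u₀ u) (hm : AEStronglyMeasurable u₀)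
    (hM : ∀ y, |u₀ y| ≤ M) (T : EReal) : SolvesEquation α f T u := by
  obtain ⟨Cf, hCf⟩ := hs.exists_bound_of_continuous hf.continuous
  intro t ht x
  have ht0 : 0 < t := ht.1
  obtain ⟨B, hB⟩ := hu.bdd_of_le h0 h1 hM hCf (t + 4)
  have hcb : CbAwayFromZero ⊤ ((t + 1 : ℝ) : EReal) u :=
    hu.cbAwayFromZero h0 h1 hf hs hm hM (EReal.coe_pos.2 (by linarith)) (B := B)
      fun r hr x => hB r (by linarith [EReal.coe_lt_coe_iff.1 hr]) x
  refine solves_at_of_restart (C := Cf) h0 h1 hf ((hcb (t / 2) (by linarith)).mono le_top)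
    ⟨by linarith, EReal.coe_lt_coe_iff.2 (by linarith)⟩ ?_ hCf
    (fun h hh x => hu.restart_eq h0 h1 hm hM hf.continuous.measurable hCf ht0 hh x) x
  have h2 : Measurable fun p : ℝ × ℝ => Function.uncurry u (t + p.1, p.2) :=
    hu.measurable.comp (by fun_prop)
  exact hf.continuous.measurable.comp h2

theorem GlobalMild.abs_le_of_abs_le (h0 : 0 < α) (h1 : α < 1) (hf : ContDiff ℝ ∞ f)
    (hs : HasCompactSupport f) (hu : GlobalMild α f u₀ u) (hm : AEStronglyMeasurable u₀)
    (hM : ∀ y, |u₀ y| ≤ M) {t' t N : ℝ} (ht' : 0 < t') (hlt : t' < t)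
    (hN : ∀ x, |u t' x| ≤ N) (x : ℝ) : |u t x| ≤ N := by
  obtain ⟨Cf, hCf⟩ := hs.exists_bound_of_continuous hf.continuous
  obtain ⟨B, hB⟩ := hu.bdd_of_le h0 h1 hM hCf (t + 4)
  have hcb : CbAwayFromZero ⊤ ((t + 1 : ℝ) : EReal) u :=
    hu.cbAwayFromZero h0 h1 hf hs hm hM (EReal.coe_pos.2 (by linarith)) (B := B)
      fun r hr x => hB r (by linarith [EReal.coe_lt_coe_iff.1 hr]) x
  exact abs_le_of_solvesEquation h0 h1 hf (fun δ hδ => (hcb δ hδ).mono le_top)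
    (hu.solvesEquation h0 h1 hf hs hm hM _) ht' hlt (EReal.coe_lt_coe_iff.2 (by linarith)) hN x

end Global

/-! ### Positivity of the kernel and the bound by the datum -/

section Positivity

variable {α C L : ℝ} {φ : ℝ → ℝ}

lemma tendsto_lipschitz_modulus (h0 : 0 < α) (h1 : α < 1) (hC : 0 ≤ C) (hL : 0 ≤ L) :
    Tendsto (fun t : ℝ => ∫ z, |G α 0 1 z| * min (2 * C) (L * (t ^ (1 / (α + 1)) * |z|)))
      (𝓝[>] 0) (𝓝 0) := by
  have i0 := integrable_G (q := 0) h0 h1 (Or.inl rfl) one_pos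
  have h2 := tendsto_integral_filter_of_dominated_convergence (μ := volume) (l := 𝓝[>] (0 : ℝ))
    (F := fun (t : ℝ) z => |G α 0 1 z| * min (2 * C) (L * (t ^ (1 / (α + 1)) * |z|)))
    (f := fun _ => 0) (fun z => |G α 0 1 z| * (2 * C)) ?_ ?_ (i0.abs.mul_const _) ?_
  · simpa using h2
  · refine Eventually.of_forall fun t => i0.abs.aestronglyMeasurable.mul ?_
    exact Continuous.aestronglyMeasurable (by fun_prop)
  · filter_upwards [self_mem_nhdsWithin] with t ht
    refine Eventually.of_forall fun z => ?_
    have ht0 : (0 : ℝ) < t := ht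
    rw [Real.norm_of_nonneg (by positivity)]
    gcongr
    exact min_le_left _ _
  · refine Eventually.of_forall fun z => ?_
    have h3 : Tendsto (fun t : ℝ => min (2 * C) (L * (t ^ (1 / (α + 1)) * |z|))) (𝓝[>] 0)
        (𝓝 (min (2 * C) (L * (0 * |z|)))) :=
      tendsto_const_nhds.min (((tendsto_rpow_inv_zero h0).mul_const _).const_mul L)
    have h4 := h3.const_mul |G α 0 1 z|
    have h5 : min (2 * C) (L * (0 * |z|)) = 0 := by
      rw [zero_mul, mul_zero, min_eq_right (by positivity)]
    rwa [h5, mul_zero] at h4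

lemma abs_conv_sub_self_le (h0 : 0 < α) (h1 : α < 1) (hc : Continuous φ) (hC : ∀ y, |φ y| ≤ C)
    (hL : ∀ y y', |φ y - φ y'| ≤ L * |y - y'|) {t : ℝ} (ht : 0 < t) (x : ℝ) :
    |conv α 0 t φ x - φ x| ≤
      ∫ z, |G α 0 1 z| * min (2 * C) (L * (t ^ (1 / (α + 1)) * |z|)) := by
  have i0 := integrable_G (q := 0) h0 h1 (Or.inl rfl) one_pos
  have hr : 0 < t ^ (1 / (α + 1)) := by positivity
  have e1 : conv α 0 t φ x - φ x =
      ∫ z, G α 0 1 z * (φ (x - t ^ (1 / (α + 1)) * z) - φ x) := by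
    have h2 : φ x = ∫ z, G α 0 1 z * φ x := by
      rw [integral_mul_const, integral_G_zero h0 h1 one_pos, one_mul]
    rw [conv_scaled h0 ht, zero_div, neg_zero, Real.rpow_zero, one_mul]
    conv_lhs => rw [h2]
    rw [← integral_sub (i0.mul_bdd (c := C) (Continuous.aestronglyMeasurable (by fun_prop))
      (Eventually.of_forall fun z => hC _)) (i0.mul_const _)]
    simp_rw [mul_sub]
  have hC0 : 0 ≤ C := (abs_nonneg _).trans (hC 0)
  have hL0 : 0 ≤ L := by simpa using (abs_nonneg _).trans (hL 1 0)
  rw [e1, ← Real.norm_eq_abs]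
  refine norm_integral_le_of_norm_le ?_ (Eventually.of_forall fun z => ?_)
  · refine (i0.abs.mul_const (2 * C)).mono' (i0.abs.aestronglyMeasurable.mul
      (Continuous.aestronglyMeasurable (by fun_prop))) (Eventually.of_forall fun z => ?_)
    rw [Real.norm_of_nonneg (by positivity)]
    gcongr
    exact min_le_left _ _
  · rw [norm_mul, Real.norm_eq_abs, Real.norm_eq_abs]
    gcongr
    refine le_min ((abs_sub _ _).trans (by linarith [hC x, hC (x - t ^ (1 / (α + 1)) * z)])) ?_
    refine (hL _ _).trans_eq ?_
    rw [sub_sub_cancel_left, abs_neg, abs_mul, abs_of_pos hr]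

/-- The linear flow is the solution with zero flux, so the maximum principle applies from any small
time. Lipschitz data are approached uniformly as that time tends to zero, so no prior knowledge of
the `L¹` norm of the kernel is needed. -/
lemma abs_conv_le_of_lipschitz (h0 : 0 < α) (h1 : α < 1) (hc : Continuous φ)
    (hC : ∀ y, |φ y| ≤ C) (hL : ∀ y y', |φ y - φ y'| ≤ L * |y - y'|) {t : ℝ} (ht : 0 < t) (x : ℝ) :
    |conv α 0 t φ x| ≤ C := by
  have hC0 : 0 ≤ C := (abs_nonneg _).trans (hC 0)
  have hL0 : 0 ≤ L := by simpa using (abs_nonneg _).trans (hL 1 0)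
  have hzero : HasCompactSupport (fun _ : ℝ => (0 : ℝ)) := HasCompactSupport.zero
  obtain ⟨u, hu⟩ := exists_globalMild (f := fun _ => 0) h0 h1 contDiff_const hzero
    hc.aestronglyMeasurable hC
  have heq : ∀ s, 0 < s → ∀ y, u s y = conv α 0 s φ y := fun s hs y => by
    rw [hu.eq s hs y]
    simp [src, conv]
  rw [← heq t ht]
  refine le_of_forall_pos_le_add fun η hη => ?_
  have h2 := (tendsto_lipschitz_modulus h0 h1 hC0 hL0).eventually (gt_mem_nhds hη)
  obtain ⟨t', ⟨ht', hlt⟩, hη'⟩ := (Filter.Eventually.and (Ioo_mem_nhdsGT ht) h2).exists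
  refine hu.abs_le_of_abs_le h0 h1 contDiff_const hzero hc.aestronglyMeasurable hC ht' hlt
    (fun y => ?_) x
  have h3 := abs_conv_sub_self_le h0 h1 hc hC hL ht' y
  rw [heq t' ht']
  have h4 := abs_add_le (conv α 0 t' φ y - φ y) (φ y)
  rw [sub_add_cancel] at h4
  linarith [hC y]

/-- The kernel is nonnegative. -/
lemma G_zero_nonneg (h0 : 0 < α) (h1 : α < 1) {t : ℝ} (ht : 0 < t) (y₀ : ℝ) :
    0 ≤ G α 0 t y₀ := by
  by_contra! hneg
  have hc := continuous_G (q := 0) h0 h1 (by norm_num) ht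
  obtain ⟨r, hr, hball⟩ := Metric.isOpen_iff.1 (isOpen_lt hc continuous_const) y₀ hneg
  -- A tent supported in a ball on which the kernel is supposed negative.
  set b : ℝ → ℝ := fun y => max (1 - |y - y₀| / r) 0 with hb
  have hbc : Continuous b := by fun_prop
  have hb0 : ∀ y, 0 ≤ b y := fun y => le_max_right _ _
  have hb1 : ∀ y, b y ≤ 1 := fun y => max_le (by
    have : 0 ≤ |y - y₀| / r := by positivity
    linarith) zero_le_one
  have i0 := integrable_G (q := 0) h0 h1 (Or.inl rfl) ht
  have i1 : Integrable fun y => G α 0 t y * b y :=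
    i0.mul_bdd (c := 1) hbc.aestronglyMeasurable (Eventually.of_forall fun y => by
      rw [Real.norm_of_nonneg (hb0 y)]; exact hb1 y)
  have hle : ∀ y, 0 ≤ -(G α 0 t y * b y) := by
    intro y
    rcases lt_or_ge |y - y₀| r with h | h
    · have h2 : G α 0 t y < 0 := hball (by rwa [Metric.mem_ball, Real.dist_eq])
      have := hb0 y
      nlinarith
    · have h2 : b y = 0 := max_eq_right (by
        have : 1 ≤ |y - y₀| / r := by rwa [one_le_div hr]
        linarith)
      simp [h2]
  have hpos : 0 < ∫ y, -(G α 0 t y * b y) := by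
    refine lt_of_le_of_ne (integral_nonneg hle) fun h => ?_
    have h2 := (integral_eq_zero_iff_of_nonneg hle i1.neg).1 h.symm
    have h3 := (Continuous.ae_eq_iff_eq volume (by fun_prop) continuous_zero).1 h2
    have h4 := congrFun h3 y₀
    have h5 : b y₀ = 1 := by simp [hb]
    rw [h5, Pi.zero_apply] at h4
    linarith
  -- The datum `1 - 2b` has modulus at most one. Since the kernel has mass one, the value of its
  -- convolution at the origin would exceed one. The reflection of `b` matches the argument of the
  -- convolution.
  have h2 := abs_conv_le_of_lipschitz (φ := fun y => 1 - 2 * b (-y)) (C := 1) (L := 2 / r) h0 h1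
    (by fun_prop) (fun y => by
      rw [abs_le]; constructor <;> linarith [hb0 (-y), hb1 (-y)]) (fun y y' => by
      have h3 : 1 - 2 * b (-y) - (1 - 2 * b (-y')) = -(2 * (b (-y) - b (-y'))) := by ring
      rw [h3, abs_neg, abs_mul, abs_two]
      have h4 : |b (-y) - b (-y')| ≤ |y - y'| / r := by
        refine (abs_max_sub_max_le_abs _ _ _).trans ?_
        rw [sub_sub_sub_cancel_left, ← sub_div, abs_div, abs_of_pos hr]
        refine div_le_div_of_nonneg_right ?_ hr.le
        refine (abs_abs_sub_abs_le _ _).trans_eq ?_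
        congr 1
        ring
      calc 2 * |b (-y) - b (-y')| ≤ 2 * (|y - y'| / r) := by gcongr
        _ = 2 / r * |y - y'| := by ring) ht 0
  have h3 : conv α 0 t (fun y => 1 - 2 * b (-y)) 0 = 1 + 2 * ∫ y, -(G α 0 t y * b y) := by
    unfold conv
    have h4 := integral_add i0 (i1.fun_neg.const_mul 2)
    rw [integral_G_zero h0 h1 ht, integral_const_mul] at h4
    rw [← h4, ← integral_sub_left_eq_self (fun y => G α 0 t y + 2 * -(G α 0 t y * b y)) volume 0]
    refine integral_congr_ae (Eventually.of_forall fun y => ?_)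
    simp only [zero_sub]
    ring
  rw [h3] at h2
  have := (abs_le.1 h2).2
  linarith

lemma kerNorm_zero (h0 : 0 < α) (h1 : α < 1) : kerNorm α 0 = 1 := by
  unfold kerNorm
  simp_rw [abs_of_nonneg (G_zero_nonneg h0 h1 one_pos _)]
  exact integral_G_zero h0 h1 one_pos

/-- Unit `L¹` norm of the kernel bounds the solution by `M` plus a vanishing source contribution at
small times. The maximum principle carries this to time `t`, and the small time is sent to zero. -/
theorem GlobalMild.abs_le_data (h0 : 0 < α) (h1 : α < 1) {f u₀ : ℝ → ℝ} {u : ℝ → ℝ → ℝ}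
    (hf : ContDiff ℝ ∞ f) (hs : HasCompactSupport f) (hu : GlobalMild α f u₀ u)
    (hm : AEStronglyMeasurable u₀) {M : ℝ} (hM : ∀ y, |u₀ y| ≤ M) (t x : ℝ) : |u t x| ≤ M := by
  obtain ⟨Cf, hCf⟩ := hs.exists_bound_of_continuous hf.continuous
  rcases le_or_gt t 0 with ht | ht
  · rw [hu.zero t ht, abs_zero]
    exact (abs_nonneg _).trans (hM 0)
  refine le_of_forall_pos_le_add fun η hη => ?_
  have h2 : Tendsto (fun t : ℝ => t ^ (1 - 1 / (α + 1)) / (1 - 1 / (α + 1)) *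
      (kerNorm α 1 * Cf)) (𝓝[>] 0) (𝓝 0) := by
    simpa using ((tendsto_rpow_nhdsGT_zero h0).div_const _).mul_const (kerNorm α 1 * Cf)
  obtain ⟨t', ⟨ht', hlt⟩, hη'⟩ := (Filter.Eventually.and (Ioo_mem_nhdsGT ht)
    (h2.eventually (gt_mem_nhds hη))).exists
  refine hu.abs_le_of_abs_le h0 h1 hf hs hm hM ht' hlt (fun y => ?_) x
  have h3 := hu.abs_le (t := t') h0 h1 hM hCf y
  rw [kerNorm_zero h0 h1, one_mul, abs_of_pos ht'] at h3
  linarith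

end Positivity

/-! ### Global solutions for arbitrary smooth flux -/

section Existence

variable {α : ℝ} {f u₀ : ℝ → ℝ}

lemma measurableSet_strip (δ : ℝ) (T : EReal) : MeasurableSet (strip δ T) :=
  (isOpen_strip δ T).measurableSet

/-- The solution for a truncated flux obeys the bound by its datum and so only takes values where
the truncation is inactive. It therefore satisfies the Duhamel formula for `f` itself. -/
theorem exists_smoothMildSolution (h0 : 0 < α) (h1 : α < 1) (hf : ContDiff ℝ ∞ f)
    (hu₀ : MemLp u₀ ⊤ volume) : ∃ v, IsSmoothMildSolution α f u₀ ⊤ v ∧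
      ∀ t : ℝ, supNorm (v t) ≤ supNorm u₀ := by
  have hfin : supNorm u₀ ≠ ⊤ := hu₀.2.ne
  set M := (supNorm u₀).toReal with hMdef
  have hM0 : 0 ≤ M := ENNReal.toReal_nonneg
  have hae := ae_abs_le_supNorm hfin
  -- Clamping turns the essential bound into a pointwise one without changing any convolution.
  set u₁ : ℝ → ℝ := fun y => max (-M) (min M (u₀ y)) with hu₁
  have hu₁m : AEStronglyMeasurable u₁ :=
    (Continuous.comp_aestronglyMeasurable (g := fun r : ℝ => max (-M) (min M r))
      (by fun_prop) hu₀.1)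
  have hu₁b : ∀ y, |u₁ y| ≤ M := fun y =>
    abs_le.2 ⟨le_max_left _ _, max_le (by linarith) (min_le_left _ _)⟩
  have hu₁e : u₁ =ᵐ[volume] u₀ := by
    filter_upwards [hae] with y hy
    have := abs_le.1 hy
    simp only [hu₁]
    rw [min_eq_right this.2, max_eq_right this.1]
  -- The radii exceed `M` by one and two so that they stay positive even when `M = 0`.
  let χ : ContDiffBump (0 : ℝ) := ⟨M + 1, M + 2, by linarith, by linarith⟩
  set f₁ : ℝ → ℝ := fun y => χ y * f y with hf₁
  have hf₁s : ContDiff ℝ ∞ f₁ := χ.contDiff.mul hf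
  have hf₁c : HasCompactSupport f₁ := χ.hasCompactSupport.mul_right
  have hf₁e : ∀ y, |y| ≤ M → f₁ y = f y := fun y hy => by
    have : χ y = 1 := χ.one_of_mem_closedBall (by
      rw [mem_closedBall_zero_iff, Real.norm_eq_abs]
      exact hy.trans (by linarith [show χ.rIn = M + 1 from rfl]))
    simp [hf₁, this]
  obtain ⟨v, hv⟩ := exists_globalMild h0 h1 hf₁s hf₁c hu₁m hu₁b
  have hvb := hv.abs_le_data h0 h1 hf₁s hf₁c hu₁m hu₁b
  refine ⟨v, ⟨⟨?_, ?_⟩, ?_⟩, fun t => ?_⟩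
  · exact memLp_top_of_bound hv.measurable.aestronglyMeasurable M
      (Eventually.of_forall fun p => hvb p.1 p.2)
  · refine ae_restrict_of_forall_mem (measurableSet_strip _ _) fun p hp => ?_
    have ht : 0 < p.1 := hp.1.1
    rw [duhamel_eq h0 h1 ht, hv.eq _ ht]
    congr 1
    · unfold conv
      refine integral_congr_ae ?_
      filter_upwards [hu₁e] with y hy
      rw [hy]
    · exact src_congr ht.le (fun s _ y => hf₁e _ (hvb s y)) _
  · exact hv.cbAwayFromZero h0 h1 hf₁s hf₁c hu₁m hu₁b EReal.zero_lt_top (B := M)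
      fun t _ x => hvb t x
  · rw [← ENNReal.ofReal_toReal hfin]
    exact supNorm_le (hvb t)

end Existence

/-! ### Uniqueness of smooth mild solutions -/

section Uniqueness

variable {α : ℝ} {f u₀ : ℝ → ℝ} {T : EReal}

lemma forall_le_of_ae_le_on {w : ℝ × ℝ → ℝ} {U : Set (ℝ × ℝ)} (hU : IsOpen U)
    (hc : ContinuousOn w U) {B : ℝ} (h : ∀ᵐ p ∂(volume.restrict U), w p ≤ B) :
    ∀ p ∈ U, w p ≤ B := by
  have ho : IsOpen (U ∩ w ⁻¹' Ioi B) := hc.isOpen_inter_preimage hU isOpen_Ioi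
  rw [ae_restrict_iff' hU.measurableSet] at h
  have h2 : volume (U ∩ w ⁻¹' Ioi B) = 0 := by
    refine measure_mono_null (fun p hp => ?_) h
    have h3 : B < w p := hp.2
    simp [hp.1, h3]
  have h3 := (ho.measure_eq_zero_iff volume).1 h2
  intro p hp
  by_contra! hlt
  exact (h3 ▸ (show p ∈ U ∩ w ⁻¹' Ioi B from ⟨hp, hlt⟩) : p ∈ (∅ : Set (ℝ × ℝ)))

lemma CbAwayFromZero.continuousOn {k : ℕ∞} {u : ℝ → ℝ → ℝ} (h : CbAwayFromZero k T u) :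
    ContinuousOn (Function.uncurry u) (strip 0 T) := by
  intro p hp
  have hp0 : 0 < p.1 := hp.1.1
  have hmem : p ∈ strip (p.1 / 2) T := ⟨⟨by linarith, hp.1.2⟩, mem_univ _⟩
  exact ((h (p.1 / 2) (by linarith)).1.continuousOn.continuousAt
    ((isOpen_strip _ _).mem_nhds hmem)).continuousWithinAt

/-- Truncation of a function to the time interval `(0, T)`. -/
def cutTime (T : EReal) (u : ℝ → ℝ → ℝ) (t x : ℝ) : ℝ :=
  open Classical in if t ∈ timeIoo 0 T then u t x else 0

lemma cutTime_of_mem {u : ℝ → ℝ → ℝ} {t : ℝ} (ht : t ∈ timeIoo 0 T) (x : ℝ) :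
    cutTime T u t x = u t x := if_pos ht

lemma IsSmoothMildSolution.exists_bound {u : ℝ → ℝ → ℝ} (h : IsSmoothMildSolution α f u₀ T u) :
    ∃ B, 0 ≤ B ∧ ∀ t x, |cutTime T u t x| ≤ B := by
  have hfin : eLpNormEssSup (Function.uncurry u) (volume.restrict (strip 0 T)) ≠ ⊤ := by
    have := h.1.1.2.ne
    rwa [eLpNorm_exponent_top] at this
  set B := (eLpNormEssSup (Function.uncurry u) (volume.restrict (strip 0 T))).toReal
  have h2 : ∀ᵐ p ∂(volume.restrict (strip 0 T)), |Function.uncurry u p| ≤ B := by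
    filter_upwards [ae_le_eLpNormEssSup (f := Function.uncurry u)
      (μ := volume.restrict (strip 0 T))] with p hp
    rw [← Real.norm_eq_abs, ← toReal_enorm]
    exact ENNReal.toReal_mono hfin hp
  have h3 := forall_le_of_ae_le_on (isOpen_strip 0 T) h.2.continuousOn.abs h2
  refine ⟨B, ENNReal.toReal_nonneg, fun t x => ?_⟩
  unfold cutTime
  split_ifs with ht
  · exact h3 (t, x) ⟨ht, mem_univ _⟩
  · rw [abs_zero]; exact ENNReal.toReal_nonneg

lemma IsSmoothMildSolution.measurable_cutTime {u : ℝ → ℝ → ℝ}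
    (h : IsSmoothMildSolution α f u₀ T u) : Measurable (Function.uncurry (cutTime T u)) := by
  refine measurable_of_continuousOn (isOpen_strip 0 T)
    (h.2.continuousOn.congr fun p hp => cutTime_of_mem hp.1 _) fun p hp => ?_
  exact if_neg fun ht => hp ⟨ht, mem_univ _⟩

lemma src_sub (h0 : 0 < α) (h1 : α < 1) {F F' : ℝ → ℝ → ℝ} {C : ℝ}
    (hF : Measurable (Function.uncurry F)) (hC : ∀ s y, |F s y| ≤ C)
    (hF' : Measurable (Function.uncurry F')) (hC' : ∀ s y, |F' s y| ≤ C) {t : ℝ} (ht : 0 ≤ t)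
    (x : ℝ) : src α F t x - src α F' t x = src α (fun s y => F s y - F' s y) t x := by
  rw [src_eq ht, src_eq ht, src_eq ht, ← integral_sub (integrableOn_conv h0 h1 hF hC t x)
    (integrableOn_conv h0 h1 hF' hC' t x)]
  refine setIntegral_congr_fun measurableSet_Ioo fun τ hτ => ?_
  exact (conv_sub h0 h1 (Or.inr le_rfl) hτ.1
    (hF.comp measurable_prodMk_left).aestronglyMeasurable (hC _)
    (hF'.comp measurable_prodMk_left).aestronglyMeasurable (hC' _) x).symm

/-- The convolution in time with `τ^{-1/(α+1)}` acts on `e^{γs}` with a factor that tends to zero as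
`γ → ∞`, a weighted substitute for a singular Gronwall inequality. -/
lemma abs_src_le_exp (h0 : 0 < α) (h1 : α < 1) {H : ℝ → ℝ → ℝ} {K γ : ℝ} (hγ : 0 < γ)
    {t : ℝ} (ht : 0 ≤ t) (hH : ∀ s ∈ Ioo 0 t, ∀ y, |H s y| ≤ K * Real.exp (γ * s)) (x : ℝ) :
    |src α H t x| ≤ (∫ τ, |expWeight α γ τ|) * (kerNorm α 1 * |K|) * Real.exp (γ * t) := by
  have hi := (integrable_expWeight h0 hγ).abs
  have k1 := kerNorm_nonneg α 1
  rw [src_eq ht, ← Real.norm_eq_abs]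
  have h2 : ‖∫ τ in Ioo 0 t, conv α 1 τ (H (t - τ)) x‖ ≤
      ∫ τ in Ioo 0 t, |expWeight α γ τ| * (kerNorm α 1 * |K| * Real.exp (γ * t)) := by
    refine norm_integral_le_of_norm_le (hi.mul_const _).integrableOn ?_
    filter_upwards [ae_restrict_mem measurableSet_Ioo] with τ hτ
    have h3 := abs_conv_le (q := 1) h0 h1 (Or.inr le_rfl) hτ.1
      (hH (t - τ) ⟨by linarith [hτ.2], by linarith [hτ.1]⟩) x
    have h4 : expWeight α γ τ = Real.exp (-(γ * τ)) * τ ^ (-(1 / (α + 1))) :=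
      indicator_of_mem (show τ ∈ Ioi (0 : ℝ) from hτ.1) _
    have hτ0 := hτ.1
    rw [h4, abs_of_nonneg (by positivity), Real.norm_eq_abs]
    refine h3.trans ?_
    have h5 : Real.exp (γ * (t - τ)) = Real.exp (-(γ * τ)) * Real.exp (γ * t) := by
      rw [← Real.exp_add]; ring_nf
    rw [h5]
    calc _ ≤ τ ^ (-(1 / (α + 1))) * (kerNorm α 1 * (|K| *
          (Real.exp (-(γ * τ)) * Real.exp (γ * t)))) := by gcongr; exact le_abs_self K
      _ = _ := by ring
  refine h2.trans ?_
  rw [integral_mul_const, mul_assoc (∫ τ, |expWeight α γ τ|)]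
  refine mul_le_mul_of_nonneg_right ?_ (mul_nonneg (by positivity) (Real.exp_pos _).le)
  exact setIntegral_le_integral hi (Eventually.of_forall fun _ => abs_nonneg _)

/-- Both solutions are bounded, so `f` is Lipschitz on their range. Subtracting the Duhamel formulas
makes the difference a fixed point of a contraction in the exponentially weighted norm. -/
theorem IsSmoothMildSolution.unique (h0 : 0 < α) (h1 : α < 1) (hf : ContDiff ℝ ∞ f)
    {u v : ℝ → ℝ → ℝ} (hu : IsSmoothMildSolution α f u₀ T u)
    (hv : IsSmoothMildSolution α f u₀ T v) : ∀ t ∈ timeIoo 0 T, ∀ x, u t x = v t x := by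
  obtain ⟨B₁, hB₁, hb₁⟩ := hu.exists_bound
  obtain ⟨B₂, hB₂, hb₂⟩ := hv.exists_bound
  set B := max B₁ B₂ with hB
  have hB0 : 0 ≤ B := hB₁.trans (le_max_left _ _)
  have hub : ∀ t x, cutTime T u t x ∈ Icc (-B) B := fun t x =>
    abs_le.1 ((hb₁ t x).trans (le_max_left _ _))
  have hvb : ∀ t x, cutTime T v t x ∈ Icc (-B) B := fun t x =>
    abs_le.1 ((hb₂ t x).trans (le_max_right _ _))
  obtain ⟨Cf, hCf⟩ := (isCompact_Icc (a := -B) (b := B)).exists_bound_of_continuousOn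
    hf.continuous.continuousOn
  obtain ⟨L, hL⟩ := (isCompact_Icc (a := -B) (b := B)).exists_bound_of_continuousOn
    (hf.continuous_deriv (by simp)).continuousOn
  have hL0 : 0 ≤ L := (norm_nonneg _).trans (hL 0 ⟨by linarith, hB0⟩)
  have hlip : ∀ a ∈ Icc (-B) B, ∀ b ∈ Icc (-B) B, |f a - f b| ≤ L * |a - b| := fun a ha b hb =>
    Convex.norm_image_sub_le_of_norm_deriv_le
      (fun x _ => hf.differentiable (by simp) x) hL (convex_Icc _ _) hb ha
  have k1 := kerNorm_nonneg α 1
  obtain ⟨γ, hγ, hγ0⟩ := (((tendsto_integral_expWeight h0).mul_const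
    (kerNorm α 1 * L)).eventually (gt_mem_nhds (by rw [zero_mul]; exact half_pos one_pos))
      |>.and (eventually_gt_atTop 0)).exists
  have hmu : Measurable (Function.uncurry fun s y => f (cutTime T u s y)) :=
    hf.continuous.measurable.comp hu.measurable_cutTime
  have hmv : Measurable (Function.uncurry fun s y => f (cutTime T v s y)) :=
    hf.continuous.measurable.comp hv.measurable_cutTime
  have hduh : ∀ w, ∀ t ∈ timeIoo 0 T, ∀ x, duhamel α f u₀ w t x =
      conv α 0 t u₀ x - src α (fun s y => f (cutTime T w s y)) t x := by
    intro w t ht x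
    rw [duhamel_eq h0 h1 ht.1]
    congr 1
    refine src_congr (le_of_lt ht.1) (fun s hs y => ?_) x
    rw [cutTime_of_mem ⟨hs.1, (EReal.coe_lt_coe_iff.2 hs.2).trans ht.2⟩]
  -- Each substitution into the Duhamel formula halves the constant in front of `e^{γt}`, starting
  -- from the crude bound `2B`.
  have hstep : ∀ n : ℕ, ∀ p ∈ strip 0 T, |Function.uncurry u p - Function.uncurry v p| -
      2 * B * (1 / 2) ^ n * Real.exp (γ * p.1) ≤ 0 := by
    intro n
    induction n with
    | zero =>
      intro p hp
      have h2 := hub p.1 p.2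
      have h3 := hvb p.1 p.2
      rw [cutTime_of_mem hp.1] at h2 h3
      have hp0 : 0 < p.1 := hp.1.1
      have h4 : 1 ≤ Real.exp (γ * p.1) := Real.one_le_exp (by positivity)
      have h5 : |Function.uncurry u p - Function.uncurry v p| ≤ 2 * B := by
        have e1 : Function.uncurry u p = u p.1 p.2 := rfl
        have e2 : Function.uncurry v p = v p.1 p.2 := rfl
        rw [e1, e2, abs_le]
        exact ⟨by linarith [h2.1, h3.2], by linarith [h2.2, h3.1]⟩
      rw [pow_zero, mul_one]
      nlinarith
    | succ n ih =>
      -- The Duhamel formula holds only almost everywhere. Continuity upgrades the improved bound to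
      -- every point before it is used again.
      refine forall_le_of_ae_le_on (isOpen_strip 0 T)
        (((hu.2.continuousOn.sub hv.2.continuousOn).abs).sub (by fun_prop)) ?_
      filter_upwards [hu.1.2, hv.1.2, ae_restrict_mem (measurableSet_strip 0 T)] with p hpu hpv hp
      have hp0 : 0 < p.1 := hp.1.1
      have e1 : Function.uncurry u p - Function.uncurry v p = -src α (fun s y =>
          f (cutTime T u s y) - f (cutTime T v s y)) p.1 p.2 := by
        rw [← src_sub h0 h1 hmu (fun s y => hCf _ (hub s y)) hmv (fun s y => hCf _ (hvb s y)) hp0.le]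
        have e2 : Function.uncurry u p = u p.1 p.2 := rfl
        have e3 : Function.uncurry v p = v p.1 p.2 := rfl
        rw [e2, e3, hpu, hpv, hduh u _ hp.1, hduh v _ hp.1]
        ring
      have h2 := abs_src_le_exp (K := L * (2 * B * (1 / 2) ^ n)) (t := p.1)
        (H := fun s y => f (cutTime T u s y) - f (cutTime T v s y)) h0 h1 hγ0 hp0.le
        (fun s hs y => by
          refine (hlip _ (hub s y) _ (hvb s y)).trans ?_
          have hs' : s ∈ timeIoo 0 T := ⟨hs.1, (EReal.coe_lt_coe_iff.2 hs.2).trans hp.1.2⟩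
          have h3 := ih (s, y) ⟨hs', mem_univ _⟩
          rw [cutTime_of_mem hs', cutTime_of_mem hs', mul_assoc]
          refine mul_le_mul_of_nonneg_left ?_ hL0
          simpa [Function.uncurry] using h3) p.2
      simp only [Pi.sub_apply]
      rw [e1, abs_neg, sub_nonpos]
      refine h2.trans (mul_le_mul_of_nonneg_right ?_ (Real.exp_pos _).le)
      rw [abs_of_nonneg (by positivity)]
      calc _ = (∫ τ, |expWeight α γ τ|) * (kerNorm α 1 * L) * (2 * B * (1 / 2) ^ n) := by ring
        _ ≤ 1 / 2 * (2 * B * (1 / 2) ^ n) := mul_le_mul_of_nonneg_right hγ.le (by positivity)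
        _ = _ := by ring
  intro t ht x
  have hlim : Tendsto (fun n : ℕ => 2 * B * (1 / 2) ^ n * Real.exp (γ * t)) atTop (𝓝 0) := by
    simpa using ((tendsto_pow_atTop_nhds_zero_of_lt_one (by norm_num : (0 : ℝ) ≤ 1 / 2)
      (by norm_num)).const_mul (2 * B)).mul_const (Real.exp (γ * t))
  have h2 : |u t x - v t x| ≤ 0 := ge_of_tendsto' hlim fun n => by
    have := hstep n (t, x) ⟨ht, mem_univ _⟩
    simpa [Function.uncurry] using this
  exact sub_eq_zero.1 (abs_nonpos_iff.1 h2)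

lemma strip_mono {T' : EReal} (h : T ≤ T') (δ : ℝ) : strip δ T ⊆ strip δ T' := fun _ hp =>
  ⟨⟨hp.1.1, hp.1.2.trans_le h⟩, mem_univ _⟩

lemma IsSmoothMildSolution.mono {T' : EReal} {u : ℝ → ℝ → ℝ}
    (hu : IsSmoothMildSolution α f u₀ T' u) (h : T ≤ T') : IsSmoothMildSolution α f u₀ T u :=
  ⟨⟨hu.1.1.mono_measure (Measure.restrict_mono (strip_mono h 0) le_rfl),
    ae_restrict_of_ae_restrict_of_subset (strip_mono h 0) hu.1.2⟩,
    fun δ hδ => ⟨(hu.2 δ hδ).1.mono (strip_mono h δ), fun m hm => by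
      obtain ⟨C, hC⟩ := (hu.2 δ hδ).2 m hm
      exact ⟨C, fun p hp => hC p (strip_mono h δ hp)⟩⟩⟩

end Uniqueness

end FracConsLaw

end

/-! ### Assembly -/

theorem mainTheorem5 (α : ℝ) (hα₀ : 0 < α) (hα₁ : α < 1) (f : ℝ → ℝ) (hf : ContDiff ℝ ∞ f) :
    -- the maximum principle for `C_b^2` solutions
    (∀ (T : EReal) (u : ℝ → ℝ → ℝ), 0 < T →
      FracConsLaw.CbAwayFromZero 2 T u → FracConsLaw.SolvesEquation α f T u →
      ∀ t' t : ℝ, 0 < t' → t' < t → (t : EReal) < T →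
        FracConsLaw.supNorm (u t) ≤ FracConsLaw.supNorm (u t')) ∧
    -- the bound by the initial datum, and the extension to a global solution
    (∀ (u₀ : ℝ → ℝ) (T : EReal) (u : ℝ → ℝ → ℝ),
      MeasureTheory.MemLp u₀ ⊤ MeasureTheory.volume → 0 < T →
      FracConsLaw.IsSmoothMildSolution α f u₀ T u →
      (∀ t : ℝ, 0 < t → (t : EReal) < T →
        FracConsLaw.supNorm (u t) ≤ FracConsLaw.supNorm u₀) ∧
      ∃ v : ℝ → ℝ → ℝ, FracConsLaw.IsSmoothMildSolution α f u₀ ⊤ v ∧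
        (∀ t : ℝ, 0 < t → (t : EReal) < T → v t = u t) ∧
        ∀ t : ℝ, 0 < t → FracConsLaw.supNorm (v t) ≤ FracConsLaw.supNorm u₀) ∧
    -- global existence for every bounded initial datum
    (∀ u₀ : ℝ → ℝ, MeasureTheory.MemLp u₀ ⊤ MeasureTheory.volume →
      ∃ v : ℝ → ℝ → ℝ, FracConsLaw.IsSmoothMildSolution α f u₀ ⊤ v ∧
        ∀ t : ℝ, 0 < t → FracConsLaw.supNorm (v t) ≤ FracConsLaw.supNorm u₀) := by
  refine ⟨fun T u _ hu hsol t' t ht' hlt htT =>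
    FracConsLaw.supNorm_antitone hα₀ hα₁ hf hu hsol ht' hlt htT, fun u₀ T u hu₀ _ hu => ?_,
    fun u₀ hu₀ => ?_⟩
  · obtain ⟨v, hv, hb⟩ := FracConsLaw.exists_smoothMildSolution hα₀ hα₁ hf hu₀
    -- The given solution is the restriction of the constructed global one, so it inherits its bound
    -- and needs no separate estimate near `t = 0`.
    have heq : ∀ t : ℝ, 0 < t → (t : EReal) < T → v t = u t := fun t ht htT =>
      funext fun x => (hv.mono le_top).unique hα₀ hα₁ hf hu t ⟨ht, htT⟩ x
    exact ⟨fun t ht htT => heq t ht htT ▸ hb t, v, hv, heq, fun t _ => hb t⟩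
  · obtain ⟨v, hv, hb⟩ := FracConsLaw.exists_smoothMildSolution hα₀ hα₁ hf hu₀
    exact ⟨v, hv, fun t _ => hb t⟩
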